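/- Let $\{X_t\}_{t\ge 0}$, $\{Y_t\}_{t\ge 0}$ and $\{\eta_t\}_{t\ge 0}$ be $d$-dimensional centered Gaussian processes, with $X$ and $Y$ jointly measurable in time and $\omega$, and let $\alpha>0$. Let $\gamma$ be one of the following on $\mathbb R^d$: the Dirac delta function $\delta$ (put $\beta=d$); $\gamma(x)=|x|^{-\beta}$ with $\beta\in(0,d)$; or $\gamma(x)=\prod_{i=1}^d|x_i|^{-\beta_i}$ with all $\beta_i\in(0,1)$ (put $\beta=\sum_i\beta_i$). Assume $\alpha\beta<1$. Suppose that (i) $\{X_{at},t\ge0\}\overset{d}{=}\{a^{\alpha}X_t,t\ge 0\}$ and $\{Y_{at},t\ge0\}\overset{d}{=}\{a^{\alpha}Y_t,t\ge 0\}$ for every $a>0$; (ii) $Y\overset{d}{=}X+\eta$; (iii) $X$ and $\eta$ are independent; (iv) for every $\varepsilon\in(0,1)$ there is a process $\eta^\varepsilon$ such that, for each $t\ge\varepsilon$, $\eta^\varepsilon_t=\eta_t$ almost surely, and such that almost surely $\{\eta^\varepsilon_t,t\in[0,1]\}$ belongs to the reproducing kernel Hilbert space of $\{X_t,t\in[0,1]\}$,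 i.e. to the completion of the linear span of the functions $t\mapsto R(t,s)v$ ($s\in[0,1]$, $v\in\mathbb R^d$) under the inner product $\langle R(\cdot,s)u,R(\cdot,t)v\rangle=u^{T}R(s,t)v$, where $R(s,t)=\mathbb E[X_sX_t^{T}]$. For a process $Z\in\{X,Y\}$ and $t\ge 0$, let $\int_0^t\gamma(Z_s)\,ds\in[0,\infty]$ be the pathwise integral if $\gamma$ is a function. If $\gamma=\delta$, let it be the local time of $Z$ at $0$, that is, the limit in $L^2$, as $\varepsilon\downarrow0$, of $\int_0^t p_\varepsilon(Z_s)\,ds$ with $p_\varepsilon(x)=(2\pi\varepsilon)^{-d/2}e^{-|x|^2/(2\varepsilon)}$. We say that $\lim_{t\to\infty}\frac1t\log\mathbb E\exp\left(\int_0^t\gamma(Z_s)\,ds\right)$ exists as a finite number if $\int_0^t\gamma(Z_s)\,ds$ is defined for every $t\ge0$ (when $\gamma=\delta$: the $L^2$ limit exists) and the limit exists in $\mathbb R$. If one of the two limits $$\lim_{t\to\infty}\frac1t\log\mathbb E\exp\left(\int_0^t\gamma(X_s)\,ds\right),\qquad \lim_{t\to\infty}\frac1t\log\mathbb E\exp\left(\int_0^t\gamma(Y_s)\,ds\right)$$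 exists as a finite number, then both exist as finite numbers and they are equal. -/

import Mathlib

open MeasureTheory ProbabilityTheory Filter Topology
open scoped NNReal ENNReal

namespace GaussianComparison

/-! ### The reproducing kernel Hilbert space of a process -/

section Kernel

variable {Ω : Type*} [MeasurableSpace Ω] {d : ℕ} {T : Type*}

/-- The (matrix-valued) covariance function `R(s, t) = 𝔼[X_s X_tᵀ]` of a centered `d`-dimensional
process `X` indexed by `T`, as an operator-valued kernel on `T`. -/
noncomputable def covKernel (P : Measure Ω) (X : T → Ω → EuclideanSpace ℝ (Fin d)) :
    Matrix T T (EuclideanSpace ℝ (Fin d) →L[ℝ] EuclideanSpace ℝ (Fin d)) :=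
  .of fun s t => Matrix.toEuclideanCLM (𝕜 := ℝ) (.of fun i j => ∫ ω, X s ω i * X t ω j ∂P)

lemma inner_covKernel {P : Measure Ω} {X : T → Ω → EuclideanSpace ℝ (Fin d)}
    (hX : ∀ t, MemLp (X t) 2 P) (s t : T) (v w : EuclideanSpace ℝ (Fin d)) :
    inner ℝ (covKernel P X s t v) w = ∫ ω, inner ℝ (X s ω) w * inner ℝ (X t ω) v ∂P := by
  have hc : ∀ t i, MemLp (fun ω => X t ω i) 2 P := fun t i =>
    ((EuclideanSpace.proj (𝕜 := ℝ) i).comp_memLp' (hX t) :)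
  have hint : ∀ i j, Integrable (fun ω => X s ω i * X t ω j) P := fun i j =>
    (hc s i).integrable_mul (hc t j)
  have e : ∀ ω, inner ℝ (X s ω) w * inner ℝ (X t ω) v
      = ∑ i, ∑ j, (w i * v j) * (X s ω i * X t ω j) := fun ω => by
    simp only [PiLp.inner_apply, RCLike.inner_apply, conj_trivial, Finset.sum_mul_sum]
    exact Finset.sum_congr rfl fun i _ => Finset.sum_congr rfl fun j _ => by ring
  simp only [e]
  rw [integral_finsetSum _ fun i _ => integrable_finsetSum _ fun j _ => (hint i j).const_mul _]
  simp only [covKernel, Matrix.of_apply, PiLp.inner_apply, RCLike.inner_apply, conj_trivial,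
    Matrix.ofLp_toEuclideanCLM, Matrix.mulVec, dotProduct, Finset.mul_sum]
  refine Finset.sum_congr rfl fun i _ => ?_
  rw [integral_finsetSum _ fun j _ => (hint i j).const_mul _]
  refine Finset.sum_congr rfl fun j _ => ?_
  rw [integral_const_mul]
  ring

/-- The covariance function of a square-integrable process (in particular of a Gaussian process)
is a positive semidefinite kernel. -/
lemma covKernel_posSemidef {P : Measure Ω} {X : T → Ω → EuclideanSpace ℝ (Fin d)}
    (hX : ∀ t, MemLp (X t) 2 P) : (covKernel P X).PosSemidef := by
  have h := (RKHS.posSemidef_tfae (K := covKernel P X)).out 0 2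
  refine h.2 ⟨?_, fun vv => ?_⟩
  · ext1 s t
    refine ContinuousLinearMap.ext fun v => ext_inner_right ℝ fun w => ?_
    rw [Matrix.conjTranspose_apply, ContinuousLinearMap.star_eq_adjoint,
      ContinuousLinearMap.adjoint_inner_left, real_inner_comm, inner_covKernel hX,
      inner_covKernel hX]
    exact integral_congr_ae (ae_of_all _ fun ω => mul_comm _ _)
  · have hl : ∀ t v, MemLp (fun ω => inner ℝ (X t ω) v) 2 P := fun t v => (hX t).inner_const v
    have key : (vv.sum fun x w => vv.sum fun x' w' => inner ℝ (covKernel P X x' x w) w')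
        = ∫ ω, (∑ x ∈ vv.support, inner ℝ (X x ω) (vv x)) ^ 2 ∂P := by
      have hi : ∀ i j, Integrable
          (fun ω => inner ℝ (X i ω) (vv i) * inner ℝ (X j ω) (vv j)) P :=
        fun i j => (hl i _).integrable_mul (hl j _)
      simp only [Finsupp.sum, inner_covKernel hX, sq, Finset.sum_mul_sum]
      rw [integral_finsetSum _ fun i _ => integrable_finsetSum _ fun j _ => hi i j,
        Finset.sum_comm]
      refine Finset.sum_congr rfl fun i _ => ?_
      rw [integral_finsetSum _ fun j _ => hi i j]
    rw [key]
    exact integral_nonneg fun ω => sq_nonneg _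

/-- `h` belongs to the reproducing kernel Hilbert space of `X`: the completion of the span of the
functions `R(·, t) v` under the inner product `⟨R(·, s) u, R(·, t) v⟩ = ⟨u, R(s, t) v⟩`. The
positive semidefiniteness needed to form it is automatic for square-integrable `X`, by
`covKernel_posSemidef`. -/
def MemRKHS (P : Measure Ω) (X : T → Ω → EuclideanSpace ℝ (Fin d))
    (h : T → EuclideanSpace ℝ (Fin d)) : Prop :=
  ∃ _ : Fact (covKernel P X).PosSemidef, ∃ f : RKHS.OfKernel (covKernel P X), ∀ t, f t = h t

end Kernel

/-! ### Self-similarity -/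

/-- `{X_{at}, t ≥ 0}` and `{a^α X_t, t ≥ 0}` have the same law (on the product space, i.e. the same
finite-dimensional distributions) for every `a > 0`. -/
def SelfSimilar {Ω : Type*} [MeasurableSpace Ω] {d : ℕ} (P : Measure Ω) (α : ℝ)
    (X : ℝ≥0 → Ω → EuclideanSpace ℝ (Fin d)) : Prop :=
  ∀ a : ℝ≥0, 0 < a →
    IdentDistrib (fun ω (t : ℝ≥0) => X (a * t) ω) (fun ω (t : ℝ≥0) => (a : ℝ) ^ α • X t ω) P P

/-! ### The functionals `∫₀ᵗ γ(X_s) ds` -/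

/-- The three families of `γ` on `ℝᵈ`: the Dirac delta function at `0`, `|x|^{-β}`, and
`∏ᵢ |xᵢ|^{-βᵢ}`. -/
inductive Potential (d : ℕ) : Type
  | delta : Potential d
  | riesz (β : ℝ) : Potential d
  | coordinates (β : Fin d → ℝ) : Potential d

namespace Potential

variable {d : ℕ}

/-- The number `β` in the homogeneity relation `γ(ax) = a^{-β} γ(x)`. -/
noncomputable def degree : Potential d → ℝ
  | delta => d
  | riesz β => β
  | coordinates β => ∑ i, β i

/-- The admissible exponents: `β ∈ (0, d)`, respectively `βᵢ ∈ (0, 1)` for all `i`. -/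
def Admissible : Potential d → Prop
  | delta => True
  | riesz β => 0 < β ∧ β < d
  | coordinates β => ∀ i, 0 < β i ∧ β i < 1

end Potential

/-- The heat kernel `p_ε(x) = (2πε)^{-d/2} exp(-|x|²/(2ε))` on `ℝᵈ`. -/
noncomputable def heatKernel {d : ℕ} (ε : ℝ) (x : EuclideanSpace ℝ (Fin d)) : ℝ :=
  (2 * Real.pi * ε) ^ (-(d : ℝ) / 2) * Real.exp (-‖x‖ ^ 2 / (2 * ε))

section Functional

variable {Ω : Type*} [MeasurableSpace Ω] {d : ℕ}

/-- `A` is (a version of) the random variable `∫₀ᵗ γ(X_s) ds`, with values in `[0, ∞]`.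
If `γ` is a function, it is the integral of the `[0, ∞]`-valued function `s ↦ γ(X_s)`, where
`0^{-β} = ∞`. If `γ = δ`, it is the local time of `X` at `0`, i.e. the limit in `L²(P)` of
`∫₀ᵗ p_ε(X_s) ds` as `ε ↓ 0`. -/
def IsPathIntegral (P : Measure Ω) (X : ℝ≥0 → Ω → EuclideanSpace ℝ (Fin d)) (t : ℝ≥0)
    (A : Ω → ℝ≥0∞) : Potential d → Prop
  | .delta => ∃ L : Ω → ℝ, MemLp L 2 P ∧
      Tendsto (fun ε : ℝ => eLpNorm
        (fun ω => (∫ s in Set.Ioc (0 : ℝ) t, heatKernel ε (X s.toNNReal ω)) - L ω) 2 P)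
        (𝓝[>] 0) (𝓝 0) ∧
      ∀ᵐ ω ∂P, A ω = ENNReal.ofReal (L ω)
  | .riesz β => ∀ᵐ ω ∂P, A ω = ∫⁻ s in Set.Ioc (0 : ℝ) t, ‖X s.toNNReal ω‖ₑ ^ (-β)
  | .coordinates β =>
      ∀ᵐ ω ∂P, A ω = ∫⁻ s in Set.Ioc (0 : ℝ) t, ∏ i, ‖X s.toNNReal ω i‖ₑ ^ (-β i)

/-- `∫₀ᵗ γ(X_s) ds` is defined for all `t ≥ 0`, and
`lim_{t → ∞} (1/t) log 𝔼 exp(∫₀ᵗ γ(X_s) ds)` exists and is the real number `ℓ`. The expectation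
takes values in `[0, ∞]` and its logarithm in `[-∞, ∞]`, so that no integrability convention
enters. -/
def HasExpGrowthRate (P : Measure Ω) (X : ℝ≥0 → Ω → EuclideanSpace ℝ (Fin d)) (γ : Potential d)
    (ℓ : ℝ) : Prop :=
  ∃ A : ℝ≥0 → Ω → ℝ≥0∞, (∀ t, IsPathIntegral P X t (A t) γ) ∧
    Tendsto (fun t : ℝ≥0 => ENNReal.log (∫⁻ ω, EReal.exp (A t ω : EReal) ∂P) / ((t : ℝ) : EReal))
      atTop (𝓝 (ℓ : EReal))

end Functional

end GaussianComparison

namespace GaussianComparison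

/-! ### Products of integrals -/

section Products

variable {ι α Ω : Type*} [Fintype ι] [MeasurableSpace α] [MeasurableSpace Ω]

/-! Only moments matter: expanding the exponential gives E exp(∫γ(Z)) = Σ_n E(∫γ(Z))^n / n!, and by
Tonelli the n-th moment is the integral over n times of E ∏ γ(Z_{s_i}), with δ replaced by heat
kernels. The growth rates agree as soon as, for every b > 1, there is a constant c > 0 independent
of n and t such that c M_X(n, t) ≤ M_Y(n, bt) and M_Y(n, t) ≤ M_X(n, t). Here M is `maxMoment`, the
n-th moment up to time t, or its supremum over the heat-kernel approximations when γ = δ. Summing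
over n and letting b ↓ 1 finishes the proof (`tendsto_log_div_iff_of_sandwich`).

Upper bound. Each γ is a positive mixture of functions with nonnegative Fourier density, so E ∏
γ(Z_{s_i}) is a positive integral of joint characteristic functions. That of X + η is the one of X,
which is positive, times one of modulus at most 1 (`charLE_add`, `CharLE.maxMoment_le`).

Lower bound. Condition on η. On times in [ε, 1] its path agrees with an element h of the RKHS of X,
with norm at most K on an event of probability more than 1/2. Cameron–Martin, together with the
symmetry of X and the evenness of γ, shows that the shift by h costs at most a factor exp(-K²/2),
uniformly in n (`exists_const_mul_le_of_rkhs`). The missing interval (0, ε] is recovered from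
self-similarity: it carries a scaled copy of the functional on (0, 1], and convexity of x ↦ x^n sums
the geometric scales at the price of a factor b^{(1-αβ)n}. This is exactly the effect of dilating
time by b (`exists_maxMoment_le_mul`).

Dirac case. The local time exists exactly when the second moments of its approximations are bounded,
a property that the sandwich transfers. L² convergence does not by itself control higher moments;
`lintegral_localTime_pow` identifies them by writing Z in law as c(Z + τZ') with an independent copy
Z', since averaging over Z' makes the approximations bounded. -/

lemma lintegral_fin_prod_eq_prod (μ : Measure α) [SigmaFinite μ] {n : ℕ}
    (f : Fin n → α → ℝ≥0∞) (hf : ∀ i, Measurable (f i)) :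
    ∫⁻ x : Fin n → α, ∏ i, f i (x i) ∂(Measure.pi fun _ => μ) = ∏ i, ∫⁻ x, f i x ∂μ := by
  induction n with
  | zero => simp
  | succ n ih =>
    have h := (measurePreserving_piFinSuccAbove (fun _ : Fin (n + 1) => μ) 0).symm
    rw [← h.lintegral_comp_emb (MeasurableEquiv.measurableEmbedding _)]
    simp only [MeasurableEquiv.piFinSuccAbove_symm_apply, Fin.insertNthEquiv,
      Fin.prod_univ_succ, Fin.insertNth_zero, Equiv.coe_fn_mk, Fin.cons_succ, Fin.cons_zero,
      Fin.zero_succAbove, cast_eq]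
    rw [lintegral_prod_mul (f := f 0) (g := fun x : Fin n → α => ∏ i, f i.succ (x i))
      (hf 0).aemeasurable, ih _ fun i => hf _]
    exact (Finset.measurable_prod _ fun i _ =>
      (hf _).comp (measurable_pi_apply i)).aemeasurable

lemma lintegral_fintype_prod_eq_prod (μ : Measure α) [SigmaFinite μ]
    (f : ι → α → ℝ≥0∞) (hf : ∀ i, Measurable (f i)) :
    ∫⁻ x : ι → α, ∏ i, f i (x i) ∂(Measure.pi fun _ => μ) = ∏ i, ∫⁻ x, f i x ∂μ := by
  let e := (Fintype.equivFin ι).symm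
  rw [← (measurePreserving_piCongrLeft (fun _ => μ) e).lintegral_comp_emb
    (MeasurableEquiv.measurableEmbedding _)]
  simp_rw [← e.prod_comp, MeasurableEquiv.coe_piCongrLeft, Equiv.piCongrLeft_apply_apply]
  exact lintegral_fin_prod_eq_prod μ _ fun i => hf _

/-- The expectation of a product of integrals is the multiple integral of the expected product. -/
lemma lintegral_prod_lintegral (P : Measure Ω) [SFinite P] (μ : Measure α) [SigmaFinite μ]
    (Φ : ι → α → Ω → ℝ≥0∞) (hΦ : ∀ i, Measurable (Function.uncurry (Φ i))) :
    ∫⁻ ω, ∏ i, ∫⁻ s, Φ i s ω ∂μ ∂P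
      = ∫⁻ s : ι → α, ∫⁻ ω, ∏ i, Φ i (s i) ω ∂P ∂(Measure.pi fun _ => μ) := by
  rw [← lintegral_lintegral_swap]
  · refine lintegral_congr fun ω => ?_
    exact (lintegral_fintype_prod_eq_prod μ (fun i s => Φ i s ω) fun i =>
      (hΦ i).comp (measurable_id.prodMk measurable_const)).symm
  · refine (Finset.measurable_prod _ fun i _ => ?_).aemeasurable
    have hp : Measurable fun p : Ω × (ι → α) => (p.2 i, p.1) :=
      ((measurable_pi_apply i).comp measurable_snd).prodMk measurable_fst
    exact (hΦ i).comp hp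

end Products

/-! ### Functions with a nonnegative Fourier density -/

section Fourier

variable {E : Type*} [NormedAddCommGroup E] [InnerProductSpace ℝ E] [FiniteDimensional ℝ E]
  [MeasurableSpace E] [BorelSpace E]

/-- `f` is the Fourier transform of the nonnegative integrable function `g`. -/
structure HasFourierDensity (f g : E → ℝ) : Prop where
  integrable : Integrable g
  nonneg : ∀ ξ, 0 ≤ g ξ
  eq_integral : ∀ x, (f x : ℂ) = ∫ ξ, (g ξ : ℂ) * Complex.exp ((inner ℝ x ξ : ℝ) * Complex.I)

/-- The joint characteristic function of a finite family of random vectors. -/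
noncomputable def jointChar {Ω ι : Type*} [MeasurableSpace Ω] [Fintype ι] (P : Measure Ω)
    (Z : ι → Ω → E) (ξ : ι → E) : ℂ :=
  ∫ ω, Complex.exp (((∑ i, inner ℝ (Z i ω) (ξ i) : ℝ) : ℂ) * Complex.I) ∂P

lemma HasFourierDensity.const_mul {f g : E → ℝ} (h : HasFourierDensity f g) {c : ℝ}
    (hc : 0 ≤ c) : HasFourierDensity (fun x => c * f x) (fun ξ => c * g ξ) where
  integrable := h.integrable.const_mul c
  nonneg ξ := mul_nonneg hc (h.nonneg ξ)
  eq_integral x := by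
    push_cast
    simp_rw [h.eq_integral x, mul_assoc]
    rw [integral_const_mul]

lemma HasFourierDensity.continuous {f g : E → ℝ} (h : HasFourierDensity f g) : Continuous f := by
  have : Continuous fun x => (f x : ℂ) := by
    simp_rw [h.eq_integral]
    refine continuous_of_dominated (bound := g) (fun x => ?_) (fun x => ?_) h.integrable ?_
    · exact (h.integrable.ofReal.aestronglyMeasurable.mul (by fun_prop))
    · refine ae_of_all _ fun ξ => ?_
      rw [norm_mul, Complex.norm_exp_ofReal_mul_I, mul_one, Complex.norm_real,
        Real.norm_of_nonneg (h.nonneg ξ)]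
    · exact ae_of_all _ fun ξ => by fun_prop
  simpa [Function.comp_def] using Complex.continuous_re.comp this

lemma HasFourierDensity.abs_le {f g : E → ℝ} (h : HasFourierDensity f g) (x : E) :
    |f x| ≤ ∫ ξ, g ξ := by
  have : ‖(f x : ℂ)‖ ≤ ∫ ξ, g ξ := by
    rw [h.eq_integral]
    refine (norm_integral_le_integral_norm _).trans_eq (integral_congr_ae (ae_of_all _ fun ξ => ?_))
    simp only
    rw [norm_mul, Complex.norm_exp_ofReal_mul_I, mul_one, Complex.norm_real,
        Real.norm_of_nonneg (h.nonneg ξ)]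
  simpa using this

variable {Ω Ω' ι : Type*} [MeasurableSpace Ω] [MeasurableSpace Ω'] [Fintype ι]

/-- Fubini after inserting the Fourier representation of every factor: the exponentials combine into
that of the joint characteristic function. -/
lemma integral_prod_eq_integral_jointChar {P : Measure Ω} [IsProbabilityMeasure P]
    {Z : ι → Ω → E} (hZ : ∀ i, Measurable (Z i)) {f g : ι → E → ℝ}
    (h : ∀ i, HasFourierDensity (f i) (g i)) :
    ((∫ ω, ∏ i, f i (Z i ω) ∂P : ℝ) : ℂ)
      = ∫ ξ : ι → E, ((∏ i, g i (ξ i) : ℝ) : ℂ) * jointChar P Z ξ := by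
  have e : ∀ ω, ((∏ i, f i (Z i ω) : ℝ) : ℂ) = ∫ ξ : ι → E, ((∏ i, g i (ξ i) : ℝ) : ℂ) *
      Complex.exp (((∑ i, inner ℝ (Z i ω) (ξ i) : ℝ) : ℂ) * Complex.I) := fun ω => by
    push_cast
    simp_rw [fun i => (h i).eq_integral (Z i ω), Finset.sum_mul, Complex.exp_sum,
      ← Finset.prod_mul_distrib]
    exact (integral_fintype_prod_volume_eq_prod (𝕜 := ℂ) (fun i (ξ : E) => (g i ξ : ℂ) *
      Complex.exp ((inner ℝ (Z i ω) ξ : ℝ) * Complex.I))).symm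
  rw [← integral_complex_ofReal]
  simp_rw [e]
  have hg : Integrable fun ξ : ι → E => ((∏ i, g i (ξ i) : ℝ) : ℂ) :=
    (Integrable.fintype_prod fun i => (h i).integrable).ofReal
  rw [integral_integral_swap]
  · simp_rw [jointChar, integral_const_mul]
  · have h1 : Integrable (fun p : Ω × (ι → E) => ((∏ i, g i (p.2 i) : ℝ) : ℂ))
        (P.prod volume) := hg.comp_snd P
    refine h1.mul_bdd (c := 1) ?_ ?_
    · refine (Measurable.aestronglyMeasurable ?_)
      refine Complex.measurable_exp.comp ((Complex.measurable_ofReal.comp ?_).mul_const _)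
      refine Finset.measurable_sum _ fun i _ => ?_
      exact ((hZ i).comp measurable_fst).inner ((measurable_pi_apply i).comp measurable_snd)
    · exact ae_of_all _ fun p => by rw [Complex.norm_exp_ofReal_mul_I]

/-- Comparison of expected products of functions with nonnegative Fourier densities. -/
lemma integral_prod_le_integral_prod {P : Measure Ω} [IsProbabilityMeasure P]
    {P' : Measure Ω'} [IsProbabilityMeasure P'] {Z : ι → Ω → E} (hZ : ∀ i, Measurable (Z i))
    {X : ι → Ω' → E} (hX : ∀ i, Measurable (X i)) {f g f' g' : ι → E → ℝ}
    (h : ∀ i, HasFourierDensity (f i) (g i)) (h' : ∀ i, HasFourierDensity (f' i) (g' i))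
    (hle : ∀ ξ : ι → E, ‖jointChar P Z ξ‖ * ∏ i, g i (ξ i)
      ≤ (jointChar P' X ξ).re * ∏ i, g' i (ξ i)) :
    ∫ ω, ∏ i, f i (Z i ω) ∂P ≤ ∫ ω, ∏ i, f' i (X i ω) ∂P' := by
  have hm : ∀ ξ, ‖jointChar P' X ξ‖ ≤ 1 := fun ξ => by
    refine (norm_integral_le_integral_norm _).trans ?_
    simp_rw [Complex.norm_exp_ofReal_mul_I]
    simp
  have hmeas : StronglyMeasurable fun ξ : ι → E => jointChar P' X ξ := by
    refine StronglyMeasurable.integral_prod_right (f := fun (ξ : ι → E) (ω : Ω') =>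
      Complex.exp (((∑ i, inner ℝ (X i ω) (ξ i) : ℝ) : ℂ) * Complex.I)) ?_
    refine Measurable.stronglyMeasurable ?_
    refine Complex.measurable_exp.comp ((Complex.measurable_ofReal.comp ?_).mul_const _)
    refine Finset.measurable_sum _ fun i _ => ?_
    exact ((hX i).comp measurable_snd).inner ((measurable_pi_apply i).comp measurable_fst)
  have hg : Integrable fun ξ : ι → E => ((∏ i, g' i (ξ i) : ℝ) : ℂ) :=
    (Integrable.fintype_prod fun i => (h' i).integrable).ofReal
  have hint : Integrable fun ξ : ι → E => ((∏ i, g' i (ξ i) : ℝ) : ℂ) * jointChar P' X ξ :=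
    hg.mul_bdd (c := 1) hmeas.aestronglyMeasurable (ae_of_all _ hm)
  have e1 := integral_prod_eq_integral_jointChar (P := P) hZ h
  have e2 := integral_prod_eq_integral_jointChar (P := P') hX h'
  have hre : ∫ ω, ∏ i, f' i (X i ω) ∂P'
      = ∫ ξ : ι → E, (jointChar P' X ξ).re * ∏ i, g' i (ξ i) := by
    rw [← Complex.ofReal_re (∫ ω, ∏ i, f' i (X i ω) ∂P'), e2]
    refine (integral_re hint).symm.trans ?_
    refine integral_congr_ae (ae_of_all _ fun ξ => ?_)
    change (((∏ i, g' i (ξ i) : ℝ) : ℂ) * jointChar P' X ξ).re = _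
    rw [Complex.re_ofReal_mul, mul_comm]
  have hint' : Integrable fun ξ : ι → E => (jointChar P' X ξ).re * ∏ i, g' i (ξ i) := by
    refine hint.re.congr (ae_of_all _ fun ξ => ?_)
    change (((∏ i, g' i (ξ i) : ℝ) : ℂ) * jointChar P' X ξ).re = _
    rw [Complex.re_ofReal_mul, mul_comm]
  calc ∫ ω, ∏ i, f i (Z i ω) ∂P ≤ ‖((∫ ω, ∏ i, f i (Z i ω) ∂P : ℝ) : ℂ)‖ := by
        rw [Complex.norm_real]; exact Real.le_norm_self _
    _ ≤ ∫ ξ : ι → E, ‖((∏ i, g i (ξ i) : ℝ) : ℂ) * jointChar P Z ξ‖ := by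
        rw [e1]; exact norm_integral_le_integral_norm _
    _ ≤ ∫ ξ : ι → E, (jointChar P' X ξ).re * ∏ i, g' i (ξ i) := by
        refine integral_mono_of_nonneg (ae_of_all _ fun ξ => norm_nonneg _) hint'
          (ae_of_all _ fun ξ => ?_)
        simp only
        rw [norm_mul, Complex.norm_real, Real.norm_of_nonneg
          (Finset.prod_nonneg fun i _ => (h i).nonneg _), mul_comm]
        exact hle ξ
    _ = _ := hre.symm

lemma lintegral_prod_ofReal {P : Measure Ω} [IsProbabilityMeasure P]
    {Z : ι → Ω → E} (hZ : ∀ i, Measurable (Z i)) {f g : ι → E → ℝ}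
    (h : ∀ i, HasFourierDensity (f i) (g i)) (hf : ∀ i x, 0 ≤ f i x) :
    ∫⁻ ω, ∏ i, ENNReal.ofReal (f i (Z i ω)) ∂P
      = ENNReal.ofReal (∫ ω, ∏ i, f i (Z i ω) ∂P) := by
  have hm : Measurable fun ω => ∏ i, f i (Z i ω) := Finset.measurable_prod _ fun i _ =>
    (h i).continuous.measurable.comp (hZ i)
  rw [ofReal_integral_eq_lintegral_ofReal]
  · exact lintegral_congr fun ω => (ENNReal.ofReal_prod_of_nonneg fun i _ => hf i _).symm
  · refine Integrable.of_bound hm.aestronglyMeasurable (∏ i, ∫ ξ, g i ξ) (ae_of_all _ fun ω => ?_)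
    rw [norm_prod]
    exact Finset.prod_le_prod (fun i _ => norm_nonneg _) fun i _ => (h i).abs_le _
  · exact ae_of_all _ fun ω => Finset.prod_nonneg fun i _ => hf i _

lemma lintegral_prod_le_lintegral_prod {P : Measure Ω} [IsProbabilityMeasure P]
    {P' : Measure Ω'} [IsProbabilityMeasure P'] {Z : ι → Ω → E} (hZ : ∀ i, Measurable (Z i))
    {X : ι → Ω' → E} (hX : ∀ i, Measurable (X i)) {f g f' g' : ι → E → ℝ}
    (h : ∀ i, HasFourierDensity (f i) (g i)) (h' : ∀ i, HasFourierDensity (f' i) (g' i))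
    (hf : ∀ i x, 0 ≤ f i x) (hf' : ∀ i x, 0 ≤ f' i x)
    (hle : ∀ ξ : ι → E, ‖jointChar P Z ξ‖ * ∏ i, g i (ξ i)
      ≤ (jointChar P' X ξ).re * ∏ i, g' i (ξ i)) :
    ∫⁻ ω, ∏ i, ENNReal.ofReal (f i (Z i ω)) ∂P
      ≤ ∫⁻ ω, ∏ i, ENNReal.ofReal (f' i (X i ω)) ∂P' := by
  rw [lintegral_prod_ofReal hZ h hf, lintegral_prod_ofReal hX h' hf']
  exact ENNReal.ofReal_le_ofReal (integral_prod_le_integral_prod hZ hX h h' hle)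

/-- Averaging over independent shifts multiplies the Fourier density by the characteristic
function of the shift. -/
lemma HasFourierDensity.average {f g : E → ℝ} (h : HasFourierDensity f g) {P : Measure Ω}
    [IsProbabilityMeasure P] {W : Ω → E} (hW : Measurable W) {φ : E → ℝ}
    (hφ : ∀ ξ, ∫ ω, Complex.exp ((inner ℝ (W ω) ξ : ℝ) * Complex.I) ∂P = φ ξ)
    (hφ0 : ∀ ξ, 0 ≤ φ ξ) :
    HasFourierDensity (fun x => ∫ ω, f (x + W ω) ∂P) (fun ξ => g ξ * φ ξ) := by
  have hmeas : StronglyMeasurable fun ξ : E => (φ ξ : ℂ) := by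
    simp_rw [← hφ]
    refine StronglyMeasurable.integral_prod_right (f := fun (ξ : E) (ω : Ω) =>
      Complex.exp ((inner ℝ (W ω) ξ : ℝ) * Complex.I)) ?_
    exact (Complex.measurable_exp.comp ((Complex.measurable_ofReal.comp
      ((hW.comp measurable_snd).inner measurable_fst)).mul_const _)).stronglyMeasurable
  have hb : ∀ ξ, ‖(φ ξ : ℂ)‖ ≤ 1 := fun ξ => by
    rw [← hφ]
    refine (norm_integral_le_integral_norm _).trans ?_
    simp_rw [Complex.norm_exp_ofReal_mul_I]
    simp
  refine ⟨?_, fun ξ => mul_nonneg (h.nonneg ξ) (hφ0 ξ), fun x => ?_⟩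
  · have := (h.integrable.ofReal (𝕜 := ℂ)).mul_bdd (c := 1) hmeas.aestronglyMeasurable
      (ae_of_all _ hb)
    refine this.re.congr (ae_of_all _ fun ξ => ?_)
    simp
  · rw [← integral_complex_ofReal]
    simp_rw [h.eq_integral]
    rw [integral_integral_swap]
    · refine integral_congr_ae (ae_of_all _ fun ξ => ?_)
      simp only
      push_cast
      rw [← hφ, mul_assoc, ← integral_mul_const, ← integral_const_mul]
      refine integral_congr_ae (ae_of_all _ fun ω => ?_)
      simp only
      rw [inner_add_left, ← Complex.exp_add]
      push_cast
      ring_nf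
    · have h1 : Integrable (fun p : Ω × E => (g p.2 : ℂ)) (P.prod volume) :=
        (h.integrable.ofReal (𝕜 := ℂ)).comp_snd P
      refine h1.mul_bdd (c := 1) ?_ ?_
      · exact (Complex.measurable_exp.comp ((Complex.measurable_ofReal.comp
          ((measurable_const.add (hW.comp measurable_fst)).inner
            measurable_snd)).mul_const _)).aestronglyMeasurable
      · exact ae_of_all _ fun p => by rw [Complex.norm_exp_ofReal_mul_I]

lemma hasFourierDensity_gaussian {b : ℝ} (hb : 0 < b) :
    HasFourierDensity
      (fun x : E => (Real.pi / b) ^ ((Module.finrank ℝ E : ℝ) / 2) * Real.exp (-‖x‖ ^ 2 / (4 * b)))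
      (fun ξ => Real.exp (-b * ‖ξ‖ ^ 2)) where
  integrable := by
    have := (GaussianFourier.integrable_cexp_neg_mul_sq_norm_add (b := (b : ℂ)) (by simpa) 0
      (0 : E)).re
    refine this.congr (ae_of_all _ fun ξ => ?_)
    change (Complex.exp (-(b : ℂ) * (‖ξ‖ : ℂ) ^ 2 + 0 * _)).re = _
    rw [zero_mul, add_zero]
    norm_cast
  nonneg ξ := (Real.exp_pos _).le
  eq_integral x := by
    have := GaussianFourier.integral_cexp_neg_mul_sq_norm_add (b := (b : ℂ)) (by simpa) Complex.I x
    have hc : ∀ v : E, ((Real.exp (-b * ‖v‖ ^ 2) : ℝ) : ℂ) *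
        Complex.exp ((inner ℝ x v : ℝ) * Complex.I)
        = Complex.exp (-(b : ℂ) * (‖v‖ : ℂ) ^ 2 + Complex.I * (inner ℝ x v : ℝ)) := fun v => by
      rw [Complex.exp_add]
      push_cast
      ring_nf
    simp_rw [hc]
    rw [this]
    push_cast
    rw [Complex.ofReal_cpow (by positivity)]
    push_cast
    rw [Complex.I_sq]
    ring_nf

end Fourier

/-! ### Comparison of processes through their characteristic functions -/

section Mixture

/-- The Gamma integral, read as a positive mixture of Gaussians over the scale u. It replaces the
Fourier transform of the singular power by those of integrable functions. -/
lemma enorm_rpow_neg_eq_lintegral {E : Type*} [NormedAddCommGroup E] {β : ℝ} (hβ : 0 < β) (x : E) :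
    ‖x‖ₑ ^ (-β) = ∫⁻ u in Set.Ioi (0 : ℝ), ENNReal.ofReal
      (u ^ (β / 2 - 1) / Real.Gamma (β / 2) * Real.exp (-(u * ‖x‖ ^ 2))) := by
  have hG : 0 < Real.Gamma (β / 2) := Real.Gamma_pos_of_pos (by positivity)
  -- At the origin both sides are infinite, because a pure power is never integrable on the whole
  -- half-line.
  rcases eq_or_ne x 0 with rfl | hx
  · simp only [enorm_zero, norm_zero, ne_eq, OfNat.ofNat_ne_zero, not_false_eq_true, zero_pow,
      mul_zero, neg_zero, Real.exp_zero, mul_one]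
    rw [ENNReal.zero_rpow_of_neg (by linarith)]
    by_contra hne
    have hni := not_integrableOn_Ioi_rpow (β / 2 - 1)
    apply hni
    have hm : Measurable fun u : ℝ => u ^ (β / 2 - 1) / Real.Gamma (β / 2) := by fun_prop
    have : IntegrableOn (fun u : ℝ => u ^ (β / 2 - 1) / Real.Gamma (β / 2)) (Set.Ioi 0) := by
      refine (lintegral_ofReal_ne_top_iff_integrable hm.aestronglyMeasurable ?_).1 (Ne.symm hne)
      filter_upwards [ae_restrict_mem measurableSet_Ioi] with u hu
      exact div_nonneg (Real.rpow_nonneg (le_of_lt hu) _) hG.le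
    refine (this.mul_const (Real.Gamma (β / 2))).congr (ae_of_all _ fun u => ?_)
    simp only
    field_simp
  · have hr : 0 < ‖x‖ ^ 2 := by positivity
    have hI := Real.integral_rpow_mul_exp_neg_mul_Ioi (a := β / 2) (r := ‖x‖ ^ 2)
      (by positivity) hr
    have hpos : 0 < (1 / ‖x‖ ^ 2) ^ (β / 2) * Real.Gamma (β / 2) := by positivity
    have hint : IntegrableOn (fun t : ℝ => t ^ (β / 2 - 1) * Real.exp (-(‖x‖ ^ 2 * t)))
        (Set.Ioi 0) := by
      by_contra h
      rw [integral_undef h] at hI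
      exact hpos.ne hI
    have e : ∀ u : ℝ, u ^ (β / 2 - 1) / Real.Gamma (β / 2) * Real.exp (-(u * ‖x‖ ^ 2))
        = (Real.Gamma (β / 2))⁻¹ * (u ^ (β / 2 - 1) * Real.exp (-(‖x‖ ^ 2 * u))) := fun u => by
      rw [mul_comm u]; field_simp
    simp_rw [e]
    rw [← ofReal_integral_eq_lintegral_ofReal (hint.const_mul _), integral_const_mul, hI]
    · rw [mul_comm, mul_assoc, mul_inv_cancel₀ hG.ne', mul_one, ← ofReal_norm,
        ENNReal.ofReal_rpow_of_pos (by positivity)]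
      congr 1
      rw [Real.rpow_neg (norm_nonneg _), one_div, Real.inv_rpow (by positivity),
        ← Real.rpow_natCast, ← Real.rpow_mul (norm_nonneg _)]
      congr 2
      push_cast
      ring
    · filter_upwards [ae_restrict_mem measurableSet_Ioi] with u hu
      have : 0 < u := hu
      positivity

variable {E : Type*} [NormedAddCommGroup E] [InnerProductSpace ℝ E] [FiniteDimensional ℝ E]
  [MeasurableSpace E] [BorelSpace E]

lemma hasFourierDensity_exp_neg_mul_sq {u : ℝ} (hu : 0 < u) :
    ∃ g : E → ℝ, HasFourierDensity (fun x : E => Real.exp (-(u * ‖x‖ ^ 2))) g := by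
  have hb : 0 < 1 / (4 * u) := by positivity
  have h := (hasFourierDensity_gaussian (E := E) hb).const_mul
    (c := ((Real.pi / (1 / (4 * u))) ^ ((Module.finrank ℝ E : ℝ) / 2))⁻¹) (by positivity)
  suffices e : (fun x : E => Real.exp (-(u * ‖x‖ ^ 2))) = fun x =>
      ((Real.pi / (1 / (4 * u))) ^ ((Module.finrank ℝ E : ℝ) / 2))⁻¹ *
        ((Real.pi / (1 / (4 * u))) ^ ((Module.finrank ℝ E : ℝ) / 2) *
          Real.exp (-‖x‖ ^ 2 / (4 * (1 / (4 * u))))) by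
    rw [e]; exact ⟨_, h⟩
  ext x
  rw [← mul_assoc, inv_mul_cancel₀ (by positivity), one_mul]
  congr 1
  field_simp

variable {Ω Ω' ι : Type*} [MeasurableSpace Ω] [MeasurableSpace Ω'] [Fintype ι]

/-- Comparison of expected products of negative powers of the norm. -/
lemma lintegral_prod_enorm_rpow_le {P : Measure Ω} [IsProbabilityMeasure P]
    {P' : Measure Ω'} [IsProbabilityMeasure P'] {Z : ι → Ω → E} (hZ : ∀ i, Measurable (Z i))
    {X : ι → Ω' → E} (hX : ∀ i, Measurable (X i))
    (hle : ∀ ξ : ι → E, ‖jointChar P Z ξ‖ ≤ (jointChar P' X ξ).re)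
    {β : ι → ℝ} (hβ : ∀ i, 0 < β i) :
    ∫⁻ ω, ∏ i, ‖Z i ω‖ₑ ^ (-β i) ∂P ≤ ∫⁻ ω, ∏ i, ‖X i ω‖ₑ ^ (-β i) ∂P' := by
  obtain ⟨k, hk⟩ : ∃ k : ι → ℝ → E → ℝ≥0∞, ∀ i u x, k i u x = ENNReal.ofReal
    (u ^ (β i / 2 - 1) / Real.Gamma (β i / 2) * Real.exp (-(u * ‖x‖ ^ 2))) :=
    ⟨_, fun _ _ _ => rfl⟩
  have hm : ∀ i, Measurable fun p : ℝ × E => k i p.1 p.2 := fun i => by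
    simp only [hk]; fun_prop
  have e : ∀ i x, ‖x‖ₑ ^ (-β i) = ∫⁻ u in Set.Ioi (0 : ℝ), k i u x := fun i x => by
    simp only [hk]
    exact enorm_rpow_neg_eq_lintegral (hβ i) x
  have e1 := lintegral_prod_lintegral P (volume.restrict (Set.Ioi (0 : ℝ)))
    (fun i u ω => k i u (Z i ω))
    (fun i => (hm i).comp (measurable_fst.prodMk ((hZ i).comp measurable_snd)))
  have e2 := lintegral_prod_lintegral P' (volume.restrict (Set.Ioi (0 : ℝ)))
    (fun i u ω => k i u (X i ω))
    (fun i => (hm i).comp (measurable_fst.prodMk ((hX i).comp measurable_snd)))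
  simp_rw [e]
  rw [e1, e2]
  have hpos : ∀ᵐ u : ι → ℝ ∂(Measure.pi fun _ => volume.restrict (Set.Ioi (0 : ℝ))),
      ∀ i, 0 < u i := by
    rw [ae_all_iff]
    intro i
    exact Measure.tendsto_eval_ae_ae.eventually (ae_restrict_mem measurableSet_Ioi)
  refine lintegral_mono_ae ?_
  filter_upwards [hpos] with u hu
  have hw : ∀ i, 0 ≤ u i ^ (β i / 2 - 1) / Real.Gamma (β i / 2) := fun i =>
    div_nonneg (Real.rpow_nonneg (hu i).le _) (Real.Gamma_pos_of_pos (by linarith [hβ i])).le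
  choose g hg using fun i => hasFourierDensity_exp_neg_mul_sq (E := E) (hu i)
  have h := fun i => (hg i).const_mul (hw i)
  simp only [hk]
  refine lintegral_prod_le_lintegral_prod hZ hX h h (fun i x => ?_) (fun i x => ?_) fun ξ => ?_
  · exact mul_nonneg (hw i) (Real.exp_pos _).le
  · exact mul_nonneg (hw i) (Real.exp_pos _).le
  · exact mul_le_mul_of_nonneg_right (hle ξ) (Finset.prod_nonneg fun i _ => (h i).nonneg _)

end Mixture

/-- The characteristic functions of the finite-dimensional distributions of `Z` are dominated by
those of `X`. -/
def CharLE {Ω Ω' T E : Type*} [MeasurableSpace Ω] [MeasurableSpace Ω'] [NormedAddCommGroup E]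
    [InnerProductSpace ℝ E] (P : Measure Ω) (Z : T → Ω → E) (P' : Measure Ω')
    (X : T → Ω' → E) : Prop :=
  ∀ (n : ℕ) (s : Fin n → T) (ξ : Fin n → E),
    ‖∫ ω, Complex.exp (((∑ i, inner ℝ (Z (s i) ω) (ξ i) : ℝ) : ℂ) * Complex.I) ∂P‖
      ≤ (∫ ω, Complex.exp (((∑ i, inner ℝ (X (s i) ω) (ξ i) : ℝ) : ℂ) * Complex.I) ∂P').re

/-! ### Positivity, symmetry and scaling of the three potentials -/

section Family

variable {d : ℕ}

/-- The functions whose integrals along the path define the functional of the potential: the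
potential itself, or the heat kernels approximating the Dirac function. -/
noncomputable def Potential.family : Potential d → Set (EuclideanSpace ℝ (Fin d) → ℝ≥0∞)
  | .delta => {f | ∃ ε : ℝ, 0 < ε ∧ f = fun x => ENNReal.ofReal (heatKernel ε x)}
  | .riesz β => {fun x => ‖x‖ₑ ^ (-β)}
  | .coordinates β => {fun x => ∏ i, ‖x i‖ₑ ^ (-β i)}

/-- Matches `hasFourierDensity_gaussian` with b = ε/2; the factor (2π)^{-d} is the constant of
Fourier inversion. -/
lemma heatKernel_eq {ε : ℝ} (hε : 0 < ε) (x : EuclideanSpace ℝ (Fin d)) :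
    heatKernel ε x = ((2 * Real.pi) ^ d)⁻¹ * ((Real.pi / (ε / 2)) ^
      ((Module.finrank ℝ (EuclideanSpace ℝ (Fin d)) : ℝ) / 2) *
        Real.exp (-‖x‖ ^ 2 / (4 * (ε / 2)))) := by
  have hpi := Real.pi_pos
  rw [heatKernel, finrank_euclideanSpace_fin, ← mul_assoc]
  congr 1
  · rw [neg_div, Real.rpow_neg (by positivity),
      show Real.pi / (ε / 2) = (2 * Real.pi) ^ 2 / (2 * Real.pi * ε) by field_simp,
      Real.div_rpow (by positivity) (by positivity), ← Real.rpow_natCast (2 * Real.pi) 2,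
      ← Real.rpow_mul (by positivity), ← Real.rpow_natCast]
    have : ((2 : ℕ) : ℝ) * ((d : ℝ) / 2) = d := by push_cast; ring
    rw [this]
    field_simp
  · congr 1
    ring

lemma hasFourierDensity_heatKernel {ε : ℝ} (hε : 0 < ε) :
    HasFourierDensity (heatKernel ε : EuclideanSpace ℝ (Fin d) → ℝ)
      (fun ξ => ((2 * Real.pi) ^ d)⁻¹ * Real.exp (-(ε / 2) * ‖ξ‖ ^ 2)) := by
  have h := (hasFourierDensity_gaussian (E := EuclideanSpace ℝ (Fin d))
    (half_pos hε)).const_mul (c := ((2 * Real.pi) ^ d)⁻¹) (by positivity)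
  have e : (heatKernel ε : EuclideanSpace ℝ (Fin d) → ℝ) = _ := funext fun x => heatKernel_eq hε x
  rw [e]
  exact h

lemma heatKernel_nonneg {ε : ℝ} (hε : 0 < ε) (x : EuclideanSpace ℝ (Fin d)) :
    0 ≤ heatKernel ε x := by
  have := Real.pi_pos
  unfold heatKernel
  positivity

lemma heatKernel_div_sq {ε c : ℝ} (hε : 0 < ε) (hc : 0 < c) (x : EuclideanSpace ℝ (Fin d)) :
    heatKernel (ε / c ^ 2) x = c ^ d * heatKernel ε (c • x) := by
  have hpi := Real.pi_pos
  simp only [heatKernel, norm_smul, Real.norm_of_nonneg hc.le]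
  rw [← mul_assoc]
  congr 1
  · rw [show 2 * Real.pi * (ε / c ^ 2) = (2 * Real.pi * ε) * (c ^ (2 : ℝ))⁻¹ by
      rw [Real.rpow_two]; ring, Real.mul_rpow (x := 2 * Real.pi * ε) (by positivity)
      (by positivity), Real.inv_rpow (by positivity), ← Real.rpow_neg (by positivity),
      ← Real.rpow_mul hc.le, mul_comm, ← Real.rpow_natCast c d]
    congr 2
    ring
  · congr 1
    field_simp

lemma Potential.measurable_of_mem_family {γ : Potential d}
    {f : EuclideanSpace ℝ (Fin d) → ℝ≥0∞} (hf : f ∈ γ.family) : Measurable f := by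
  cases γ with
  | delta =>
    obtain ⟨ε, hε, rfl⟩ := hf
    exact (hasFourierDensity_heatKernel hε).continuous.measurable.ennreal_ofReal
  | riesz β =>
    rw [Potential.family, Set.mem_singleton_iff] at hf
    rw [hf]; fun_prop
  | coordinates β =>
    rw [Potential.family, Set.mem_singleton_iff] at hf
    rw [hf]; fun_prop

/-- Evenness will allow the shifts by h and by -h to be averaged in the Cameron–Martin bound. -/
lemma Potential.even_of_mem_family {γ : Potential d}
    {f : EuclideanSpace ℝ (Fin d) → ℝ≥0∞} (hf : f ∈ γ.family) (x) : f (-x) = f x := by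
  cases γ with
  | delta =>
    obtain ⟨ε, hε, rfl⟩ := hf
    simp [heatKernel]
  | riesz β =>
    rw [Potential.family, Set.mem_singleton_iff] at hf
    simp [hf]
  | coordinates β =>
    rw [Potential.family, Set.mem_singleton_iff] at hf
    simp [hf]

/-- Homogeneity of degree -β. A function potential is fixed by the rescaling; for δ the heat kernel
of width ε becomes the one of width ε / a^{2α}. Only the family as a whole is invariant, which is
why suprema over it are used later. -/
lemma Potential.rescale_mem_family {γ : Potential d}
    {f : EuclideanSpace ℝ (Fin d) → ℝ≥0∞} (hf : f ∈ γ.family) {α a : ℝ} (ha : 0 < a) :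
    (fun x => ENNReal.ofReal (a ^ (α * γ.degree)) * f (a ^ α • x)) ∈ γ.family := by
  have hp : 0 < a ^ α := Real.rpow_pos_of_pos ha _
  have hb : ∀ β : ℝ, ENNReal.ofReal (a ^ (α * β)) * ENNReal.ofReal (a ^ α) ^ (-β) = 1 := fun β => by
    rw [ENNReal.ofReal_rpow_of_pos hp, ← ENNReal.ofReal_mul (by positivity), Real.rpow_mul ha.le,
      Real.rpow_neg hp.le, mul_inv_cancel₀ (by positivity), ENNReal.ofReal_one]
  have hm : ∀ (y : ℝ≥0∞) (β : ℝ), (ENNReal.ofReal (a ^ α) * y) ^ β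
      = ENNReal.ofReal (a ^ α) ^ β * y ^ β := fun y β => by
    rw [ENNReal.mul_rpow_eq_ite]
    simp [hp]
  cases γ with
  | delta =>
    obtain ⟨ε, hε, rfl⟩ := hf
    refine ⟨ε / (a ^ α) ^ 2, by positivity, funext fun x => ?_⟩
    rw [← ENNReal.ofReal_mul (by positivity), heatKernel_div_sq hε hp, Real.rpow_mul ha.le,
      Potential.degree, Real.rpow_natCast]
  | riesz β =>
    rw [Potential.family, Set.mem_singleton_iff] at hf ⊢
    funext x
    rw [hf]
    simp only [Potential.degree, enorm_smul]
    rw [Real.enorm_of_nonneg hp.le, hm, ← mul_assoc, hb, one_mul]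
  | coordinates β =>
    rw [Potential.family, Set.mem_singleton_iff] at hf ⊢
    funext x
    rw [hf]
    simp only [Potential.degree, PiLp.smul_apply, smul_eq_mul, enorm_mul]
    rw [Real.enorm_of_nonneg hp.le]
    simp_rw [hm]
    rw [Finset.mul_sum, Real.rpow_sum_of_pos ha, ENNReal.ofReal_prod_of_nonneg
      fun i _ => Real.rpow_nonneg ha.le _, ← Finset.prod_mul_distrib]
    refine Finset.prod_congr rfl fun i _ => ?_
    rw [← mul_assoc, hb, one_mul]

variable {Ω Ω' T : Type*} [MeasurableSpace Ω] [MeasurableSpace Ω']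

lemma CharLE.lintegral_prod_le {P : Measure Ω} [IsProbabilityMeasure P]
    {P' : Measure Ω'} [IsProbabilityMeasure P'] {Z : T → Ω → EuclideanSpace ℝ (Fin d)}
    (hZ : ∀ t, Measurable (Z t)) {X : T → Ω' → EuclideanSpace ℝ (Fin d)}
    (hX : ∀ t, Measurable (X t)) (h : CharLE P Z P' X) {γ : Potential d} (hγ : γ.Admissible)
    {f : EuclideanSpace ℝ (Fin d) → ℝ≥0∞} (hf : f ∈ γ.family) {n : ℕ} (s : Fin n → T) :
    ∫⁻ ω, ∏ i, f (Z (s i) ω) ∂P ≤ ∫⁻ ω, ∏ i, f (X (s i) ω) ∂P' := by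
  cases γ with
  | delta =>
    obtain ⟨ε, hε, rfl⟩ := hf
    refine lintegral_prod_le_lintegral_prod (fun i => hZ (s i)) (fun i => hX (s i))
      (fun _ => hasFourierDensity_heatKernel hε) (fun _ => hasFourierDensity_heatKernel hε)
      (fun _ => heatKernel_nonneg hε) (fun _ => heatKernel_nonneg hε) fun ξ => ?_
    refine mul_le_mul_of_nonneg_right (h n s ξ) (Finset.prod_nonneg fun i _ => ?_)
    exact (hasFourierDensity_heatKernel hε).nonneg _
  | riesz β =>
    rw [Potential.family, Set.mem_singleton_iff] at hf
    rw [hf]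
    exact lintegral_prod_enorm_rpow_le (fun i => hZ (s i)) (fun i => hX (s i)) (h n s)
      (β := fun _ => β) fun _ => hγ.1
  | coordinates β =>
    rw [Potential.family, Set.mem_singleton_iff] at hf
    rw [hf]
    -- The n vectors are regarded as n·d scalar variables, so the product potential becomes a
    -- product of one-dimensional negative powers.
    simp_rw [← Fintype.prod_prod_type']
    refine lintegral_prod_enorm_rpow_le (E := ℝ) (ι := Fin n × Fin d)
      (Z := fun p ω => Z (s p.1) ω p.2) (X := fun p ω => X (s p.1) ω p.2) (fun p => ?_)
      (fun p => ?_) (fun ξ => ?_) (β := fun p => β p.2) fun p => (hγ p.2).1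
    · have := hZ (s p.1)
      fun_prop
    · have := hX (s p.1)
      fun_prop
    · convert! h n s fun i => WithLp.toLp 2 fun j => ξ (i, j) using 1
      · simp [jointChar, Fintype.sum_prod_type, PiLp.inner_apply]
      · simp [jointChar, Fintype.sum_prod_type, PiLp.inner_apply]

end Family

/-! ### Centered Gaussian families -/

section Gaussian

variable {Ω Ω' T ι E : Type*} [MeasurableSpace Ω] [MeasurableSpace Ω'] [Fintype ι]
  [NormedAddCommGroup E] [InnerProductSpace ℝ E] [FiniteDimensional ℝ E]
  [MeasurableSpace E] [BorelSpace E] {P : Measure Ω} {X : T → Ω → E}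

lemma hasGaussianLaw_tuple (hX : IsGaussianProcess X P) (s : ι → T) :
    HasGaussianLaw (fun ω i => X (s i) ω) P := by
  have h := (hX.comp_right s).hasGaussianLaw Finset.univ
  exact h.map_fun (ContinuousLinearMap.pi fun i : ι =>
    ContinuousLinearMap.proj (R := ℝ) (φ := fun _ : (Finset.univ : Finset ι) => E)
      ⟨i, Finset.mem_univ i⟩)

lemma hasGaussianLaw_sum_inner {Z : ι → Ω → E} (hZ : HasGaussianLaw (fun ω i => Z i ω) P)
    (ξ : ι → E) : HasGaussianLaw (fun ω => ∑ i, inner ℝ (Z i ω) (ξ i)) P := by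
  have h := hZ.map_fun (∑ i, (innerSL ℝ (ξ i)).comp
    (ContinuousLinearMap.proj (R := ℝ) (φ := fun _ : ι => E) i))
  convert! h using 2 with ω
  simp [real_inner_comm]

lemma integral_sum_inner_eq_zero {Z : ι → Ω → E} (hZ : HasGaussianLaw (fun ω i => Z i ω) P)
    (hc : ∀ i, ∫ ω, Z i ω ∂P = 0) (ξ : ι → E) :
    ∫ ω, ∑ i, inner ℝ (Z i ω) (ξ i) ∂P = 0 := by
  have hi : ∀ i, Integrable (Z i) P := fun i => (hZ.eval i).integrable
  rw [integral_finsetSum _ fun i _ => (hi i).inner_const (ξ i)]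
  refine Finset.sum_eq_zero fun i _ => ?_
  simp_rw [fun ω => real_inner_comm (ξ i) (Z i ω)]
  rw [integral_inner (hi i), hc, inner_zero_right]

/-- The joint characteristic function of a centered Gaussian family. -/
lemma jointChar_eq_exp {Z : ι → Ω → E} (hZ : HasGaussianLaw (fun ω i => Z i ω) P)
    (hc : ∀ i, ∫ ω, Z i ω ∂P = 0) (ξ : ι → E) :
    jointChar P Z ξ = (Real.exp (-(∫ ω, (∑ i, inner ℝ (Z i ω) (ξ i)) ^ 2 ∂P) / 2) : ℝ) := by
  have hV := hasGaussianLaw_sum_inner hZ ξ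
  have h := hV.charFun_map_eq 1
  have h0 := integral_sum_inner_eq_zero hZ hc ξ
  have hm := hV.aemeasurable
  rw [charFun_apply, integral_map hm (by fun_prop)] at h
  have e1 : ∀ x : ℝ, inner ℝ 1 x = x := fun x => by simp
  have e2 : ∀ x : ℝ, inner ℝ x 1 = x := fun x => by simp
  simp only [e1, e2, h0, variance_of_integral_eq_zero hm h0] at h
  rw [jointChar, h]
  push_cast
  simp
  ring_nf

/-- A centered Gaussian vector has a symmetric law. -/
lemma map_neg_eq_map {F : Type*} [NormedAddCommGroup F] [NormedSpace ℝ F] [CompleteSpace F]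
    [SecondCountableTopology F] [MeasurableSpace F] [BorelSpace F] {Z : Ω → F}
    (hZ : HasGaussianLaw Z P) (hc : ∫ ω, Z ω ∂P = 0) :
    P.map (fun ω => -Z ω) = P.map Z := by
  have := hZ.isProbabilityMeasure
  have := hZ.isGaussian_map
  have := hZ.fun_neg.isGaussian_map
  refine Measure.ext_of_charFunDual ?_
  ext L
  have hL : ∫ ω, L (Z ω) ∂P = 0 := by
    rw [L.integral_comp_comm hZ.integrable, hc, map_zero]
  rw [hZ.charFunDual_map_eq_fun, hZ.fun_neg.charFunDual_map_eq_fun]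
  simp only [map_neg, integral_neg, hL, variance_fun_neg]
  simp

/-- Independence factors the characteristic function of the sum. The factor of X is real and
positive because X is centered Gaussian, and the factor of η has modulus at most 1. -/
lemma charLE_add {η : T → Ω → E} [IsProbabilityMeasure P] (hX : IsGaussianProcess X P)
    (hXm : ∀ t, Measurable (X t)) (hηm : ∀ t, Measurable (η t))
    (hc : ∀ t, ∫ ω, X t ω ∂P = 0)
    (hind : IndepFun (fun ω t => X t ω) (fun ω t => η t ω) P) :
    CharLE P (fun t ω => X t ω + η t ω) P X := by
  intro n s ξ
  have h1 := jointChar_eq_exp (hasGaussianLaw_tuple hX s) (fun i => hc (s i)) ξ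
  rw [jointChar] at h1
  rw [h1, Complex.ofReal_re]
  have hm : ∀ s' : Fin n → T, Measurable fun x : T → E =>
      Complex.exp (((∑ i, inner ℝ (x (s' i)) (ξ i) : ℝ) : ℂ) * Complex.I) := fun s' => by
    refine Complex.measurable_exp.comp ((Complex.measurable_ofReal.comp ?_).mul_const _)
    exact Finset.measurable_sum _ fun i _ => (measurable_pi_apply _).inner measurable_const
  have h2 := (hind.comp (hm s) (hm s)).integral_fun_mul_eq_mul_integral
    ((hm s).comp (measurable_pi_lambda _ hXm)).aestronglyMeasurable
    ((hm s).comp (measurable_pi_lambda _ hηm)).aestronglyMeasurable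
  simp only [Function.comp_apply] at h2
  simp_rw [inner_add_left, Finset.sum_add_distrib, Complex.ofReal_add, add_mul, Complex.exp_add]
  rw [h2, norm_mul, h1, Complex.norm_real, Real.norm_of_nonneg (Real.exp_pos _).le]
  refine mul_le_of_le_one_right (Real.exp_pos _).le ?_
  refine (norm_integral_le_integral_norm _).trans ?_
  simp_rw [Complex.norm_exp_ofReal_mul_I]
  simp

lemma CharLE.of_identDistrib {P' : Measure Ω'} {Y : T → Ω' → E}
    {Ω₂ : Type*} [MeasurableSpace Ω₂] {P₂ : Measure Ω₂} {X₂ : T → Ω₂ → E}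
    (hY : IdentDistrib (fun ω t => Y t ω) (fun ω t => X t ω) P' P)
    (h : CharLE P X P₂ X₂) : CharLE P' Y P₂ X₂ := by
  intro n s ξ
  refine le_trans (le_of_eq ?_) (h n s ξ)
  have hm : Measurable fun x : T → E =>
      Complex.exp (((∑ i, inner ℝ (x (s i)) (ξ i) : ℝ) : ℂ) * Complex.I) := by
    refine Complex.measurable_exp.comp ((Complex.measurable_ofReal.comp ?_).mul_const _)
    exact Finset.measurable_sum _ fun i _ => (measurable_pi_apply _).inner measurable_const
  exact congrArg _ (hY.comp hm).integral_eq

end Gaussian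

/-! ### Shifts along the reproducing kernel Hilbert space -/

section CameronMartin

variable {Ω ι E : Type*} [MeasurableSpace Ω] [Fintype ι]
  [NormedAddCommGroup E] [InnerProductSpace ℝ E] [FiniteDimensional ℝ E]
  [MeasurableSpace E] [BorelSpace E] {P : Measure Ω}

/-- exp(u - v/2) is the density of N(v, v) with respect to N(0, v); shifting by the variance itself
makes the coefficient of u equal to 1. -/
lemma lintegral_gaussianReal_add (v : ℝ≥0) (hv : v ≠ 0) {F : ℝ → ℝ≥0∞} (hF : Measurable F) :
    ∫⁻ u, F (u + v) ∂(gaussianReal 0 v)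
      = ∫⁻ u, ENNReal.ofReal (Real.exp (u - v / 2)) * F u ∂(gaussianReal 0 v) := by
  have h1 : ∫⁻ u, F (u + v) ∂(gaussianReal 0 v) = ∫⁻ u, F u ∂(gaussianReal v v) := by
    have := gaussianReal_map_add_const (μ := 0) (v := v) (v : ℝ)
    rw [zero_add] at this
    rw [← this, lintegral_map hF (measurable_add_const _)]
  have hv' : (0 : ℝ) < v := by positivity
  rw [h1, gaussianReal_of_var_ne_zero _ hv, gaussianReal_of_var_ne_zero _ hv,
    lintegral_withDensity_eq_lintegral_mul _ (measurable_gaussianPDF _ _) hF,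
    lintegral_withDensity_eq_lintegral_mul _ (measurable_gaussianPDF _ _) (by fun_prop)]
  refine lintegral_congr fun u => ?_
  simp only [Pi.mul_apply]
  rw [← mul_assoc]
  congr 1
  rw [gaussianPDF, gaussianPDF, ← ENNReal.ofReal_mul (gaussianPDFReal_nonneg _ _ _)]
  congr 1
  simp only [gaussianPDFReal]
  rw [mul_assoc _ (Real.exp _), ← Real.exp_add]
  congr 2
  field_simp
  ring

/-- The Cameron–Martin formula for a finite centered Gaussian family. -/
lemma lintegral_add_eq_lintegral_exp_mul [IsProbabilityMeasure P] {Z : ι → Ω → E}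
    (hZ : HasGaussianLaw (fun ω i => Z i ω) P) (hZm : ∀ i, Measurable (Z i))
    (hc : ∀ i, ∫ ω, Z i ω ∂P = 0) (w h : ι → E)
    (hh : ∀ i, ∫ ω, (∑ j, inner ℝ (Z j ω) (w j)) • Z i ω ∂P = h i)
    {v : ℝ≥0} (hv0 : v ≠ 0) (hv : ∫ ω, (∑ j, inner ℝ (Z j ω) (w j)) ^ 2 ∂P = v)
    {G : (ι → E) → ℝ≥0∞} (hG : Measurable G) :
    ∫⁻ ω, G (fun i => Z i ω + h i) ∂P = ∫⁻ ω, ENNReal.ofReal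
      (Real.exp ((∑ j, inner ℝ (Z j ω) (w j)) - v / 2)) * G (fun i => Z i ω) ∂P := by
  set U : Ω → ℝ := fun ω => ∑ j, inner ℝ (Z j ω) (w j) with hU
  -- The residual of Z after regression on U. Since h is the covariance of U with Z and v is the
  -- variance of U, R is uncorrelated with U, hence independent of it by joint Gaussianity.
  set R : Ω → ι → E := fun ω i => Z i ω - (U ω / v) • h i with hR
  have hv' : (v : ℝ) ≠ 0 := by exact_mod_cast hv0
  have hUm : Measurable U := Finset.measurable_sum _ fun i _ => (hZm i).inner measurable_const
  have hRm : Measurable R := measurable_pi_lambda _ fun i =>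
    (hZm i).sub ((hUm.div_const _).smul_const _)
  have hUg : HasGaussianLaw U P := hasGaussianLaw_sum_inner hZ w
  have hU0 : ∫ ω, U ω ∂P = 0 := integral_sum_inner_eq_zero hZ hc w
  have hRU : HasGaussianLaw (fun ω => (R ω, U ω)) P := by
    let ℓ : (ι → E) →L[ℝ] ℝ := ∑ i, (innerSL ℝ (w i)).comp
      (ContinuousLinearMap.proj (R := ℝ) (φ := fun _ : ι => E) i)
    have := hZ.map_fun ((ContinuousLinearMap.id ℝ (ι → E) - ℓ.smulRight ((v : ℝ)⁻¹ • h)).prod ℓ)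
    have eℓ : ∀ ω, ℓ (fun i => Z i ω) = U ω := fun ω => by simp [ℓ, hU, real_inner_comm]
    convert! this using 2 with ω
    simp only [ContinuousLinearMap.prod_apply, eℓ, Prod.mk.injEq, and_true]
    ext1 i
    simp [hR, eℓ, smul_smul, div_eq_mul_inv]
  have hUZ : ∀ i, Integrable (fun ω => U ω • Z i ω) P := fun i =>
    memLp_one_iff_integrable.1 ((hZ.eval i).memLp_two.smul hUg.memLp_two)
  have hind : IndepFun R U P := by
    refine hRU.indepFun_of_covariance_strongDual fun L₁ L₂ => ?_
    have e2 : (L₂ ∘ U) = fun ω => L₂ 1 * U ω := funext fun ω => by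
      rw [Function.comp_apply, ← mul_one (U ω), ← smul_eq_mul (U ω), map_smul, smul_eq_mul,
        smul_eq_mul, mul_one, mul_comm]
    have hRint : Integrable (fun ω => U ω • R ω) P :=
      memLp_one_iff_integrable.1 (hRU.fst.memLp_two.smul hUg.memLp_two)
    have hUR : ∫ ω, U ω • R ω ∂P = 0 := by
      ext1 i
      rw [eval_integral fun j => hRint.eval j]
      have : ∀ ω, (U ω • R ω) i = U ω • Z i ω - (U ω ^ 2) • ((v : ℝ)⁻¹ • h i) := fun ω => by
        simp only [hR, Pi.smul_apply, smul_sub, smul_smul]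
        congr 2
        ring
      simp_rw [this]
      rw [integral_sub (hUZ i) (hUg.memLp_two.integrable_sq.smul_const _), hh,
        integral_smul_const, hv, smul_smul, mul_inv_cancel₀ hv', one_smul, sub_self, Pi.zero_apply]
    rw [e2, covariance_const_mul_right, covariance_eq_sub, hU0, mul_zero, sub_zero]
    · have : ∀ ω, ((L₁ ∘ R) * U) ω = L₁ (U ω • R ω) := fun ω => by
        simp [mul_comm]
      simp_rw [this]
      rw [L₁.integral_comp_comm hRint, hUR, map_zero, mul_zero]
    · exact (hRU.fst.map L₁).memLp_two
    · exact hUg.memLp_two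
  have hmap : P.map (fun ω => (R ω, U ω)) = (P.map R).prod (gaussianReal 0 v) := by
    rw [(indepFun_iff_map_prod_eq_prod_map_map hRm.aemeasurable hUm.aemeasurable).1 hind,
      hUg.map_eq_gaussianReal, hU0, variance_of_integral_eq_zero hUm.aemeasurable hU0]
    simp [hU, hv]
  have hRm' : IsProbabilityMeasure (P.map R) := Measure.isProbabilityMeasure_map hRm.aemeasurable
  have key : ∀ Φ : (ι → E) × ℝ → ℝ≥0∞, Measurable Φ → ∫⁻ ω, Φ (R ω, U ω) ∂P
      = ∫⁻ r, ∫⁻ u, Φ (r, u) ∂(gaussianReal 0 v) ∂(P.map R) := fun Φ hΦ => by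
    rw [← lintegral_prod _ hΦ.aemeasurable, ← hmap,
      lintegral_map hΦ (hRm.prodMk hUm)]
  have eZ : ∀ ω, (fun i => Z i ω) = fun i => R ω i + (U ω / v) • h i := fun ω => by
    ext1 i; simp [hR]
  -- Shifting Z by h leaves R fixed and shifts U by v, so the problem becomes one-dimensional.
  have eZh : ∀ ω, (fun i => Z i ω + h i) = fun i => R ω i + ((U ω + v) / v) • h i := fun ω => by
    ext1 i
    simp only [hR]
    rw [add_div, div_self hv', add_smul, one_smul]
    abel
  calc ∫⁻ ω, G (fun i => Z i ω + h i) ∂P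
      = ∫⁻ ω, G (fun i => R ω i + ((U ω + v) / v) • h i) ∂P := by simp_rw [eZh]
    _ = ∫⁻ r, ∫⁻ u, G (fun i => r i + ((u + v) / v) • h i) ∂(gaussianReal 0 v) ∂(P.map R) :=
        key (fun p => G (fun i => p.1 i + ((p.2 + v) / v) • h i)) (hG.comp (by fun_prop))
    _ = ∫⁻ r, ∫⁻ u, ENNReal.ofReal (Real.exp (u - v / 2)) *
          G (fun i => r i + (u / v) • h i) ∂(gaussianReal 0 v) ∂(P.map R) := by
        refine lintegral_congr fun r => ?_
        exact lintegral_gaussianReal_add v hv0 (F := fun u => G (fun i => r i + (u / v) • h i))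
          (hG.comp (by fun_prop))
    _ = ∫⁻ ω, ENNReal.ofReal (Real.exp (U ω - v / 2)) *
          G (fun i => R ω i + (U ω / v) • h i) ∂P :=
        (key (fun p => ENNReal.ofReal (Real.exp (p.2 - v / 2)) *
          G (fun i => p.1 i + (p.2 / v) • h i)) (by fun_prop)).symm
    _ = ∫⁻ ω, ENNReal.ofReal (Real.exp (U ω - v / 2)) * G (fun i => Z i ω) ∂P := by
        simp_rw [eZ]

/-- By the symmetry of Z and the evenness of G, the Cameron–Martin weight exp(U - v/2) may be
replaced by its average with exp(-U - v/2). This average is cosh(U) exp(-v/2), which is at least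
exp(-K²/2). -/
lemma lintegral_le_lintegral_add [IsProbabilityMeasure P] {Z : ι → Ω → E}
    (hZ : HasGaussianLaw (fun ω i => Z i ω) P) (hZm : ∀ i, Measurable (Z i))
    (hc : ∀ i, ∫ ω, Z i ω ∂P = 0) (w h : ι → E)
    (hh : ∀ i, ∫ ω, (∑ j, inner ℝ (Z j ω) (w j)) • Z i ω ∂P = h i)
    {K : ℝ} (hK : ∫ ω, (∑ j, inner ℝ (Z j ω) (w j)) ^ 2 ∂P ≤ K ^ 2)
    {G : (ι → E) → ℝ≥0∞} (hG : Measurable G) (hGe : ∀ x, G (-x) = G x) :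
    ENNReal.ofReal (Real.exp (-K ^ 2 / 2)) * ∫⁻ ω, G (fun i => Z i ω) ∂P
      ≤ ∫⁻ ω, G (fun i => Z i ω + h i) ∂P := by
  set U : Ω → ℝ := fun ω => ∑ j, inner ℝ (Z j ω) (w j) with hU
  have hZm' : Measurable fun ω i => Z i ω := measurable_pi_lambda _ hZm
  have hUg : HasGaussianLaw U P := hasGaussianLaw_sum_inner hZ w
  have hv0 : 0 ≤ ∫ ω, U ω ^ 2 ∂P := integral_nonneg fun ω => sq_nonneg _
  obtain ⟨v, hv⟩ : ∃ v : ℝ≥0, ∫ ω, U ω ^ 2 ∂P = v := ⟨⟨_, hv0⟩, rfl⟩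
  -- If U has variance zero, it vanishes almost surely, so h = 0 and there is no shift.
  rcases eq_or_ne v 0 with rfl | hvne
  · have hU0 : ∀ᵐ ω ∂P, U ω = 0 := by
      have := (integral_eq_zero_iff_of_nonneg (fun ω => sq_nonneg (U ω))
        hUg.memLp_two.integrable_sq).1 (by simpa using hv)
      filter_upwards [this] with ω hω
      simpa using hω
    have hh0 : ∀ i, h i = 0 := fun i => by
      rw [← hh i, integral_eq_zero_of_ae]
      filter_upwards [hU0] with ω hω
      simp only [hU] at hω
      simp [hω]
    simp only [hh0, add_zero]
    refine mul_le_of_le_one_left zero_le ?_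
    rw [ENNReal.ofReal_le_one, Real.exp_le_one_iff]
    nlinarith [sq_nonneg K]
  · rw [lintegral_add_eq_lintegral_exp_mul hZ hZm hc w h hh hvne hv hG]
    have hI : ∫ ω, (fun i => Z i ω) ∂P = 0 := by
      ext1 i
      rw [eval_integral fun j => (hZ.eval j).integrable, hc, Pi.zero_apply]
    have hsym := map_neg_eq_map hZ hI
    set F : ℝ → (ι → E) → ℝ≥0∞ := fun c z => ENNReal.ofReal
      (Real.exp (c * (∑ j, inner ℝ (z j) (w j)) - v / 2)) * G z with hF
    have hFm : ∀ c, Measurable (F c) := fun c => by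
      refine Measurable.mul ?_ hG
      refine (Real.measurable_exp.comp (((Finset.measurable_sum _ fun i _ =>
        (measurable_pi_apply _).inner measurable_const).const_mul _).sub_const _)).ennreal_ofReal
    have e : ∫⁻ ω, F 1 (fun i => Z i ω) ∂P = ∫⁻ ω, F (-1) (fun i => Z i ω) ∂P := by
      have h1 : ∫⁻ ω, F 1 (-fun i => Z i ω) ∂P = ∫⁻ ω, F 1 (fun i => Z i ω) ∂P := by
        rw [← lintegral_map (g := fun ω => -fun i => Z i ω) (hFm 1) hZm'.neg,
          ← lintegral_map (hFm 1) hZm']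
        exact congrArg (fun μ => ∫⁻ z, F 1 z ∂μ) hsym
      rw [← h1]
      refine lintegral_congr fun ω => ?_
      simp only [hF, hGe, Pi.neg_apply, inner_neg_left, Finset.sum_neg_distrib, one_mul, neg_mul]
    have e1 : ∫⁻ ω, ENNReal.ofReal (Real.exp (U ω - v / 2)) * G (fun i => Z i ω) ∂P
        = ∫⁻ ω, F 1 (fun i => Z i ω) ∂P := by simp only [hF, one_mul, hU]
    change _ ≤ ∫⁻ ω, ENNReal.ofReal (Real.exp (U ω - v / 2)) * G (fun i => Z i ω) ∂P
    rw [e1]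
    have h2 : 2 * (ENNReal.ofReal (Real.exp (-K ^ 2 / 2)) * ∫⁻ ω, G (fun i => Z i ω) ∂P)
        ≤ 2 * ∫⁻ ω, F 1 (fun i => Z i ω) ∂P := by
      have hadd : 2 * ∫⁻ ω, F 1 (fun i => Z i ω) ∂P
          = ∫⁻ ω, (F 1 (fun i => Z i ω) + F (-1) (fun i => Z i ω)) ∂P := by
        rw [lintegral_add_left (f := fun ω => F 1 fun i => Z i ω) ((hFm 1).comp hZm'), ← e, two_mul]
      rw [hadd, ← mul_assoc, ← lintegral_const_mul (f := fun ω => G fun i => Z i ω) _ (hG.comp hZm')]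
      refine lintegral_mono fun ω => ?_
      simp only [hF]
      rw [← add_mul, ← ENNReal.ofReal_add (Real.exp_pos _).le (Real.exp_pos _).le]
      gcongr
      rw [show (2 : ℝ≥0∞) = ENNReal.ofReal 2 by simp, ← ENNReal.ofReal_mul (by norm_num)]
      refine ENNReal.ofReal_le_ofReal ?_
      set u := ∑ j, inner ℝ (Z j ω) (w j)
      have hKv : Real.exp (-K ^ 2 / 2) ≤ Real.exp (-(v : ℝ) / 2) := by
        refine Real.exp_le_exp.2 ?_
        have : (v : ℝ) ≤ K ^ 2 := hv ▸ hK
        linarith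
      have hs : ∀ c : ℝ, Real.exp (c * u - v / 2) = Real.exp (c * u) * Real.exp (-(v : ℝ) / 2) :=
        fun c => by rw [← Real.exp_add]; ring_nf
      rw [hs, hs, ← add_mul]
      have hcosh : 2 ≤ Real.exp (1 * u) + Real.exp (-1 * u) := by
        have := Real.one_le_cosh u
        rw [Real.cosh_eq] at this
        rw [one_mul, neg_one_mul]
        linarith
      exact mul_le_mul hcosh hKv (Real.exp_pos _).le (by positivity)
    exact (ENNReal.mul_le_mul_iff_right (by norm_num) (by norm_num)).1 h2

end CameronMartin

/-! ### Restriction of RKHS elements to finitely many times -/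

section RKHS

variable {Ω ι T : Type*} [MeasurableSpace Ω] [Fintype ι] {d : ℕ} {P : Measure Ω}

/-- Project f orthogonally onto the span of the kernel functions at the given times. By the
reproducing property the projection has the same values there, its norm is not larger, and its
coefficients give the Gaussian variable representing the shift. -/
lemma exists_weights_of_rkhs {X : T → Ω → EuclideanSpace ℝ (Fin d)}
    (hX : ∀ t, MemLp (X t) 2 P) [Fact (covKernel P X).PosSemidef]
    (f : RKHS.OfKernel (covKernel P X)) (t : ι → T) :
    ∃ w : ι → EuclideanSpace ℝ (Fin d),
      (∀ i, ∫ ω, (∑ j, inner ℝ (X (t j) ω) (w j)) • X (t i) ω ∂P = f (t i)) ∧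
      ∫ ω, (∑ j, inner ℝ (X (t j) ω) (w j)) ^ 2 ∂P ≤ ‖f‖ ^ 2 := by
  let L : (ι → EuclideanSpace ℝ (Fin d)) →ₗ[ℝ]
      RKHS.OfKernel (covKernel P X) :=
    ∑ j, (RKHS.kerFun (RKHS.OfKernel (covKernel P X)) (t j)).toLinearMap ∘ₗ LinearMap.proj j
  have hL : ∀ w, L w = ∑ j, RKHS.kerFun (RKHS.OfKernel (covKernel P X)) (t j) (w j) := fun w => by simp [L]
  obtain ⟨w, hw⟩ : ∃ w, L w = (LinearMap.range L).starProjection f := by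
    have := (LinearMap.range L).starProjection_apply_mem f
    exact this
  have hl : ∀ s v, MemLp (fun ω => inner ℝ (X s ω) v) 2 P := fun s v => (hX s).inner_const v
  have hU : MemLp (fun ω => ∑ j, inner ℝ (X (t j) ω) (w j)) 2 P :=
    memLp_finsetSum _ fun j _ => hl _ _
  have hll : ∀ s v s' v', Integrable (fun ω => inner ℝ (X s ω) v * inner ℝ (X s' ω) v') P :=
    fun s v s' v' => (hl s v).integrable_mul (hl s' v')
  have hlU : ∀ s v, Integrable
      (fun ω => inner ℝ (X s ω) v * ∑ j, inner ℝ (X (t j) ω) (w j)) P :=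
    fun s v => (hl s v).integrable_mul hU
  have hker : ∀ (i : ι) v, inner ℝ (L w) (RKHS.kerFun (RKHS.OfKernel (covKernel P X)) (t i) v)
      = ∫ ω, inner ℝ (X (t i) ω) v * ∑ j, inner ℝ (X (t j) ω) (w j) ∂P := fun i v => by
    simp_rw [Finset.mul_sum]
    rw [hL, sum_inner, integral_finsetSum _ fun j _ => hll _ _ _ _]
    refine Finset.sum_congr rfl fun j _ => ?_
    rw [RKHS.inner_kerFun, RKHS.kerFun_apply, RKHS.OfKernel.kernel_ofKernel, inner_covKernel hX]
  refine ⟨w, fun i => ?_, ?_⟩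
  · refine ext_inner_right ℝ fun v => ?_
    have hint : Integrable (fun ω => (∑ j, inner ℝ (X (t j) ω) (w j)) • X (t i) ω) P :=
      memLp_one_iff_integrable.1 ((hX _).smul hU)
    rw [real_inner_comm, ← integral_inner hint, ← RKHS.inner_kerFun]
    have hmem : RKHS.kerFun (RKHS.OfKernel (covKernel P X)) (t i) v ∈ LinearMap.range L := by
      classical
      refine ⟨Pi.single i v, ?_⟩
      rw [hL, Finset.sum_eq_single i]
      · simp
      · intro j _ hj; simp [Pi.single_eq_of_ne hj]
      · simp
    have : inner ℝ f (RKHS.kerFun (RKHS.OfKernel (covKernel P X)) (t i) v) = inner ℝ (L w) (RKHS.kerFun (RKHS.OfKernel (covKernel P X)) (t i) v) := by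
      rw [hw, Submodule.inner_starProjection_left_eq_right,
        Submodule.starProjection_eq_self_iff.2 hmem]
    rw [this, hker]
    refine integral_congr_ae (ae_of_all _ fun ω => ?_)
    simp only [real_inner_smul_right, real_inner_comm]
    rw [mul_comm]
  · have : ∫ ω, (∑ j, inner ℝ (X (t j) ω) (w j)) ^ 2 ∂P = ‖L w‖ ^ 2 := by
      rw [← real_inner_self_eq_norm_sq]
      conv_rhs => rw [hL w, inner_sum, ← hL w]
      simp_rw [hker, sq]
      rw [← integral_finsetSum _ fun j _ => hlU _ _]
      simp_rw [Finset.sum_mul]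
    rw [this, hw]
    gcongr
    exact Submodule.norm_starProjection_apply_le _ _

end RKHS

/-! ### Comparison from below through the reproducing kernel Hilbert space -/

section LowerBound

variable {Ω Ω' : Type*} [MeasurableSpace Ω] [MeasurableSpace Ω'] {d : ℕ}
  {P : Measure Ω} [IsProbabilityMeasure P] {P' : Measure Ω'}
  {X η : ℝ≥0 → Ω → EuclideanSpace ℝ (Fin d)} {Y : ℝ≥0 → Ω' → EuclideanSpace ℝ (Fin d)}

omit [IsProbabilityMeasure P] in
lemma lintegral_indep_add [SFinite P] {ι E : Type*} [Finite ι] [NormedAddCommGroup E]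
    [MeasurableSpace E] [BorelSpace E] [SecondCountableTopology E] {A B : Ω → ι → E}
    (hA : Measurable A) (hB : Measurable B) (hAB : IndepFun A B P) [IsFiniteMeasure P]
    {G : (ι → E) → ℝ≥0∞} (hG : Measurable G) :
    ∫⁻ ω, G (A ω + B ω) ∂P = ∫⁻ ω, ∫⁻ ω', G (A ω' + B ω) ∂P ∂P := by
  have h := (indepFun_iff_map_prod_eq_prod_map_map hA.aemeasurable hB.aemeasurable).1 hAB
  have hGm : Measurable fun p : (ι → E) × (ι → E) => G (p.1 + p.2) :=
    hG.comp (measurable_fst.add measurable_snd)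
  calc ∫⁻ ω, G (A ω + B ω) ∂P
      = ∫⁻ p, G (p.1 + p.2) ∂(P.map fun ω => (A ω, B ω)) :=
        (lintegral_map hGm (hA.prodMk hB)).symm
    _ = ∫⁻ b, ∫⁻ a, G (a + b) ∂(P.map A) ∂(P.map B) := by
        rw [h, lintegral_prod_symm _ hGm.aemeasurable]
    _ = ∫⁻ ω, ∫⁻ a, G (a + B ω) ∂(P.map A) ∂P :=
        lintegral_map (Measurable.lintegral_prod_left' hGm) hB
    _ = _ := lintegral_congr fun ω => lintegral_map (hG.comp (measurable_id.add_const _)) hA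

/-- The loss depends only on the RKHS norm of the shift, not on the number or position of the times.
-/
lemma lintegral_prod_le_of_rkhs {K : ℝ} (hX : IsGaussianProcess X P)
    (hXm : ∀ t, Measurable (X t)) (hXc : ∀ t, ∫ ω, X t ω ∂P = 0)
    [Fact (covKernel P fun t : Set.Icc (0 : ℝ≥0) 1 => X t).PosSemidef]
    (h : RKHS.OfKernel (covKernel P fun t : Set.Icc (0 : ℝ≥0) 1 => X t)) (hK : ‖h‖ ≤ K)
    {n : ℕ} (s : Fin n → Set.Icc (0 : ℝ≥0) 1) {f : EuclideanSpace ℝ (Fin d) → ℝ≥0∞}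
    (hf : Measurable f) (hfe : ∀ x, f (-x) = f x) :
    ENNReal.ofReal (Real.exp (-K ^ 2 / 2)) * ∫⁻ ω, ∏ i, f (X (s i) ω) ∂P
      ≤ ∫⁻ ω, ∏ i, f (X (s i) ω + h (s i)) ∂P := by
  obtain ⟨w, hw, hwK⟩ := exists_weights_of_rkhs
    (X := fun t : Set.Icc (0 : ℝ≥0) 1 => X t)
    (fun t => (hX.hasGaussianLaw_eval t).memLp_two) h s
  refine lintegral_le_lintegral_add (Z := fun i => X (s i))
    (hasGaussianLaw_tuple hX fun i => (s i : ℝ≥0)) (fun i => hXm _) (fun i => hXc _) w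
    (fun i => h (s i)) hw (hwK.trans ?_) (G := fun z => ∏ i, f (z i))
    (Finset.measurable_prod _ fun i _ => hf.comp (measurable_pi_apply i)) fun z => ?_
  · exact pow_le_pow_left₀ (norm_nonneg _) hK 2
  · simp [hfe]

/-- For times bounded away from `0`, adding the independent summand `η` decreases expected
products of even functions at most by a constant factor. -/
lemma exists_const_mul_le_of_rkhs (hX : IsGaussianProcess X P)
    (hXm : ∀ t, Measurable (X t)) (hηm : ∀ t, Measurable (η t))
    (hXc : ∀ t, ∫ ω, X t ω ∂P = 0)
    (hind : IndepFun (fun ω (t : ℝ≥0) => X t ω) (fun ω (t : ℝ≥0) => η t ω) P) (ε : ℝ≥0)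
    (hR : ∃ ηε : ℝ≥0 → Ω → EuclideanSpace ℝ (Fin d),
      (∀ t, ε ≤ t → ∀ᵐ ω ∂P, ηε t ω = η t ω) ∧
      ∀ᵐ ω ∂P, MemRKHS P (fun t : Set.Icc (0 : ℝ≥0) 1 => X t) (fun t => ηε t ω)) :
    ∃ c : ℝ≥0∞, c ≠ 0 ∧ c ≠ ∞ ∧ ∀ (n : ℕ) (s : Fin n → ℝ≥0), (∀ i, ε ≤ s i ∧ s i ≤ 1) →
      ∀ f : EuclideanSpace ℝ (Fin d) → ℝ≥0∞, Measurable f → (∀ x, f (-x) = f x) →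
        c * ∫⁻ ω, ∏ i, f (X (s i) ω) ∂P ≤ ∫⁻ ω, ∏ i, f (X (s i) ω + η (s i) ω) ∂P := by
  obtain ⟨ηε, hηε, hmem⟩ := hR
  -- Paths whose RKHS norm is at most K. No measurability of these sets is needed: continuity from
  -- below along increasing unions holds for outer measure.
  let D : ℕ → Set Ω := fun K => {ω | ∃ _ : Fact (covKernel P
    fun t : Set.Icc (0 : ℝ≥0) 1 => X t).PosSemidef, ∃ h : RKHS.OfKernel (covKernel P
    fun t : Set.Icc (0 : ℝ≥0) 1 => X t), ‖h‖ ≤ K ∧ ∀ t : Set.Icc (0 : ℝ≥0) 1, h t = ηε t ω}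
  have hDmono : Monotone D := fun K L hKL ω ⟨hF, h, hn, hh⟩ =>
    ⟨hF, h, hn.trans (by exact_mod_cast hKL), hh⟩
  have hDunion : P (⋃ K, D K) = 1 := by
    refine le_antisymm prob_le_one ?_
    have : P (⋃ K, D K) = P Set.univ := by
      refine measure_congr (Filter.eventuallyEq_univ.2 ?_)
      filter_upwards [hmem] with ω ⟨hF, h, hh⟩
      obtain ⟨K, hK⟩ := exists_nat_ge ‖h‖
      exact Set.mem_iUnion.2 ⟨K, hF, h, hK, hh⟩
    rw [this, measure_univ]
  obtain ⟨K, hK⟩ : ∃ K, 1 / 2 < P (D K) := by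
    rw [hDmono.directed_le.measure_iUnion] at hDunion
    have : (1 / 2 : ℝ≥0∞) < ⨆ K, P (D K) := by
      rw [hDunion, one_div]; exact ENNReal.one_half_lt_one
    exact lt_iSup_iff.1 this
  -- The Cameron–Martin factor at norm K times the lower bound 1/2 for the probability of that
  -- event; neither involves n, the times or f.
  refine ⟨ENNReal.ofReal (Real.exp (-(K : ℝ) ^ 2 / 2)) * (1 / 2), ?_, ?_, fun n s hs f hf hfe => ?_⟩
  · simp [Real.exp_pos]
  · exact ENNReal.mul_ne_top ENNReal.ofReal_ne_top (by simp)
  let A : Ω → Fin n → EuclideanSpace ℝ (Fin d) := fun ω i => X (s i) ω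
  let B : Ω → Fin n → EuclideanSpace ℝ (Fin d) := fun ω i => η (s i) ω
  have hA : Measurable A := measurable_pi_lambda _ fun i => hXm _
  have hB : Measurable B := measurable_pi_lambda _ fun i => hηm _
  have hres : Measurable fun (x : ℝ≥0 → EuclideanSpace ℝ (Fin d)) (i : Fin n) => x (s i) :=
    measurable_pi_lambda _ fun i => measurable_pi_apply _
  have hAB : IndepFun A B P := hind.comp hres hres
  have hGm : Measurable fun z : Fin n → EuclideanSpace ℝ (Fin d) => ∏ i, f (z i) :=
    Finset.measurable_prod _ fun i _ => hf.comp (measurable_pi_apply i)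
  have hkey := lintegral_indep_add hA hB hAB hGm
  simp only [Pi.add_apply, A, B] at hkey
  rw [hkey]
  set c₀ := ENNReal.ofReal (Real.exp (-(K : ℝ) ^ 2 / 2))
  set I := ∫⁻ ω, ∏ i, f (X (s i) ω) ∂P
  have hgm : Measurable fun ω => ∫⁻ ω', ∏ i, f (X (s i) ω' + η (s i) ω) ∂P := by
    refine Measurable.lintegral_prod_right' (f := fun p : Ω × Ω =>
      ∏ i, f (X (s i) p.2 + η (s i) p.1)) ?_
    exact Finset.measurable_prod _ fun i _ => hf.comp
      (((hXm _).comp measurable_snd).add ((hηm _).comp measurable_fst))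
  -- A measurable event, defined by the desired inequality itself, that contains `D K` up to a null
  -- set.
  let S : Set Ω := {ω | c₀ * I ≤ ∫⁻ ω', ∏ i, f (X (s i) ω' + η (s i) ω) ∂P}
  have hS : MeasurableSet S := measurableSet_le measurable_const hgm
  have hDS : P (D K) ≤ P S := by
    refine measure_mono_ae ?_
    -- The exceptional null set depends on the time, but only finitely many times occur.
    have hae : ∀ᵐ ω ∂P, ∀ i, ηε (s i) ω = η (s i) ω :=
      ae_all_iff.2 fun i => hηε _ (hs i).1
    filter_upwards [hae] with ω hω ⟨hF, h, hn, hh⟩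
    have := lintegral_prod_le_of_rkhs hX hXm hXc h hn
      (fun i => ⟨s i, zero_le, (hs i).2⟩) hf hfe
    simp only [hh, hω] at this
    exact this
  calc c₀ * (1 / 2) * I = c₀ * I * (1 / 2) := by ring
    _ ≤ c₀ * I * P S := by gcongr; exact hK.le.trans hDS
    _ = ∫⁻ _ in S, c₀ * I ∂P := by rw [setLIntegral_const]
    _ ≤ ∫⁻ ω in S, ∫⁻ ω', ∏ i, f (X (s i) ω' + η (s i) ω) ∂P ∂P :=
        setLIntegral_mono hgm fun ω hω => hω
    _ ≤ _ := setLIntegral_le_lintegral _ _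

end LowerBound

/-! ### Moments of integrals along paths -/

section Moments

variable {Ω Ω' : Type*} [MeasurableSpace Ω] [MeasurableSpace Ω'] {d : ℕ}

/-- The integral `∫ f(Z_s) ds` over `s ∈ (a, b]`. -/
noncomputable def pathIntegral (Z : ℝ≥0 → Ω → EuclideanSpace ℝ (Fin d))
    (f : EuclideanSpace ℝ (Fin d) → ℝ≥0∞) (a b : ℝ) (ω : Ω) : ℝ≥0∞ :=
  ∫⁻ s in Set.Ioc a b, f (Z s.toNNReal ω)

variable {P : Measure Ω} [IsProbabilityMeasure P] {P' : Measure Ω'} [IsProbabilityMeasure P']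
  {Z : ℝ≥0 → Ω → EuclideanSpace ℝ (Fin d)} {X : ℝ≥0 → Ω' → EuclideanSpace ℝ (Fin d)}
  {f g : EuclideanSpace ℝ (Fin d) → ℝ≥0∞}

omit [IsProbabilityMeasure P] in
lemma measurable_comp_toNNReal (hZ : Measurable (Function.uncurry Z)) (hf : Measurable f) :
    Measurable (Function.uncurry fun (s : ℝ) ω => f (Z s.toNNReal ω)) := by
  have hp : Measurable fun p : ℝ × Ω => (p.1.toNNReal, p.2) :=
    (measurable_real_toNNReal.comp measurable_fst).prodMk measurable_snd
  exact hf.comp (hZ.comp hp)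

omit [IsProbabilityMeasure P] in
lemma measurable_pathIntegral (hZ : Measurable (Function.uncurry Z)) (hf : Measurable f)
    (a b : ℝ) : Measurable (pathIntegral Z f a b) :=
  Measurable.lintegral_prod_left' (f := Function.uncurry fun (s : ℝ) ω => f (Z s.toNNReal ω))
    (measurable_comp_toNNReal hZ hf)

lemma lintegral_prod_pathIntegral (hZ : Measurable (Function.uncurry Z)) {ι : Type*} [Fintype ι]
    {f : ι → EuclideanSpace ℝ (Fin d) → ℝ≥0∞} (hf : ∀ i, Measurable (f i)) (a b : ℝ) :
    ∫⁻ ω, ∏ i, pathIntegral Z (f i) a b ω ∂P = ∫⁻ s : ι → ℝ, ∫⁻ ω,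
      ∏ i, f i (Z (s i).toNNReal ω) ∂P ∂(Measure.pi fun _ => volume.restrict (Set.Ioc a b)) :=
  lintegral_prod_lintegral P (volume.restrict (Set.Ioc a b))
    (fun i s ω => f i (Z s.toNNReal ω)) fun i => measurable_comp_toNNReal hZ (hf i)

/-- Comparison of moments follows from comparison of the expected products. -/
lemma lintegral_prod_pathIntegral_le (hZ : Measurable (Function.uncurry Z))
    (hX : Measurable (Function.uncurry X)) {ι : Type*} [Fintype ι]
    {f g : ι → EuclideanSpace ℝ (Fin d) → ℝ≥0∞} (hf : ∀ i, Measurable (f i))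
    (hg : ∀ i, Measurable (g i)) {a b : ℝ} (ha : 0 ≤ a) {c : ℝ≥0∞} (hc : c ≠ ∞)
    (h : ∀ s : ι → ℝ≥0, (∀ i, a ≤ s i ∧ (s i : ℝ) ≤ b) →
      c * ∫⁻ ω, ∏ i, f i (Z (s i) ω) ∂P ≤ ∫⁻ ω, ∏ i, g i (X (s i) ω) ∂P') :
    c * ∫⁻ ω, ∏ i, pathIntegral Z (f i) a b ω ∂P
      ≤ ∫⁻ ω, ∏ i, pathIntegral X (g i) a b ω ∂P' := by
  rw [lintegral_prod_pathIntegral hZ hf, lintegral_prod_pathIntegral hX hg,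
    ← lintegral_const_mul' _ _ hc]
  have hpos : ∀ᵐ s : ι → ℝ ∂(Measure.pi fun _ => volume.restrict (Set.Ioc a b)),
      ∀ i, s i ∈ Set.Ioc a b := by
    rw [ae_all_iff]
    intro i
    exact Measure.tendsto_eval_ae_ae.eventually (ae_restrict_mem measurableSet_Ioc)
  refine lintegral_mono_ae ?_
  filter_upwards [hpos] with s hs
  refine h (fun i => (s i).toNNReal) fun i => ?_
  rw [Real.coe_toNNReal _ (ha.trans (hs i).1.le)]
  exact ⟨(hs i).1.le, (hs i).2⟩

lemma lintegral_pathIntegral_pow_le (hZ : Measurable (Function.uncurry Z))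
    (hX : Measurable (Function.uncurry X)) (hf : Measurable f)
    (hg : Measurable g) {a b : ℝ} (ha : 0 ≤ a) {c : ℝ≥0∞} (hc : c ≠ ∞) (n : ℕ)
    (h : ∀ s : Fin n → ℝ≥0, (∀ i, a ≤ s i ∧ (s i : ℝ) ≤ b) →
      c * ∫⁻ ω, ∏ i, f (Z (s i) ω) ∂P ≤ ∫⁻ ω, ∏ i, g (X (s i) ω) ∂P') :
    c * ∫⁻ ω, pathIntegral Z f a b ω ^ n ∂P ≤ ∫⁻ ω, pathIntegral X g a b ω ^ n ∂P' := by
  have := lintegral_prod_pathIntegral_le (P := P) (P' := P') hZ hX (f := fun _ : Fin n => f)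
    (g := fun _ => g) (fun _ => hf) (fun _ => hg) ha hc h
  simpa using this

omit [MeasurableSpace Ω] in
lemma pathIntegral_const_mul {c : ℝ≥0∞} (hc : c ≠ ∞) (a b : ℝ) (ω : Ω) :
    pathIntegral Z (fun x => c * f x) a b ω = c * pathIntegral Z f a b ω :=
  lintegral_const_mul' _ _ hc

omit [MeasurableSpace Ω] in
lemma pathIntegral_mul_time {c : ℝ≥0} (hc : 0 < c) (a b : ℝ) (ω : Ω) :
    pathIntegral Z f (c * a) (c * b) ω
      = c * pathIntegral (fun t => Z (c * t)) f a b ω := by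
  have hc' : (0 : ℝ) < c := hc
  have hpre : (fun s : ℝ => (c : ℝ) * s) ⁻¹' Set.Ioc (c * a) (c * b) = Set.Ioc a b := by
    ext s
    simp only [Set.mem_preimage, Set.mem_Ioc, mul_lt_mul_iff_right₀ hc', mul_le_mul_iff_right₀ hc']
  unfold pathIntegral
  have hvol : (volume : Measure ℝ) = (c : ℝ≥0∞) • Measure.map (fun s : ℝ => (c : ℝ) * s) volume := by
    rw [Real.map_volume_mul_left hc'.ne', smul_smul, abs_of_pos (inv_pos.2 hc')]
    rw [ENNReal.ofReal_inv_of_pos hc', ENNReal.ofReal_coe_nnreal,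
      ENNReal.mul_inv_cancel (by simpa using hc.ne') ENNReal.coe_ne_top, one_smul]
  conv_lhs => rw [hvol]
  rw [Measure.restrict_smul, lintegral_smul_measure, smul_eq_mul]
  congr 1
  have hemb : MeasurableEmbedding (fun s : ℝ => (c : ℝ) * s) :=
    (Homeomorph.mulLeft₀ (c : ℝ) hc'.ne').measurableEmbedding
  rw [hemb.restrict_map, hpre, hemb.lintegral_map]
  simp only [Real.toNNReal_mul hc'.le, Real.toNNReal_coe]

/-- Scaling of the moments of a self-similar process. -/
lemma SelfSimilar.lintegral_pathIntegral_pow {α : ℝ} (hself : SelfSimilar P α Z)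
    (hZ : Measurable (Function.uncurry Z)) (hf : Measurable f) {c : ℝ≥0} (hc : 0 < c)
    {a b : ℝ} (ha : 0 ≤ a) (β : ℝ) (n : ℕ) :
    ∫⁻ ω, pathIntegral Z f (c * a) (c * b) ω ^ n ∂P
      = ENNReal.ofReal ((c : ℝ) ^ (1 - α * β)) ^ n * ∫⁻ ω, pathIntegral Z
        (fun x => ENNReal.ofReal ((c : ℝ) ^ (α * β)) * f ((c : ℝ) ^ α • x)) a b ω ^ n ∂P := by
  have hc' : (0 : ℝ) < c := hc
  have hfc : Measurable fun x => f ((c : ℝ) ^ α • x) := hf.comp (measurable_const_smul _)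
  have hZc : Measurable (Function.uncurry fun t => Z (c * t)) :=
    hZ.comp ((measurable_const.mul measurable_fst).prodMk measurable_snd)
  -- Equality of finite-dimensional laws suffices, since the n-th moment is an integral over n
  -- times; the moment comparison is applied in both directions.
  have hlaw : ∫⁻ ω, pathIntegral (fun t => Z (c * t)) f a b ω ^ n ∂P
      = ∫⁻ ω, pathIntegral Z (fun x => f ((c : ℝ) ^ α • x)) a b ω ^ n ∂P := by
    have hs : ∀ s : Fin n → ℝ≥0, ∫⁻ ω, ∏ i, f (Z (c * s i) ω) ∂P
        = ∫⁻ ω, ∏ i, f ((c : ℝ) ^ α • Z (s i) ω) ∂P := fun s => by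
      have hm : Measurable fun x : ℝ≥0 → EuclideanSpace ℝ (Fin d) => ∏ i, f (x (s i)) :=
        Finset.measurable_prod _ fun i _ => hf.comp (measurable_pi_apply _)
      exact ((hself c hc).comp hm).lintegral_eq
    refine le_antisymm ?_ ?_
    · simpa using lintegral_pathIntegral_pow_le (P := P) (P' := P) hZc hZ hf hfc ha
        ENNReal.one_ne_top n (b := b) fun s _ => by rw [one_mul, hs]
    · simpa using lintegral_pathIntegral_pow_le (P := P) (P' := P) hZ hZc hfc hf ha
        ENNReal.one_ne_top n (b := b) fun s _ => by rw [one_mul, hs]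
  simp_rw [pathIntegral_mul_time hc, pathIntegral_const_mul ENNReal.ofReal_ne_top, mul_pow]
  rw [lintegral_const_mul' _ _ (by finiteness), lintegral_const_mul' _ _ (by finiteness), hlaw,
    ← mul_assoc]
  congr 1
  -- The factor c produced by the change of time is c^{1-αβ} · c^{αβ}; the second power belongs to
  -- the rescaled function.
  rw [← mul_pow, ← ENNReal.ofReal_mul (by positivity), ← Real.rpow_add hc', sub_add_cancel,
    Real.rpow_one, ENNReal.ofReal_coe_nnreal]

omit [MeasurableSpace Ω] in
lemma pathIntegral_add {a b c : ℝ} (hab : a ≤ b) (hbc : b ≤ c) (ω : Ω) :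
    pathIntegral Z f a c ω = pathIntegral Z f a b ω + pathIntegral Z f b c ω := by
  unfold pathIntegral
  rw [← Set.Ioc_union_Ioc_eq_Ioc hab hbc,
    lintegral_union measurableSet_Ioc (Set.Ioc_disjoint_Ioc_of_le le_rfl)]

end Moments

/-! ### Comparison of the moments of the path functionals -/

section Convexity

/-- Convexity of x ↦ x^n at the points a/w and b/v, whose weighted mean is a + b. -/
lemma add_pow_le_convex (a b : ℝ≥0∞) {w v : ℝ≥0∞} (hw : w ≠ 0) (hv : v ≠ 0) (hwv : w + v = 1)
    (n : ℕ) : (a + b) ^ n ≤ w * (w⁻¹ * a) ^ n + v * (v⁻¹ * b) ^ n := by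
  have hw' : w ≠ ∞ := fun h => by simp [h] at hwv
  have hv' : v ≠ ∞ := fun h => by simp [h] at hwv
  rcases Nat.eq_zero_or_pos n with rfl | hn
  · simp [hwv]
  have h := ENNReal.rpow_arith_mean_le_arith_mean2_rpow w v (w⁻¹ * a) (v⁻¹ * b) hwv
    (p := n) (by exact_mod_cast hn)
  rw [← mul_assoc, ← mul_assoc, ENNReal.mul_inv_cancel hw hw', ENNReal.mul_inv_cancel hv hv',
    one_mul, one_mul] at h
  simpa only [ENNReal.rpow_natCast] using h

end Convexity

/-! ### Self-similarity and summation over geometric time scales -/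

section MaxMoment

variable {Ω Ω' : Type*} [MeasurableSpace Ω] [MeasurableSpace Ω'] {d : ℕ}

/-- The supremum over the family of a potential of the `n`-th moments of the path integrals over
`(0, t]`. -/
noncomputable def maxMoment (P : Measure Ω) (Z : ℝ≥0 → Ω → EuclideanSpace ℝ (Fin d))
    (γ : Potential d) (n : ℕ) (t : ℝ≥0) : ℝ≥0∞ :=
  ⨆ f ∈ γ.family, ∫⁻ ω, pathIntegral Z f 0 t ω ^ n ∂P

variable {P : Measure Ω} [IsProbabilityMeasure P] {P' : Measure Ω'} [IsProbabilityMeasure P']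
  {Z : ℝ≥0 → Ω → EuclideanSpace ℝ (Fin d)} {X : ℝ≥0 → Ω' → EuclideanSpace ℝ (Fin d)}
  {f : EuclideanSpace ℝ (Fin d) → ℝ≥0∞} {γ : Potential d} {α : ℝ}

lemma CharLE.maxMoment_le (h : CharLE P Z P' X) (hZ : Measurable (Function.uncurry Z))
    (hX : Measurable (Function.uncurry X)) (hγ : γ.Admissible) (n : ℕ) (t : ℝ≥0) :
    maxMoment P Z γ n t ≤ maxMoment P' X γ n t := by
  refine iSup₂_mono fun f hf => ?_
  have hfm := Potential.measurable_of_mem_family hf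
  simpa using lintegral_pathIntegral_pow_le (P := P) (P' := P') hZ hX hfm hfm le_rfl
    ENNReal.one_ne_top n (b := t) fun s _ => by
      rw [one_mul]
      exact h.lintegral_prod_le (fun t => hZ.comp measurable_prodMk_left)
        (fun t => hX.comp measurable_prodMk_left) hγ hf s

lemma SelfSimilar.maxMoment_mul_le (hself : SelfSimilar P α Z)
    (hZ : Measurable (Function.uncurry Z)) {c : ℝ≥0} (hc : 0 < c) (n : ℕ) (t : ℝ≥0) :
    maxMoment P Z γ n (c * t)
      ≤ ENNReal.ofReal ((c : ℝ) ^ (1 - α * γ.degree)) ^ n * maxMoment P Z γ n t := by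
  refine iSup₂_le fun f hf => ?_
  have hfm := Potential.measurable_of_mem_family hf
  have := hself.lintegral_pathIntegral_pow hZ hfm hc (a := 0) (b := t) le_rfl γ.degree n
  rw [mul_zero] at this
  rw [NNReal.coe_mul, this]
  gcongr
  exact le_iSup₂_of_le _ (Potential.rescale_mem_family hf (show (0 : ℝ) < c from hc)) le_rfl

lemma SelfSimilar.maxMoment_mul (hself : SelfSimilar P α Z)
    (hZ : Measurable (Function.uncurry Z)) {c : ℝ≥0} (hc : 0 < c) (n : ℕ) (t : ℝ≥0) :
    maxMoment P Z γ n (c * t)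
      = ENNReal.ofReal ((c : ℝ) ^ (1 - α * γ.degree)) ^ n * maxMoment P Z γ n t := by
  refine le_antisymm (hself.maxMoment_mul_le hZ hc n t) ?_
  have hc' : (0 : ℝ) < c := hc
  -- The reverse inequality is the forward one for the inverse dilation.
  have h := hself.maxMoment_mul_le hZ (γ := γ) (inv_pos.2 hc) n (c * t)
  rw [← mul_assoc, inv_mul_cancel₀ hc.ne', one_mul] at h
  refine (mul_le_mul_right h _).trans ?_
  rw [← mul_assoc, ← mul_pow, ← ENNReal.ofReal_mul (by positivity), NNReal.coe_inv,
    Real.inv_rpow hc'.le, mul_inv_cancel₀ (by positivity)]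
  simp

/-- Split at r. The piece below r is a scaled copy of the previous scale, with moment at most w^n
times the current bound for w = r^{1-αβ}. Convexity with weights w and v = 1 - w cancels w^n, and w
+ v = 1 makes the bound v^{-n} S reproduce itself. Starting the integrals at r^N avoids subtracting
a possibly infinite moment. -/
lemma SelfSimilar.lintegral_pathIntegral_pow_geometric_le (hself : SelfSimilar P α Z)
    (hZ : Measurable (Function.uncurry Z)) {r : ℝ≥0} (hr0 : 0 < r) (hr1 : r < 1)
    {v S : ℝ≥0∞} (hv : v ≠ 0)
    (hwv : ENNReal.ofReal ((r : ℝ) ^ (1 - α * γ.degree)) + v = 1) (n : ℕ)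
    (hS : ∀ f ∈ γ.family, ∫⁻ ω, pathIntegral Z f r 1 ω ^ n ∂P ≤ S) (N : ℕ) :
    ∀ f ∈ γ.family, ∫⁻ ω, pathIntegral Z f ((r : ℝ) ^ N) 1 ω ^ n ∂P ≤ v⁻¹ ^ n * S := by
  have hr0' : (0 : ℝ) < r := hr0
  have hr1' : (r : ℝ) < 1 := hr1
  set w := ENNReal.ofReal ((r : ℝ) ^ (1 - α * γ.degree)) with hw
  have hw0 : w ≠ 0 := by
    rw [hw, Ne, ENNReal.ofReal_eq_zero, not_le]
    positivity
  have hv1 : v ≤ 1 := hwv ▸ le_add_self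
  have hv' : 1 ≤ v⁻¹ := ENNReal.one_le_inv.2 hv1
  induction N with
  | zero =>
    intro f hf
    refine le_trans (lintegral_mono fun ω => ?_) ((hS f hf).trans
      (le_mul_of_one_le_left zero_le (one_le_pow₀ hv')))
    gcongr
    rw [pow_zero]
    exact lintegral_mono_set (Set.Ioc_subset_Ioc_left hr1'.le)
  | succ N ih =>
    intro f hf
    have hfm := Potential.measurable_of_mem_family hf
    have hle : (r : ℝ) ^ (N + 1) ≤ r := by
      rw [pow_succ]
      exact mul_le_of_le_one_left hr0'.le (pow_le_one₀ hr0'.le hr1'.le)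
    have h1 : ∫⁻ ω, pathIntegral Z f ((r : ℝ) ^ (N + 1)) r ω ^ n ∂P ≤ w ^ n * (v⁻¹ ^ n * S) := by
      have := hself.lintegral_pathIntegral_pow hZ hfm hr0 (a := (r : ℝ) ^ N) (b := 1)
        (by positivity) γ.degree n
      rw [mul_one, ← pow_succ'] at this
      rw [this]
      gcongr
      -- The induction hypothesis is needed for the rescaled function, hence the quantification over
      -- the whole family.
      exact ih _ (Potential.rescale_mem_family hf hr0')
    have hm1 := measurable_pathIntegral hZ hfm ((r : ℝ) ^ (N + 1)) r
    calc ∫⁻ ω, pathIntegral Z f ((r : ℝ) ^ (N + 1)) 1 ω ^ n ∂P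
        ≤ ∫⁻ ω, (w * w⁻¹ ^ n * pathIntegral Z f ((r : ℝ) ^ (N + 1)) r ω ^ n
          + v * v⁻¹ ^ n * pathIntegral Z f r 1 ω ^ n) ∂P := by
          refine lintegral_mono fun ω => ?_
          simp only
          rw [pathIntegral_add hle hr1'.le]
          refine (add_pow_le_convex _ _ hw0 hv hwv n).trans_eq ?_
          rw [mul_pow, mul_pow, mul_assoc, mul_assoc]
      _ = w * w⁻¹ ^ n * ∫⁻ ω, pathIntegral Z f ((r : ℝ) ^ (N + 1)) r ω ^ n ∂P
          + v * v⁻¹ ^ n * ∫⁻ ω, pathIntegral Z f r 1 ω ^ n ∂P := by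
          rw [lintegral_add_left ((hm1.pow_const n).const_mul _),
            lintegral_const_mul _ (hm1.pow_const n),
            lintegral_const_mul _ ((measurable_pathIntegral hZ hfm r 1).pow_const n)]
      _ ≤ w * w⁻¹ ^ n * (w ^ n * (v⁻¹ ^ n * S)) + v * v⁻¹ ^ n * S := by
          gcongr
          exact hS f hf
      _ = (w * (w⁻¹ * w) ^ n + v) * (v⁻¹ ^ n * S) := by ring
      _ = v⁻¹ ^ n * S := by
          rw [ENNReal.inv_mul_cancel hw0 ENNReal.ofReal_ne_top, one_pow, mul_one, hwv, one_mul]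

omit [IsProbabilityMeasure P] in
lemma lintegral_pathIntegral_pow_le_of_forall (hZ : Measurable (Function.uncurry Z))
    (hf : Measurable f) {r : ℝ} (hr0 : 0 < r) (hr1 : r < 1) (n : ℕ) {B : ℝ≥0∞}
    (h : ∀ N : ℕ, ∫⁻ ω, pathIntegral Z f (r ^ N) 1 ω ^ n ∂P ≤ B) :
    ∫⁻ ω, pathIntegral Z f 0 1 ω ^ n ∂P ≤ B := by
  have hanti : Antitone fun N : ℕ => r ^ N := pow_right_anti₀ hr0.le hr1.le
  have hmono : ∀ ω, Monotone fun N : ℕ => pathIntegral Z f (r ^ N) 1 ω := fun ω N M hNM =>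
    lintegral_mono_set (Set.Ioc_subset_Ioc_left (hanti hNM))
  have hU : ⋃ N : ℕ, Set.Ioc (r ^ N) 1 = Set.Ioc 0 1 := by
    ext s
    simp only [Set.mem_iUnion, Set.mem_Ioc]
    constructor
    · rintro ⟨N, h1, h2⟩
      exact ⟨lt_of_le_of_lt (by positivity) h1, h2⟩
    · rintro ⟨h1, h2⟩
      obtain ⟨N, hN⟩ := exists_pow_lt_of_lt_one h1 hr1
      exact ⟨N, hN, h2⟩
  have hsup : ∀ ω, pathIntegral Z f 0 1 ω = ⨆ N : ℕ, pathIntegral Z f (r ^ N) 1 ω := fun ω => by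
    unfold pathIntegral
    rw [← hU]
    refine setLIntegral_iUnion_of_directed _ (directed_of_isDirected_le fun N M hNM => ?_)
    exact Set.Ioc_subset_Ioc_left (hanti hNM)
  refine le_of_tendsto' (lintegral_tendsto_of_tendsto_of_monotone (μ := P)
    (f := fun N ω => pathIntegral Z f (r ^ N) 1 ω ^ n) (fun N =>
      ((measurable_pathIntegral hZ hf _ _).pow_const n).aemeasurable)
      (ae_of_all _ fun ω N M hNM => pow_le_pow_left₀ zero_le (hmono ω hNM) n)
      (ae_of_all _ fun ω => ?_)) h
  rw [hsup]
  exact (ENNReal.continuous_pow n).continuousAt.tendsto.comp (tendsto_atTop_iSup (hmono ω))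

end MaxMoment

/-! ### Moment comparison up to a dilation of time -/

section Sandwich

variable {Ω Ω' : Type*} [MeasurableSpace Ω] [MeasurableSpace Ω'] {d : ℕ}
  {P : Measure Ω} [IsProbabilityMeasure P] {P' : Measure Ω'} [IsProbabilityMeasure P']
  {X : ℝ≥0 → Ω → EuclideanSpace ℝ (Fin d)} {Y : ℝ≥0 → Ω' → EuclideanSpace ℝ (Fin d)}
  {γ : Potential d} {α : ℝ}

/-- If the finite-dimensional products of `X` are dominated by those of `Y` on every `[ε, 1]`,
then the moments of the functionals of `X` are dominated by those of `Y` at slightly later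
times. -/
lemma exists_maxMoment_le_mul (hXm : Measurable (Function.uncurry X))
    (hYm : Measurable (Function.uncurry Y)) (hX : SelfSimilar P α X) (hY : SelfSimilar P' α Y)
    (hα : α * γ.degree < 1)
    (h : ∀ ε : ℝ≥0, 0 < ε → ε < 1 → ∃ c : ℝ≥0∞, c ≠ 0 ∧ c ≠ ∞ ∧ ∀ (n : ℕ) (s : Fin n → ℝ≥0),
      (∀ i, ε ≤ s i ∧ s i ≤ 1) → ∀ f : EuclideanSpace ℝ (Fin d) → ℝ≥0∞, Measurable f →
        (∀ x, f (-x) = f x) →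
          c * ∫⁻ ω, ∏ i, f (X (s i) ω) ∂P ≤ ∫⁻ ω, ∏ i, f (Y (s i) ω) ∂P')
    {b : ℝ≥0} (hb : 1 < b) :
    ∃ c : ℝ≥0∞, c ≠ 0 ∧ c ≠ ∞ ∧ ∀ (n : ℕ) (t : ℝ≥0), 0 < t →
      c * maxMoment P X γ n t ≤ maxMoment P' Y γ n (b * t) := by
  set p := 1 - α * γ.degree with hp
  have hp0 : 0 < p := by linarith
  have hb' : (1 : ℝ) < b := hb
  have hb0 : (0 : ℝ) < b := by linarith
  have hbp : 1 < (b : ℝ) ^ p := Real.one_lt_rpow hb' hp0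
  -- Chosen so that the loss v^{-n} of the geometric summation is b^{pn}, the factor by which
  -- dilating time by b multiplies the n-th moment. Then r is determined by r^p + v = 1.
  set v : ℝ := ((b : ℝ) ^ p)⁻¹ with hv
  have hv0 : 0 < v := by positivity
  have hv1 : v < 1 := inv_lt_one_of_one_lt₀ hbp
  set r : ℝ≥0 := ⟨(1 - v) ^ p⁻¹, Real.rpow_nonneg (by linarith) _⟩ with hr
  have hr' : (r : ℝ) = (1 - v) ^ p⁻¹ := rfl
  have hr0 : 0 < r := by
    rw [← NNReal.coe_pos, hr']
    exact Real.rpow_pos_of_pos (by linarith) _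
  have hr1 : r < 1 := by
    rw [← NNReal.coe_lt_coe, hr', NNReal.coe_one]
    exact Real.rpow_lt_one (by linarith) (by linarith) (by positivity)
  have hrp : (r : ℝ) ^ p = 1 - v := by
    rw [hr', ← Real.rpow_mul (by linarith), inv_mul_cancel₀ hp0.ne', Real.rpow_one]
  have hwv : ENNReal.ofReal ((r : ℝ) ^ (1 - α * γ.degree)) + ENNReal.ofReal v = 1 := by
    rw [← hp, hrp, ← ENNReal.ofReal_add (by linarith) hv0.le]
    simp
  obtain ⟨c, hc0, hctop, hc⟩ := h r hr0 hr1
  refine ⟨c, hc0, hctop, fun n t ht => ?_⟩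
  have hvinv : (ENNReal.ofReal v)⁻¹ = ENNReal.ofReal ((b : ℝ) ^ p) := by
    rw [← ENNReal.ofReal_inv_of_pos hv0, hv, inv_inv]
  have h1 : c * maxMoment P X γ n 1 ≤ ENNReal.ofReal ((b : ℝ) ^ p) ^ n * maxMoment P' Y γ n 1 := by
    rw [maxMoment, ENNReal.mul_iSup]
    refine iSup_le fun f => ?_
    rw [ENNReal.mul_iSup]
    refine iSup_le fun hf => ?_
    have hfm := Potential.measurable_of_mem_family hf
    have hS : ∀ g ∈ γ.family, ∫⁻ ω, pathIntegral X g r 1 ω ^ n ∂P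
        ≤ c⁻¹ * maxMoment P' Y γ n 1 := fun g hg => by
      have hgm := Potential.measurable_of_mem_family hg
      have h2 := lintegral_pathIntegral_pow_le (P := P) (P' := P') hXm hYm hgm hgm
        (NNReal.coe_nonneg r) hctop n (b := 1) fun s hs =>
          hc n s (fun i => by exact_mod_cast hs i) g hgm (Potential.even_of_mem_family hg)
      rw [mul_comm, ← div_eq_mul_inv, ENNReal.le_div_iff_mul_le (Or.inl hc0) (Or.inl hctop),
        mul_comm]
      refine h2.trans (le_iSup₂_of_le g hg (lintegral_mono fun ω => ?_))
      gcongr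
      exact lintegral_mono_set (Set.Ioc_subset_Ioc_left (NNReal.coe_nonneg r))
    have h3 := lintegral_pathIntegral_pow_le_of_forall (P := P) hXm hfm
      (NNReal.coe_pos.2 hr0) (show (r : ℝ) < 1 from hr1) n fun N =>
      hX.lintegral_pathIntegral_pow_geometric_le hXm hr0 hr1
        (by simpa using hv0) hwv n hS N f hf
    rw [hvinv] at h3
    rw [NNReal.coe_one]
    calc c * ∫⁻ ω, pathIntegral X f 0 1 ω ^ n ∂P
        ≤ c * (ENNReal.ofReal ((b : ℝ) ^ p) ^ n * (c⁻¹ * maxMoment P' Y γ n 1)) := by gcongr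
      _ = (c * c⁻¹) * (ENNReal.ofReal ((b : ℝ) ^ p) ^ n * maxMoment P' Y γ n 1) := by ring
      _ = _ := by rw [ENNReal.mul_inv_cancel hc0 hctop, one_mul]
  have e1 := hX.maxMoment_mul (γ := γ) hXm ht n 1
  have e2 := hY.maxMoment_mul (γ := γ) hYm (mul_pos (show (0 : ℝ≥0) < b by positivity) ht) n 1
  rw [mul_one] at e1 e2
  rw [e1, e2, ← hp, NNReal.coe_mul, Real.mul_rpow hb0.le t.coe_nonneg,
    ENNReal.ofReal_mul (by positivity), mul_pow]
  calc _ = ENNReal.ofReal ((t : ℝ) ^ p) ^ n * (c * maxMoment P X γ n 1) := by ring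
    _ ≤ ENNReal.ofReal ((t : ℝ) ^ p) ^ n *
        (ENNReal.ofReal ((b : ℝ) ^ p) ^ n * maxMoment P' Y γ n 1) := by gcongr
    _ = _ := by ring

end Sandwich

/-! ### Moments of bounded random variables -/

section BoundedMoments

variable {Ω Ω' : Type*} [MeasurableSpace Ω] [MeasurableSpace Ω']
  {P : Measure Ω} [IsProbabilityMeasure P] {P' : Measure Ω'} [IsProbabilityMeasure P']

/-- The exponential series may be integrated term by term, being dominated by the summable series of
(|ξ| C)^n / n!. -/
lemma hasSum_charFun_of_bounded {a : Ω → ℝ} (ha : Measurable a) {C : ℝ} (hC : ∀ ω, |a ω| ≤ C)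
    (ξ : ℝ) : HasSum (fun n : ℕ => ((ξ : ℂ) * Complex.I) ^ n / (n.factorial : ℂ) *
      ((∫ ω, a ω ^ n ∂P : ℝ) : ℂ)) (charFun (P.map a) ξ) := by
  have hint : ∀ n : ℕ, Integrable (fun ω => a ω ^ n) P := fun n =>
    Integrable.of_bound (ha.pow_const n).aestronglyMeasurable (C ^ n) (ae_of_all _ fun ω => by
      rw [norm_pow]; exact pow_le_pow_left₀ (norm_nonneg _) (hC ω) n)
  have hF : ∀ n : ℕ, Integrable (fun ω => ((ξ : ℂ) * Complex.I) ^ n / (n.factorial : ℂ) *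
      ((a ω ^ n : ℝ) : ℂ)) P := fun n => (hint n).ofReal.const_mul _
  have hnorm : ∀ n ω, ‖((ξ : ℂ) * Complex.I) ^ n / (n.factorial : ℂ) * ((a ω ^ n : ℝ) : ℂ)‖
      ≤ (|ξ| * C) ^ n / n.factorial := fun n ω => by
    have h := pow_le_pow_left₀ (abs_nonneg _) (hC ω) n
    simp only [norm_mul, norm_div, norm_pow, Complex.norm_real, Complex.norm_I, mul_one,
      Complex.norm_natCast, Real.norm_eq_abs]
    rw [mul_pow, div_mul_eq_mul_div]
    gcongr
  have h := hasSum_integral_of_summable_integral_norm hF (Summable.of_nonneg_of_le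
    (fun n => integral_nonneg fun ω => norm_nonneg _) (fun n => ?_)
    (Real.summable_pow_div_factorial (|ξ| * C)))
  · convert! h using 1
    · ext n
      rw [integral_const_mul, integral_complex_ofReal]
    · rw [charFun_apply_real, integral_map ha.aemeasurable (by fun_prop)]
      refine integral_congr_ae (ae_of_all _ fun ω => ?_)
      simp only
      rw [Complex.exp_eq_exp_ℂ, NormedSpace.exp_eq_tsum_div]
      refine tsum_congr fun n => ?_
      push_cast
      rw [mul_right_comm, mul_pow]
      ring
  · refine (integral_mono_of_nonneg (ae_of_all _ fun ω => norm_nonneg _)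
      (integrable_const _) (ae_of_all _ (hnorm n))).trans_eq ?_
    simp

/-- Bounded random variables with the same moments have the same law. -/
lemma map_eq_of_forall_integral_pow_eq {a : Ω → ℝ} {b : Ω' → ℝ} (ha : Measurable a)
    (hb : Measurable b) {C : ℝ} (haC : ∀ ω, |a ω| ≤ C) (hbC : ∀ ω, |b ω| ≤ C)
    (h : ∀ n : ℕ, ∫ ω, a ω ^ n ∂P = ∫ ω, b ω ^ n ∂P') : P.map a = P'.map b := by
  have := Measure.isProbabilityMeasure_map (μ := P) ha.aemeasurable
  have := Measure.isProbabilityMeasure_map (μ := P') hb.aemeasurable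
  refine Measure.ext_of_charFun (funext fun ξ => ?_)
  refine (hasSum_charFun_of_bounded (P := P) ha haC ξ).unique ?_
  simp_rw [h]
  exact hasSum_charFun_of_bounded hb hbC ξ

lemma lintegral_comp_eq_of_forall_lintegral_pow_eq {a : Ω → ℝ≥0∞} {b : Ω' → ℝ≥0∞}
    (ha : Measurable a) (hb : Measurable b) {C : ℝ≥0} (haC : ∀ ω, a ω ≤ C) (hbC : ∀ ω, b ω ≤ C)
    (h : ∀ n : ℕ, ∫⁻ ω, a ω ^ n ∂P = ∫⁻ ω, b ω ^ n ∂P') {Φ : ℝ≥0∞ → ℝ≥0∞} (hΦ : Measurable Φ) :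
    ∫⁻ ω, Φ (a ω) ∂P = ∫⁻ ω, Φ (b ω) ∂P' := by
  have hmap : P.map (fun ω => (a ω).toReal) = P'.map (fun ω => (b ω).toReal) := by
    refine map_eq_of_forall_integral_pow_eq ha.ennreal_toReal hb.ennreal_toReal (C := C)
      (fun ω => ?_) (fun ω => ?_) fun n => ?_
    · rw [abs_of_nonneg ENNReal.toReal_nonneg]
      exact ENNReal.toReal_le_coe_of_le_coe (haC ω)
    · rw [abs_of_nonneg ENNReal.toReal_nonneg]
      exact ENNReal.toReal_le_coe_of_le_coe (hbC ω)
    · simp_rw [← ENNReal.toReal_pow]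
      rw [integral_toReal (ha.pow_const n).aemeasurable (ae_of_all _ fun ω =>
        ENNReal.pow_lt_top ((haC ω).trans_lt ENNReal.coe_lt_top)),
        integral_toReal (hb.pow_const n).aemeasurable (ae_of_all _ fun ω =>
        ENNReal.pow_lt_top ((hbC ω).trans_lt ENNReal.coe_lt_top)), h]
  have hΦ' : Measurable fun x : ℝ => Φ (ENNReal.ofReal x) := hΦ.comp ENNReal.measurable_ofReal
  have e1 : ∀ ω, Φ (a ω) = Φ (ENNReal.ofReal (a ω).toReal) := fun ω => by
    rw [ENNReal.ofReal_toReal ((haC ω).trans_lt ENNReal.coe_lt_top).ne]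
  have e2 : ∀ ω, Φ (b ω) = Φ (ENNReal.ofReal (b ω).toReal) := fun ω => by
    rw [ENNReal.ofReal_toReal ((hbC ω).trans_lt ENNReal.coe_lt_top).ne]
  simp_rw [e1, e2]
  rw [← lintegral_map hΦ' ha.ennreal_toReal, hmap, lintegral_map hΦ' hb.ennreal_toReal]

lemma lintegral_pow_le_lintegral_pow {a : Ω → ℝ≥0∞} (ha : Measurable a) (n : ℕ) :
    (∫⁻ ω, a ω ∂P) ^ n ≤ ∫⁻ ω, a ω ^ n ∂P := by
  rcases Nat.eq_zero_or_pos n with rfl | hn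
  · simp
  have h := eLpNorm_le_eLpNorm_of_exponent_le (μ := P) (p := 1) (q := n)
    (by exact_mod_cast hn) ha.aestronglyMeasurable
  rw [eLpNorm_one_eq_lintegral_enorm,
    eLpNorm_eq_lintegral_rpow_enorm_toReal (by positivity) (by simp)] at h
  simp only [enorm_eq_self, ENNReal.toReal_natCast, ENNReal.rpow_natCast, one_div] at h
  have h2 := pow_le_pow_left₀ zero_le h n
  rwa [← ENNReal.rpow_natCast (_ ^ _) n, ← ENNReal.rpow_mul, inv_mul_cancel₀ (by positivity),
    ENNReal.rpow_one] at h2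

/-- Linear in y: if the sum is bounded, the error from truncating a high moment is controlled by the
first moment of the discarded part. -/
lemma add_pow_succ_le {x y C : ℝ≥0∞} (h : x + y ≤ C) (n : ℕ) :
    (x + y) ^ (n + 1) ≤ x ^ (n + 1) + (n + 1) * C ^ n * y := by
  induction n with
  | zero => simp
  | succ n ih =>
    have hx : x ≤ C := le_self_add.trans h
    calc (x + y) ^ (n + 1 + 1) = (x + y) ^ (n + 1) * (x + y) := pow_succ _ _
      _ ≤ (x ^ (n + 1) + (n + 1) * C ^ n * y) * (x + y) := by gcongr
      _ = x ^ (n + 1) * x + x ^ (n + 1) * y + (n + 1) * C ^ n * y * (x + y) := by ring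
      _ ≤ x ^ (n + 1) * x + C ^ (n + 1) * y + (n + 1) * C ^ n * y * C := by gcongr
      _ = _ := by push_cast; ring

end BoundedMoments

/-! ### Local times -/

section LocalTime

variable {Ω Ω' : Type*} [MeasurableSpace Ω] [MeasurableSpace Ω'] {d : ℕ}
  {P : Measure Ω} [IsProbabilityMeasure P] {P' : Measure Ω'} [IsProbabilityMeasure P']
  {Z : ℝ≥0 → Ω → EuclideanSpace ℝ (Fin d)} {X : ℝ≥0 → Ω' → EuclideanSpace ℝ (Fin d)}

/-- The approximate local time `∫₀ᵗ p_ε(Z_s) ds`. -/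
noncomputable def approxLocalTime (Z : ℝ≥0 → Ω → EuclideanSpace ℝ (Fin d)) (ε : ℝ) (t : ℝ≥0)
    (ω : Ω) : ℝ≥0∞ :=
  pathIntegral Z (fun x => ENNReal.ofReal (heatKernel ε x)) 0 t ω

lemma measurable_heatKernel (ε : ℝ) :
    Measurable (heatKernel ε : EuclideanSpace ℝ (Fin d) → ℝ) := by
  unfold heatKernel; fun_prop

lemma heatKernel_le {ε : ℝ} (hε : 0 < ε) (x : EuclideanSpace ℝ (Fin d)) :
    heatKernel ε x ≤ (2 * Real.pi * ε) ^ (-(d : ℝ) / 2) := by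
  have := Real.pi_pos
  refine mul_le_of_le_one_right (by positivity) (Real.exp_le_one_iff.2 ?_)
  exact div_nonpos_of_nonpos_of_nonneg (by simp) (by positivity)

omit [IsProbabilityMeasure P] in
lemma measurable_approxLocalTime (hZ : Measurable (Function.uncurry Z)) (ε : ℝ) (t : ℝ≥0) :
    Measurable (approxLocalTime Z ε t) :=
  measurable_pathIntegral hZ (measurable_heatKernel ε).ennreal_ofReal _ _

omit [MeasurableSpace Ω] in
lemma approxLocalTime_le {ε : ℝ} (hε : 0 < ε) (t : ℝ≥0) (ω : Ω) :
    approxLocalTime Z ε t ω ≤ ((2 * Real.pi * ε) ^ (-(d : ℝ) / 2)).toNNReal * t := by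
  refine (lintegral_mono fun s => ENNReal.ofReal_le_ofReal (heatKernel_le hε _)).trans_eq ?_
  rw [setLIntegral_const, Real.volume_Ioc, sub_zero, ENNReal.ofReal_coe_nnreal]
  rfl

omit [MeasurableSpace Ω] in
lemma approxLocalTime_ne_top {ε : ℝ} (hε : 0 < ε) (t : ℝ≥0) (ω : Ω) :
    approxLocalTime Z ε t ω ≠ ∞ :=
  ((approxLocalTime_le hε t ω).trans_lt
    (ENNReal.mul_lt_top ENNReal.coe_lt_top ENNReal.coe_lt_top)).ne

omit [IsProbabilityMeasure P] in
lemma integral_heatKernel_eq (hZ : Measurable (Function.uncurry Z)) {ε : ℝ} (hε : 0 < ε)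
    (t : ℝ≥0) (ω : Ω) :
    ∫ s in Set.Ioc (0 : ℝ) t, heatKernel ε (Z s.toNNReal ω) = (approxLocalTime Z ε t ω).toReal := by
  rw [integral_eq_lintegral_of_nonneg_ae]
  · rfl
  · exact ae_of_all _ fun s => heatKernel_nonneg hε _
  · have hp : Measurable fun s : ℝ => (s.toNNReal, ω) :=
      measurable_real_toNNReal.prodMk measurable_const
    have hs : Measurable fun s : ℝ => Z s.toNNReal ω := hZ.comp hp
    exact ((measurable_heatKernel ε).comp hs).aestronglyMeasurable

lemma CharLE.lintegral_prod_pathIntegral_le (h : CharLE P Z P' X)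
    (hZ : Measurable (Function.uncurry Z)) (hX : Measurable (Function.uncurry X)) {n : ℕ}
    {f g f' g' : Fin n → EuclideanSpace ℝ (Fin d) → ℝ} (hf : ∀ i, HasFourierDensity (f i) (g i))
    (hf' : ∀ i, HasFourierDensity (f' i) (g' i)) (hf0 : ∀ i x, 0 ≤ f i x)
    (hf0' : ∀ i x, 0 ≤ f' i x) (hg : ∀ i ξ, g i ξ ≤ g' i ξ) {a b : ℝ} (ha : 0 ≤ a) :
    ∫⁻ ω, ∏ i, pathIntegral Z (fun x => ENNReal.ofReal (f i x)) a b ω ∂P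
      ≤ ∫⁻ ω, ∏ i, pathIntegral X (fun x => ENNReal.ofReal (f' i x)) a b ω ∂P' := by
  have hm : ∀ i, Measurable fun x => ENNReal.ofReal (f i x) := fun i =>
    (hf i).continuous.measurable.ennreal_ofReal
  have hm' : ∀ i, Measurable fun x => ENNReal.ofReal (f' i x) := fun i =>
    (hf' i).continuous.measurable.ennreal_ofReal
  refine (one_mul _).symm.trans_le (GaussianComparison.lintegral_prod_pathIntegral_le hZ hX hm hm'
    ha ENNReal.one_ne_top fun s _ => ?_)
  rw [one_mul]
  refine lintegral_prod_le_lintegral_prod (Z := fun i => Z (s i)) (X := fun i => X (s i))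
    (fun i => hZ.comp measurable_prodMk_left) (fun i => hX.comp measurable_prodMk_left)
    hf hf' hf0 hf0' fun ξ => ?_
  exact mul_le_mul (h n s ξ) (Finset.prod_le_prod (fun i _ => (hf i).nonneg _) fun i _ => hg i _)
    (Finset.prod_nonneg fun i _ => (hf i).nonneg _) ((norm_nonneg _).trans (h n s ξ))

/-- Mixed moments of approximate local times increase as the regularization decreases. -/
lemma CharLE.lintegral_prod_approxLocalTime_le (h : CharLE P Z P' X)
    (hZ : Measurable (Function.uncurry Z)) (hX : Measurable (Function.uncurry X)) {n : ℕ}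
    {ε δ : Fin n → ℝ} (hδ : ∀ i, 0 < δ i) (hεδ : ∀ i, δ i ≤ ε i) (t : ℝ≥0) :
    ∫⁻ ω, ∏ i, approxLocalTime Z (ε i) t ω ∂P ≤ ∫⁻ ω, ∏ i, approxLocalTime X (δ i) t ω ∂P' := by
  have hε : ∀ i, 0 < ε i := fun i => (hδ i).trans_le (hεδ i)
  refine h.lintegral_prod_pathIntegral_le hZ hX
    (fun i => hasFourierDensity_heatKernel (hε i)) (fun i => hasFourierDensity_heatKernel (hδ i))
    (fun i => heatKernel_nonneg (hε i)) (fun i => heatKernel_nonneg (hδ i)) (fun i ξ => ?_) le_rfl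
  have := Real.pi_pos
  gcongr
  exact hεδ i

lemma CharLE.lintegral_approxLocalTime_pow_le (h : CharLE P Z P' X)
    (hZ : Measurable (Function.uncurry Z)) (hX : Measurable (Function.uncurry X)) (n : ℕ)
    {ε δ : ℝ} (hδ : 0 < δ) (hεδ : δ ≤ ε) (t : ℝ≥0) :
    ∫⁻ ω, approxLocalTime Z ε t ω ^ n ∂P ≤ ∫⁻ ω, approxLocalTime X δ t ω ^ n ∂P' := by
  simpa using h.lintegral_prod_approxLocalTime_le hZ hX (n := n) (ε := fun _ => ε)
    (δ := fun _ => δ) (fun _ => hδ) (fun _ => hεδ) t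

omit [IsProbabilityMeasure P] in
lemma le_maxMoment_delta {ε : ℝ} (hε : 0 < ε) (n : ℕ) (t : ℝ≥0) :
    ∫⁻ ω, approxLocalTime Z ε t ω ^ n ∂P ≤ maxMoment P Z .delta n t :=
  le_iSup₂_of_le (fun x => ENNReal.ofReal (heatKernel ε x)) ⟨ε, hε, rfl⟩ le_rfl

omit [IsProbabilityMeasure P] in
lemma maxMoment_delta_le {n : ℕ} {t : ℝ≥0} {B : ℝ≥0∞}
    (h : ∀ ε : ℝ, 0 < ε → ∫⁻ ω, approxLocalTime Z ε t ω ^ n ∂P ≤ B) :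
    maxMoment P Z .delta n t ≤ B := by
  refine iSup₂_le fun f hf => ?_
  obtain ⟨ε, hε, rfl⟩ := hf
  exact h ε hε

lemma memLp_approxLocalTime (hZ : Measurable (Function.uncurry Z)) {ε : ℝ} (hε : 0 < ε)
    (t : ℝ≥0) : MemLp (fun ω => (approxLocalTime Z ε t ω).toReal) 2 P := by
  refine MemLp.of_bound (measurable_approxLocalTime hZ ε t).ennreal_toReal.aestronglyMeasurable
    (((2 * Real.pi * ε) ^ (-(d : ℝ) / 2)).toNNReal * t : ℝ≥0) (ae_of_all _ fun ω => ?_)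
  rw [Real.norm_of_nonneg ENNReal.toReal_nonneg]
  exact ENNReal.toReal_le_coe_of_le_coe (by exact_mod_cast approxLocalTime_le hε t ω)

/-- The increments of the approximate local times are controlled by the increments of their second
moments. -/
lemma integral_sub_approxLocalTime_sq_le (h : CharLE P Z P Z)
    (hZ : Measurable (Function.uncurry Z)) {ε δ : ℝ} (hε : 0 < ε) (hεδ : ε ≤ δ) (t : ℝ≥0) :
    ∫ ω, ((approxLocalTime Z ε t ω).toReal - (approxLocalTime Z δ t ω).toReal) ^ 2 ∂P
      ≤ (∫⁻ ω, approxLocalTime Z ε t ω ^ 2 ∂P).toReal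
        - (∫⁻ ω, approxLocalTime Z δ t ω ^ 2 ∂P).toReal := by
  have hδ := hε.trans_le hεδ
  have m1 := memLp_approxLocalTime (P := P) hZ hε t
  have m2 := memLp_approxLocalTime (P := P) hZ hδ t
  have e : ∀ {ε δ : ℝ}, 0 < ε → 0 < δ → ∫ ω, (approxLocalTime Z ε t ω).toReal *
      (approxLocalTime Z δ t ω).toReal ∂P
        = (∫⁻ ω, approxLocalTime Z ε t ω * approxLocalTime Z δ t ω ∂P).toReal :=
    fun {ε δ} hε hδ => by
      simp_rw [← ENNReal.toReal_mul]
      refine integral_toReal ((measurable_approxLocalTime hZ ε t).mul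
        (measurable_approxLocalTime hZ δ t)).aemeasurable (ae_of_all _ fun ω => ?_)
      exact ENNReal.mul_lt_top (approxLocalTime_ne_top hε t ω).lt_top
        (approxLocalTime_ne_top hδ t ω).lt_top
  have hfin : ∫⁻ ω, approxLocalTime Z ε t ω * approxLocalTime Z δ t ω ∂P ≠ ∞ := by
    refine ((lintegral_mono fun ω => mul_le_mul' (approxLocalTime_le hε t ω)
      (approxLocalTime_le hδ t ω)).trans_lt ?_).ne
    rw [lintegral_const, measure_univ, mul_one]
    finiteness
  -- Refining one of the two factors increases the mixed moment. In the expanded square the cross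
  -- term is therefore at most -2 E A_δ², where A_δ is the approximation at δ, leaving the
  -- difference of second moments.
  have hmix : ∫⁻ ω, approxLocalTime Z δ t ω ^ 2 ∂P
      ≤ ∫⁻ ω, approxLocalTime Z ε t ω * approxLocalTime Z δ t ω ∂P := by
    have := h.lintegral_prod_approxLocalTime_le hZ hZ (n := 2) (ε := ![δ, δ]) (δ := ![ε, δ])
      (by simp [Fin.forall_fin_two, hε, hδ]) (by simp [Fin.forall_fin_two, hεδ]) t
    simpa [Fin.prod_univ_two, sq] using this
  have hmix' := ENNReal.toReal_mono hfin hmix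
  have hexp : ∀ ω, ((approxLocalTime Z ε t ω).toReal - (approxLocalTime Z δ t ω).toReal) ^ 2
      = (approxLocalTime Z ε t ω).toReal * (approxLocalTime Z ε t ω).toReal
        - 2 * ((approxLocalTime Z ε t ω).toReal * (approxLocalTime Z δ t ω).toReal)
        + (approxLocalTime Z δ t ω).toReal * (approxLocalTime Z δ t ω).toReal := fun ω => by ring
  have i11 : Integrable (fun ω => (approxLocalTime Z ε t ω).toReal *
    (approxLocalTime Z ε t ω).toReal) P := m1.integrable_mul m1
  have i12 : Integrable (fun ω => 2 * ((approxLocalTime Z ε t ω).toReal *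
    (approxLocalTime Z δ t ω).toReal)) P := (m1.integrable_mul m2).const_mul 2
  have i22 : Integrable (fun ω => (approxLocalTime Z δ t ω).toReal *
    (approxLocalTime Z δ t ω).toReal) P := m2.integrable_mul m2
  have i112 : Integrable (fun ω => (approxLocalTime Z ε t ω).toReal *
    (approxLocalTime Z ε t ω).toReal - 2 * ((approxLocalTime Z ε t ω).toReal *
    (approxLocalTime Z δ t ω).toReal)) P := i11.sub i12
  simp_rw [hexp]
  rw [integral_add i112 i22, integral_sub i11 i12, integral_const_mul, e hε hε, e hε hδ,
    e hδ hδ]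
  simp_rw [sq] at hmix' ⊢
  linarith

end LocalTime

/-! ### Existence of the local time and boundedness of second moments -/

section LocalTimeExistence

variable {Ω : Type*} [MeasurableSpace Ω] {d : ℕ}
  {P : Measure Ω} [IsProbabilityMeasure P] {Z : ℝ≥0 → Ω → EuclideanSpace ℝ (Fin d)}

omit [IsProbabilityMeasure P] in
lemma eLpNorm_two_eq_ofReal_sqrt {f : Ω → ℝ} (hf : MemLp f 2 P) :
    eLpNorm f 2 P = ENNReal.ofReal (√(∫ ω, f ω ^ 2 ∂P)) := by
  rw [hf.eLpNorm_eq_integral_rpow_norm (by norm_num) (by norm_num), Real.sqrt_eq_rpow]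
  simp

/-- Bounded second moments of the approximate local times imply their convergence. -/
lemma exists_localTime (h : CharLE P Z P Z) (hZ : Measurable (Function.uncurry Z)) (t : ℝ≥0)
    (hfin : maxMoment P Z .delta 2 t ≠ ∞) :
    ∃ L : Ω → ℝ, MemLp L 2 P ∧ Tendsto (fun ε : ℝ => eLpNorm
      (fun ω => (approxLocalTime Z ε t ω).toReal - L ω) 2 P) (𝓝[>] 0) (𝓝 0) := by
  set M := maxMoment P Z .delta 2 t with hM
  let φ : ℝ → ℝ := fun ε => (∫⁻ ω, approxLocalTime Z ε t ω ^ 2 ∂P).toReal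
  -- The second moments increase to a finite supremum as ε ↓ 0, so their increments become small;
  -- these control the L² distances and give the Cauchy property.
  have hφM : ∀ ε, 0 < ε → φ ε ≤ M.toReal := fun ε hε =>
    ENNReal.toReal_mono hfin (le_maxMoment_delta hε 2 t)
  have hanti : ∀ ε δ, 0 < ε → ε ≤ δ → φ δ ≤ φ ε := fun ε δ hε hεδ =>
    ENNReal.toReal_mono ((le_maxMoment_delta hε 2 t).trans_lt hfin.lt_top).ne
      (h.lintegral_approxLocalTime_pow_le hZ hZ 2 hε hεδ t)
  have hclose : ∀ η : ℝ, 0 < η → ∃ ε, 0 < ε ∧ M.toReal - η < φ ε := fun η hη => by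
    by_contra! hcon
    have : M ≤ ENNReal.ofReal (M.toReal - η) := maxMoment_delta_le fun ε hε => by
      rw [← ENNReal.ofReal_toReal ((le_maxMoment_delta (P := P) (Z := Z) hε 2 t).trans_lt
        hfin.lt_top).ne]
      exact ENNReal.ofReal_le_ofReal (hcon ε hε)
    have h0 : 0 ≤ M.toReal - η := ENNReal.toReal_nonneg.trans (hcon 1 one_pos)
    have h1 := ENNReal.toReal_mono ENNReal.ofReal_ne_top this
    rw [ENNReal.toReal_ofReal h0] at h1
    linarith
  let F : ℝ → Lp ℝ 2 P := fun ε =>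
    if hε : 0 < ε then (memLp_approxLocalTime (P := P) hZ hε t).toLp else 0
  have hF : ∀ {ε} (hε : 0 < ε), F ε = (memLp_approxLocalTime (P := P) hZ hε t).toLp :=
    fun hε => dif_pos hε
  have hle : ∀ ε δ, 0 < ε → ε ≤ δ → edist (F ε) (F δ)
      ≤ ENNReal.ofReal (√(φ ε - φ δ)) := fun ε δ hε hεδ => by
    have hδ := hε.trans_le hεδ
    rw [hF hε, hF hδ, Lp.edist_toLp_toLp, eLpNorm_two_eq_ofReal_sqrt
      ((memLp_approxLocalTime hZ hε t).sub (memLp_approxLocalTime hZ hδ t))]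
    exact ENNReal.ofReal_le_ofReal (Real.sqrt_le_sqrt
      (integral_sub_approxLocalTime_sq_le h hZ hε hεδ t))
  have hcauchy : Cauchy (map F (𝓝[>] 0)) := by
    rw [EMetric.cauchy_iff]
    refine ⟨(map_neBot).ne, fun η hη => ?_⟩
    obtain ⟨ρ, hρ0, hρη⟩ := ENNReal.lt_iff_exists_nnreal_btwn.1 hη
    have hρ0' : (0 : ℝ) < ρ := by exact_mod_cast hρ0
    obtain ⟨ε₀, hε₀, hφε₀⟩ := hclose ((ρ : ℝ) ^ 2) (by positivity)
    have key : ∀ ε δ, 0 < ε → ε ≤ δ → δ < ε₀ → edist (F ε) (F δ) < η := fun ε δ hε hεδ hδ => by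
      refine ((hle ε δ hε hεδ).trans ?_).trans_lt hρη
      rw [← ENNReal.ofReal_coe_nnreal]
      refine ENNReal.ofReal_le_ofReal ?_
      rw [Real.sqrt_le_left ρ.coe_nonneg]
      have := hφM ε hε
      have := hanti δ ε₀ (hε.trans_le hεδ) hδ.le
      linarith
    refine ⟨F '' Set.Ioo 0 ε₀, image_mem_map (Ioo_mem_nhdsGT hε₀), ?_⟩
    rintro _ ⟨ε, hε, rfl⟩ _ ⟨δ, hδ, rfl⟩
    rcases le_total ε δ with hεδ | hεδ
    · exact key ε δ hε.1 hεδ hδ.2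
    · rw [edist_comm]
      exact key δ ε hδ.1 hεδ hε.2
  obtain ⟨L, hL⟩ := CompleteSpace.complete hcauchy
  refine ⟨L, Lp.memLp L, ?_⟩
  have h1 : Tendsto (fun ε => edist (F ε) L) (𝓝[>] 0) (𝓝 0) :=
    tendsto_iff_edist_tendsto_0.1 (show Tendsto F (𝓝[>] 0) (𝓝 L) from hL)
  refine h1.congr' ?_
  filter_upwards [self_mem_nhdsWithin] with ε hε
  have hε' : 0 < ε := hε
  rw [hF hε', Lp.edist_def]
  refine eLpNorm_congr_ae ?_
  filter_upwards [(memLp_approxLocalTime (P := P) hZ hε' t).coeFn_toLp] with ω hω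
  simp [hω]

/-- Convergence of the approximate local times implies bounded second moments. -/
lemma maxMoment_two_ne_top (h : CharLE P Z P Z) (hZ : Measurable (Function.uncurry Z)) {t : ℝ≥0}
    {L : Ω → ℝ} (hL : MemLp L 2 P) (hlim : Tendsto (fun ε : ℝ => eLpNorm
      (fun ω => (approxLocalTime Z ε t ω).toReal - L ω) 2 P) (𝓝[>] 0) (𝓝 0)) :
    maxMoment P Z .delta 2 t ≠ ∞ := by
  have hev := hlim.eventually_lt_const (show (0 : ℝ≥0∞) < 1 from one_pos)
  have hbound : maxMoment P Z .delta 2 t ≤ (1 + eLpNorm L 2 P) ^ 2 :=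
    maxMoment_delta_le fun ε hε => by
      -- An arbitrary ε is compared with a smaller δ at which the L² distance to L is already below
      -- 1.
      obtain ⟨δ, hδ1, hδ⟩ := (hev.and (Ioo_mem_nhdsGT hε)).exists
      refine (h.lintegral_approxLocalTime_pow_le hZ hZ 2 hδ.1 hδ.2.le t).trans ?_
      have hm := memLp_approxLocalTime (P := P) hZ hδ.1 t
      have hn : eLpNorm (fun ω => (approxLocalTime Z δ t ω).toReal) 2 P ≤ 1 + eLpNorm L 2 P := by
        have := eLpNorm_add_le (hm.sub hL).aestronglyMeasurable hL.aestronglyMeasurable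
          (p := 2) (by norm_num)
        rw [sub_add_cancel] at this
        exact this.trans (by gcongr; exact hδ1.le)
      refine le_trans (le_of_eq ?_) (pow_le_pow_left₀ zero_le hn 2)
      rw [eLpNorm_eq_lintegral_rpow_enorm_toReal (by norm_num) (by norm_num)]
      have : ∀ ω, ‖(approxLocalTime Z δ t ω).toReal‖ₑ = approxLocalTime Z δ t ω := fun ω => by
        rw [Real.enorm_of_nonneg ENNReal.toReal_nonneg,
          ENNReal.ofReal_toReal (approxLocalTime_ne_top hδ.1 t ω)]
      simp_rw [this]
      rw [← ENNReal.rpow_natCast, ← ENNReal.rpow_mul]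
      simp
  exact (hbound.trans_lt (ENNReal.pow_lt_top (ENNReal.add_lt_top.2
    ⟨ENNReal.one_lt_top, hL.eLpNorm_lt_top⟩))).ne

end LocalTimeExistence

/-! ### Gaussian rotation with an independent copy -/

section Rotation

variable {Ω : Type*} [MeasurableSpace Ω] {d : ℕ}
  {P : Measure Ω} [IsProbabilityMeasure P] {Z : ℝ≥0 → Ω → EuclideanSpace ℝ (Fin d)}

/-- A process plus a multiple of an independent copy, on the product space. -/
def addCopy (Z : ℝ≥0 → Ω → EuclideanSpace ℝ (Fin d)) (τ : ℝ) (s : ℝ≥0) (p : Ω × Ω) :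
    EuclideanSpace ℝ (Fin d) :=
  Z s p.1 + τ • Z s p.2

lemma measurable_addCopy (hZ : Measurable (Function.uncurry Z)) (τ : ℝ) :
    Measurable (Function.uncurry (addCopy Z τ)) := by
  have h1 : Measurable fun q : ℝ≥0 × (Ω × Ω) => Z q.1 q.2.1 :=
    hZ.comp (g := Function.uncurry Z) (f := fun q : ℝ≥0 × (Ω × Ω) => (q.1, q.2.1))
      (measurable_fst.prodMk (measurable_fst.comp measurable_snd))
  have h2 : Measurable fun q : ℝ≥0 × (Ω × Ω) => Z q.1 q.2.2 :=
    hZ.comp (g := Function.uncurry Z) (f := fun q : ℝ≥0 × (Ω × Ω) => (q.1, q.2.2))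
      (measurable_fst.prodMk (measurable_snd.comp measurable_snd))
  exact h1.add (h2.const_smul τ)

/-- Independence adds the variances of the two terms, and c² + (cτ)² = 1, so the covariance is that
of Z. -/
lemma jointChar_smul_addCopy (hG : IsGaussianProcess Z P) (hc : ∀ t, ∫ ω, Z t ω ∂P = 0)
    {c τ : ℝ} (hcτ : c ^ 2 * (1 + τ ^ 2) = 1) {n : ℕ} (s : Fin n → ℝ≥0)
    (ξ : Fin n → EuclideanSpace ℝ (Fin d)) :
    jointChar (P.prod P) (fun i p => c • addCopy Z τ (s i) p) ξ
      = jointChar P (fun i => Z (s i)) ξ := by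
  have hs := hasGaussianLaw_tuple hG s
  have hcs : ∀ i, ∫ ω, Z (s i) ω ∂P = 0 := fun i => hc _
  have hscale : ∀ a : ℝ, ∫ ω, Complex.exp (((∑ i, inner ℝ (Z (s i) ω) (a • ξ i) : ℝ) : ℂ) *
      Complex.I) ∂P = (Real.exp (-(a ^ 2 * ∫ ω, (∑ i, inner ℝ (Z (s i) ω) (ξ i)) ^ 2 ∂P) / 2) :
        ℝ) := fun a => by
    refine (jointChar_eq_exp hs hcs (fun i => a • ξ i)).trans ?_
    simp_rw [real_inner_smul_right, ← Finset.mul_sum, mul_pow]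
    rw [integral_const_mul]
  have e : ∀ p : Ω × Ω, Complex.exp (((∑ i, inner ℝ (c • addCopy Z τ (s i) p) (ξ i) : ℝ) : ℂ) *
      Complex.I) = Complex.exp (((∑ i, inner ℝ (Z (s i) p.1) (c • ξ i) : ℝ) : ℂ) * Complex.I) *
        Complex.exp (((∑ i, inner ℝ (Z (s i) p.2) ((c * τ) • ξ i) : ℝ) : ℂ) * Complex.I) :=
    fun p => by
      rw [← Complex.exp_add, ← add_mul, ← Complex.ofReal_add, ← Finset.sum_add_distrib]
      congr 4
      ext i
      simp only [addCopy, smul_add, inner_add_left, real_inner_smul_left, real_inner_smul_right]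
      ring
  rw [jointChar]
  simp_rw [e]
  rw [integral_prod_mul (fun ω => Complex.exp (((∑ i, inner ℝ (Z (s i) ω) (c • ξ i) : ℝ) : ℂ) *
      Complex.I)) (fun ω => Complex.exp (((∑ i, inner ℝ (Z (s i) ω) ((c * τ) • ξ i) : ℝ) : ℂ) *
      Complex.I)), hscale, hscale, jointChar_eq_exp hs hcs, ← Complex.ofReal_mul, ← Real.exp_add]
  congr 2
  have : c ^ 2 + (c * τ) ^ 2 = 1 := by rw [← hcτ]; ring
  set q := ∫ ω, (∑ i, inner ℝ (Z (s i) ω) (ξ i)) ^ 2 ∂P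
  calc _ = -((c ^ 2 + (c * τ) ^ 2) * q) / 2 := by ring
    _ = _ := by rw [this, one_mul]

omit [IsProbabilityMeasure P] in
lemma charLE_self (hG : IsGaussianProcess Z P) (hc : ∀ t, ∫ ω, Z t ω ∂P = 0) :
    CharLE P Z P Z := by
  intro n s ξ
  have := jointChar_eq_exp (hasGaussianLaw_tuple hG s) (fun i => hc _) ξ
  rw [jointChar] at this
  rw [this, Complex.ofReal_re, Complex.norm_real, Real.norm_of_nonneg (Real.exp_pos _).le]

omit [MeasurableSpace Ω] in
lemma approxLocalTime_smul {c : ℝ} (hc : 0 < c) {ε : ℝ} (hε : 0 < ε) (t : ℝ≥0) (ω : Ω) :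
    approxLocalTime Z (ε / c ^ 2) t ω
      = ENNReal.ofReal (c ^ d) * approxLocalTime (fun s ω => c • Z s ω) ε t ω := by
  rw [approxLocalTime, approxLocalTime, ← pathIntegral_const_mul ENNReal.ofReal_ne_top]
  refine lintegral_congr fun s => ?_
  simp only [heatKernel_div_sq hε hc, ENNReal.ofReal_mul (show (0 : ℝ) ≤ c ^ d by positivity)]

/-- The law of the approximate local time is invariant under the Gaussian rotation. -/
lemma lintegral_comp_approxLocalTime_rotation (hG : IsGaussianProcess Z P)
    (hc : ∀ t, ∫ ω, Z t ω ∂P = 0) (hZ : Measurable (Function.uncurry Z)) {c τ : ℝ}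
    (hcτ : c ^ 2 * (1 + τ ^ 2) = 1) {ε : ℝ} (hε : 0 < ε) (t : ℝ≥0) {Φ : ℝ≥0∞ → ℝ≥0∞}
    (hΦ : Measurable Φ) :
    ∫⁻ p, Φ (approxLocalTime (fun s p => c • addCopy Z τ s p) ε t p) ∂(P.prod P)
      = ∫⁻ ω, Φ (approxLocalTime Z ε t ω) ∂P := by
  have hself := charLE_self hG hc
  have hV : Measurable (Function.uncurry fun s p => c • addCopy Z τ s p) :=
    (measurable_addCopy hZ τ).const_smul c
  have h1 : CharLE (P.prod P) (fun s p => c • addCopy Z τ s p) P Z := fun n s ξ => by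
    have := jointChar_smul_addCopy hG hc hcτ s ξ
    rw [jointChar, jointChar] at this
    rw [this]
    exact hself n s ξ
  have h2 : CharLE P Z (P.prod P) (fun s p => c • addCopy Z τ s p) := fun n s ξ => by
    have := jointChar_smul_addCopy hG hc hcτ s ξ
    rw [jointChar, jointChar] at this
    rw [this]
    exact hself n s ξ
  -- For fixed ε the approximate local times are bounded, so their moments, computed from
  -- finite-dimensional laws, determine their laws.
  refine lintegral_comp_eq_of_forall_lintegral_pow_eq (measurable_approxLocalTime hV ε t)
    (measurable_approxLocalTime hZ ε t)
    (C := ((2 * Real.pi * ε) ^ (-(d : ℝ) / 2)).toNNReal * t)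
    (fun p => by exact_mod_cast approxLocalTime_le hε t p)
    (fun ω => by exact_mod_cast approxLocalTime_le hε t ω) (fun n => le_antisymm ?_ ?_) hΦ
  · exact h1.lintegral_approxLocalTime_pow_le hV hZ n hε le_rfl t
  · exact h2.lintegral_approxLocalTime_pow_le hZ hV n hε le_rfl t

end Rotation

/-! ### Moments of the local time -/

section LocalTimeMoments

variable {Ω : Type*} [MeasurableSpace Ω] {d : ℕ}
  {P : Measure Ω} [IsProbabilityMeasure P] {Z : ℝ≥0 → Ω → EuclideanSpace ℝ (Fin d)}

lemma HasFourierDensity.apply_zero {f g : EuclideanSpace ℝ (Fin d) → ℝ}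
    (h : HasFourierDensity f g) : f 0 = ∫ ξ, g ξ := by
  have := h.eq_integral 0
  simp only [inner_zero_left, Complex.ofReal_zero, zero_mul, Complex.exp_zero, mul_one] at this
  rw [integral_complex_ofReal] at this
  exact_mod_cast this

/-- The heat kernel averaged over an independent Gaussian shift. -/
lemma hasFourierDensity_heatKernel_average (hG : IsGaussianProcess Z P)
    (hc : ∀ t, ∫ ω, Z t ω ∂P = 0) (hZ : ∀ t, Measurable (Z t)) (τ : ℝ) {δ : ℝ} (hδ : 0 < δ)
    (s : ℝ≥0) :
    HasFourierDensity (fun x => ∫ ω, heatKernel δ (x + τ • Z s ω) ∂P) (fun ξ =>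
      ((2 * Real.pi) ^ d)⁻¹ * Real.exp (-(δ / 2) * ‖ξ‖ ^ 2) *
        Real.exp (-(τ ^ 2 * ∫ ω, inner ℝ (Z s ω) ξ ^ 2 ∂P) / 2)) := by
  refine (hasFourierDensity_heatKernel hδ).average ((hZ s).const_smul τ) (fun ξ => ?_)
    fun ξ => (Real.exp_pos _).le
  have h := jointChar_eq_exp (hasGaussianLaw_tuple hG fun _ : Fin 1 => s) (fun i => hc _)
    (fun _ => τ • ξ)
  simp only [jointChar, Finset.univ_unique, Finset.sum_const, Finset.card_singleton, one_smul,
    real_inner_smul_right, mul_pow] at h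
  rw [integral_const_mul] at h
  simp only [Pi.smul_apply, real_inner_smul_left]
  exact h

lemma ofReal_integral_heatKernel (hZ : ∀ t, Measurable (Z t)) (τ : ℝ) {δ : ℝ} (hδ : 0 < δ)
    (s : ℝ≥0) (x : EuclideanSpace ℝ (Fin d)) :
    ENNReal.ofReal (∫ ω, heatKernel δ (x + τ • Z s ω) ∂P)
      = ∫⁻ ω, ENNReal.ofReal (heatKernel δ (x + τ • Z s ω)) ∂P := by
  have hm : Measurable fun ω => heatKernel δ (x + τ • Z s ω) :=
    (measurable_heatKernel δ).comp (((hZ s).const_smul τ).const_add x)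
  refine ofReal_integral_eq_lintegral_ofReal ?_ (ae_of_all _ fun ω => heatKernel_nonneg hδ _)
  refine Integrable.of_bound hm.aestronglyMeasurable ((2 * Real.pi * δ) ^ (-(d : ℝ) / 2))
    (ae_of_all _ fun ω => ?_)
  rw [Real.norm_of_nonneg (heatKernel_nonneg hδ _)]
  exact heatKernel_le hδ _

lemma lintegral_approxLocalTime_addCopy (hZ : Measurable (Function.uncurry Z)) (τ : ℝ) {δ : ℝ}
    (hδ : 0 < δ) (t : ℝ≥0) (ω : Ω) :
    ∫⁻ ω', approxLocalTime (addCopy Z τ) δ t (ω, ω') ∂P = ∫⁻ s in Set.Ioc (0 : ℝ) t,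
      ENNReal.ofReal (∫ ω', heatKernel δ (Z s.toNNReal ω + τ • Z s.toNNReal ω') ∂P) := by
  have hZt : ∀ t, Measurable (Z t) := fun t => hZ.comp measurable_prodMk_left
  have hm := measurable_comp_toNNReal (measurable_addCopy hZ τ)
    (measurable_heatKernel δ).ennreal_ofReal
  have hp : Measurable fun q : Ω × ℝ => (q.2, (ω, q.1)) :=
    measurable_snd.prodMk (measurable_const.prodMk measurable_fst)
  unfold approxLocalTime pathIntegral
  rw [lintegral_lintegral_swap]
  · refine lintegral_congr fun s => ?_
    rw [ofReal_integral_heatKernel hZt τ hδ]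
    rfl
  · exact (hm.comp hp).aemeasurable

/-- On the Fourier side, averaging over τZ'_s multiplies the density by exp(-τ² Var⟨Z_s, ξ⟩ / 2).
Since the variance is at most σ|ξ|² and δ + τ²σ ≤ ε, the resulting density still dominates that of
the heat kernel of width ε. -/
lemma lintegral_approxLocalTime_pow_le_average (hG : IsGaussianProcess Z P)
    (hc : ∀ t, ∫ ω, Z t ω ∂P = 0) (hZ : Measurable (Function.uncurry Z)) {σ τ δ ε : ℝ} {t : ℝ≥0}
    (hσ : ∀ s, 0 < s → s ≤ t → ∀ ξ, ∫ ω, inner ℝ (Z s ω) ξ ^ 2 ∂P ≤ σ * ‖ξ‖ ^ 2)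
    (hδ : 0 < δ) (hε : 0 < ε) (hle : δ + τ ^ 2 * σ ≤ ε) (n : ℕ) :
    ∫⁻ ω, approxLocalTime Z ε t ω ^ n ∂P
      ≤ ∫⁻ ω, (∫⁻ ω', approxLocalTime (addCopy Z τ) δ t (ω, ω') ∂P) ^ n ∂P := by
  have hZt : ∀ t, Measurable (Z t) := fun t => hZ.comp measurable_prodMk_left
  simp_rw [lintegral_approxLocalTime_addCopy hZ τ hδ]
  obtain ⟨q, hq⟩ : ∃ q : ℝ → EuclideanSpace ℝ (Fin d) → ℝ, ∀ s x, q s x =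
    ∫ ω', heatKernel δ (x + τ • Z s.toNNReal ω') ∂P := ⟨_, fun _ _ => rfl⟩
  have hqm : Measurable (Function.uncurry fun s ω => ENNReal.ofReal (q s (Z s.toNNReal ω))) := by
    have hp : Measurable fun u : (ℝ × Ω) × Ω => (u.1.1, (u.1.2, u.2)) :=
      (measurable_fst.comp measurable_fst).prodMk
        ((measurable_snd.comp measurable_fst).prodMk measurable_snd)
    have hm := (measurable_comp_toNNReal (measurable_addCopy hZ τ)
      (measurable_heatKernel δ).ennreal_ofReal).comp hp
    have hm2 := hm.lintegral_prod_right' (ν := P)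
    convert! hm2 using 1
    ext ⟨s, ω⟩
    simp only [Function.uncurry, hq]
    rw [ofReal_integral_heatKernel hZt τ hδ]
    rfl
  have e1 := lintegral_prod_lintegral P (volume.restrict (Set.Ioc (0 : ℝ) t))
    (fun (_ : Fin n) s ω => ENNReal.ofReal (q s (Z s.toNNReal ω))) fun _ => hqm
  have e2 := lintegral_prod_pathIntegral (P := P) hZ (f := fun (_ : Fin n) x =>
    ENNReal.ofReal (heatKernel ε x)) (fun _ => (measurable_heatKernel ε).ennreal_ofReal) 0 t
  simp only [Finset.prod_const, Finset.card_univ, Fintype.card_fin] at e1 e2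
  simp_rw [← hq]
  rw [e1]
  refine e2.trans_le ?_
  have hpos : ∀ᵐ s : Fin n → ℝ ∂(Measure.pi fun _ => volume.restrict (Set.Ioc (0 : ℝ) t)),
      ∀ i, s i ∈ Set.Ioc (0 : ℝ) t := by
    rw [ae_all_iff]
    intro i
    exact Measure.tendsto_eval_ae_ae.eventually (ae_restrict_mem measurableSet_Ioc)
  refine lintegral_mono_ae ?_
  filter_upwards [hpos] with s hs
  have hd : ∀ i, HasFourierDensity (q (s i)) _ := fun i => by
    have := hasFourierDensity_heatKernel_average hG hc hZt τ hδ (s i).toNNReal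
    simp_rw [← hq] at this
    exact this
  refine lintegral_prod_le_lintegral_prod (Z := fun i => Z (s i).toNNReal)
    (X := fun i => Z (s i).toNNReal) (fun i => hZt _) (fun i => hZt _)
    (fun _ => hasFourierDensity_heatKernel hε) hd (fun _ => heatKernel_nonneg hε)
    (fun i x => ?_) fun ξ => ?_
  · rw [hq]
    exact integral_nonneg fun ω => heatKernel_nonneg hδ _
  · have h0 := charLE_self hG hc n (fun i => (s i).toNNReal) ξ
    refine mul_le_mul h0 (Finset.prod_le_prod (fun i _ => by positivity) fun i _ => ?_)
      (Finset.prod_nonneg fun i _ => by positivity) ((norm_nonneg _).trans h0)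
    rw [mul_assoc, ← Real.exp_add]
    gcongr
    have h1 := hσ (s i).toNNReal (Real.toNNReal_pos.2 (hs i).1)
      (Real.toNNReal_le_iff_le_coe.2 (hs i).2) (ξ i)
    have h2 : τ ^ 2 * ∫ ω, inner ℝ (Z (s i).toNNReal ω) (ξ i) ^ 2 ∂P
        ≤ τ ^ 2 * (σ * ‖ξ i‖ ^ 2) := by gcongr
    have h3 : (δ + τ ^ 2 * σ) * ‖ξ i‖ ^ 2 ≤ ε * ‖ξ i‖ ^ 2 := by gcongr
    linarith

/-- A bound uniform in ω and in δ: a function with nonnegative Fourier density is largest at the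
origin, so the path of Z may be replaced by 0. What remains is the mean approximate local time of
τZ', a rescaling of that of Z. -/
lemma lintegral_approxLocalTime_addCopy_le (hG : IsGaussianProcess Z P)
    (hc : ∀ t, ∫ ω, Z t ω ∂P = 0) (hZ : Measurable (Function.uncurry Z)) {τ δ : ℝ} (hτ : 0 < τ)
    (hδ : 0 < δ) (t : ℝ≥0) (ω : Ω) :
    ∫⁻ ω', approxLocalTime (addCopy Z τ) δ t (ω, ω') ∂P
      ≤ (ENNReal.ofReal (τ ^ d))⁻¹ * (1 + maxMoment P Z .delta 2 t) := by
  have hZt : ∀ t, Measurable (Z t) := fun t => hZ.comp measurable_prodMk_left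
  have hτZ : Measurable (Function.uncurry fun s ω => τ • Z s ω) := hZ.const_smul τ
  have hk0 : ENNReal.ofReal (τ ^ d) ≠ 0 := by simp; positivity
  have h1 : ∫⁻ ω', approxLocalTime (addCopy Z τ) δ t (ω, ω') ∂P
      ≤ ∫⁻ ω', approxLocalTime (fun s ω => τ • Z s ω) δ t ω' ∂P := by
    rw [lintegral_approxLocalTime_addCopy hZ τ hδ]
    have hm := measurable_comp_toNNReal hτZ (measurable_heatKernel δ).ennreal_ofReal
    have e : ∫⁻ ω', approxLocalTime (fun s ω => τ • Z s ω) δ t ω' ∂P =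
        ∫⁻ s in Set.Ioc (0 : ℝ) t, ∫⁻ ω', ENNReal.ofReal (heatKernel δ (τ • Z s.toNNReal ω')) ∂P := by
      unfold approxLocalTime pathIntegral
      exact lintegral_lintegral_swap (hm.comp measurable_swap).aemeasurable
    rw [e]
    refine lintegral_mono fun s => ?_
    have h0 := ofReal_integral_heatKernel (P := P) hZt τ hδ s.toNNReal 0
    simp only [zero_add] at h0
    rw [← h0]
    refine ENNReal.ofReal_le_ofReal ((le_abs_self _).trans ?_)
    have hF := hasFourierDensity_heatKernel_average hG hc hZt τ hδ s.toNNReal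
    have := hF.abs_le (Z s.toNNReal ω)
    rw [← hF.apply_zero] at this
    simpa using this
  refine h1.trans ?_
  rw [mul_comm, ← div_eq_mul_inv, ENNReal.le_div_iff_mul_le (Or.inl hk0)
    (Or.inl ENNReal.ofReal_ne_top), mul_comm, ← lintegral_const_mul' _ _ ENNReal.ofReal_ne_top]
  simp_rw [← approxLocalTime_smul hτ hδ]
  -- The first moment is bounded through x ≤ 1 + x².
  refine (lintegral_mono (g := fun ω => 1 + approxLocalTime Z (δ / τ ^ 2) t ω ^ 2)
    fun ω => ?_).trans ?_
  · simp only
    rcases le_total (approxLocalTime Z (δ / τ ^ 2) t ω) 1 with h | h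
    · exact h.trans le_self_add
    · exact (le_self_pow h two_ne_zero).trans le_add_self
  · rw [lintegral_add_left measurable_const, lintegral_one, measure_univ]
    gcongr
    exact le_maxMoment_delta (by positivity) 2 t

end LocalTimeMoments

section LocalTimeMoments

variable {Ω : Type*} [MeasurableSpace Ω] {d : ℕ}
  {P : Measure Ω} [IsProbabilityMeasure P] {Z : ℝ≥0 → Ω → EuclideanSpace ℝ (Fin d)}

/-- A truncation bound for the moments of the approximate local time by the law of the approximate
local time at a smaller scale. -/
lemma lintegral_approxLocalTime_pow_succ_le (hG : IsGaussianProcess Z P)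
    (hc : ∀ t, ∫ ω, Z t ω ∂P = 0) (hZ : Measurable (Function.uncurry Z)) {σ τ c δ ε : ℝ} {t : ℝ≥0}
    (hσ : ∀ s, 0 < s → s ≤ t → ∀ ξ, ∫ ω, inner ℝ (Z s ω) ξ ^ 2 ∂P ≤ σ * ‖ξ‖ ^ 2)
    (hτ : 0 < τ) (hc0 : 0 < c) (hcτ : c ^ 2 * (1 + τ ^ 2) = 1) (hδ : 0 < δ) (hε : 0 < ε)
    (hle : δ / c ^ 2 + τ ^ 2 * σ ≤ ε) (n : ℕ) (K : ℝ≥0∞) :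
    ∫⁻ ω, approxLocalTime Z ε t ω ^ (n + 1) ∂P
      ≤ ∫⁻ ω, min (approxLocalTime Z δ t ω) K ^ (n + 1) ∂P +
        (n + 1) * ((ENNReal.ofReal (τ ^ d))⁻¹ * (1 + maxMoment P Z .delta 2 t)) ^ n *
          ∫⁻ ω, (approxLocalTime Z δ t ω - K) ∂P := by
  set C := (ENNReal.ofReal (τ ^ d))⁻¹ * (1 + maxMoment P Z .delta 2 t) with hC
  have hc1 : c ≤ 1 := by
    by_contra! h
    nlinarith [sq_nonneg τ, mul_pos hτ hτ]
  obtain ⟨V, hV⟩ : ∃ V : Ω × Ω → ℝ≥0∞, ∀ p, V p =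
    approxLocalTime (fun s p => c • addCopy Z τ s p) δ t p := ⟨_, fun _ => rfl⟩
  have hVm : Measurable V := by
    rw [funext hV]
    exact measurable_approxLocalTime ((measurable_addCopy hZ τ).const_smul c) δ t
  set k := ENNReal.ofReal (c ^ d) with hk
  have hk1 : k ≤ 1 := ENNReal.ofReal_le_one.2 (pow_le_one₀ hc0.le hc1)
  -- Up to the factor c^d ≤ 1, this is the approximation at scale δ for the rotated process, whose
  -- law is that for Z.
  have hU : ∀ p, approxLocalTime (addCopy Z τ) (δ / c ^ 2) t p = k * V p := fun p => by
    rw [approxLocalTime_smul hc0 hδ, hV]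
  have hm1 : Measurable fun p => k * min (V p) K := (hVm.min measurable_const).const_mul k
  have hm2 : Measurable fun p => k * (V p - K) := (hVm.sub measurable_const).const_mul k
  have hsplit : ∀ p, k * V p = k * min (V p) K + k * (V p - K) := fun p => by
    rw [← mul_add, add_comm, tsub_add_min]
  have hmin : Measurable fun v : ℝ≥0∞ => min v K ^ (n + 1) :=
    (measurable_id.min measurable_const).pow_const _
  have hsub : Measurable fun v : ℝ≥0∞ => v - K := measurable_id.sub measurable_const
  have r1 := lintegral_comp_approxLocalTime_rotation hG hc hZ hcτ hδ t hmin
  have r2 := lintegral_comp_approxLocalTime_rotation hG hc hZ hcτ hδ t hsub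
  simp only [← hV] at r1 r2
  have hδ' : 0 < δ / c ^ 2 := by positivity
  refine (lintegral_approxLocalTime_pow_le_average hG hc hZ hσ hδ' hε hle (n + 1)).trans ?_
  -- For fixed ω the average over the copy is at most C. Splitting V at level K, the truncated part
  -- goes through Jensen's inequality and the excess enters linearly.
  have hpt : ∀ ω, (∫⁻ ω', approxLocalTime (addCopy Z τ) (δ / c ^ 2) t (ω, ω') ∂P) ^ (n + 1)
      ≤ ∫⁻ ω', min (V (ω, ω')) K ^ (n + 1) ∂P
        + (n + 1) * C ^ n * ∫⁻ ω', (V (ω, ω') - K) ∂P := fun ω => by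
    have hb := lintegral_approxLocalTime_addCopy_le hG hc hZ hτ hδ' t ω
    have h1 : Measurable fun ω' => k * min (V (ω, ω')) K := hm1.comp measurable_prodMk_left
    simp only [hU, hsplit] at hb ⊢
    rw [lintegral_add_left h1] at hb ⊢
    refine (add_pow_succ_le hb n).trans (add_le_add ?_ ?_)
    · refine (lintegral_pow_le_lintegral_pow h1 _).trans (lintegral_mono fun ω' => ?_)
      exact pow_le_pow_left₀ zero_le (mul_le_of_le_one_left zero_le hk1) _
    · gcongr with ω'
      exact mul_le_of_le_one_left zero_le hk1
  refine (lintegral_mono hpt).trans ?_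
  have hm3 : Measurable fun ω => ∫⁻ ω', min (V (ω, ω')) K ^ (n + 1) ∂P :=
    (hmin.comp hVm).lintegral_prod_right'
  have hm4 : Measurable fun ω => ∫⁻ ω', (V (ω, ω') - K) ∂P :=
    (hsub.comp hVm).lintegral_prod_right'
  have hm5 : Measurable fun p => min (V p) K ^ (n + 1) := hmin.comp hVm
  have hm6 : Measurable fun p => V p - K := hsub.comp hVm
  rw [lintegral_add_left hm3, lintegral_const_mul _ hm4, ← r1, ← r2,
    lintegral_prod _ hm5.aemeasurable, lintegral_prod _ hm6.aemeasurable]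

lemma exists_seq_tendsto_localTime (hZ : Measurable (Function.uncurry Z)) {t : ℝ≥0} {L : Ω → ℝ}
    (hL : MemLp L 2 P) (hlim : Tendsto (fun ε : ℝ => eLpNorm
      (fun ω => (approxLocalTime Z ε t ω).toReal - L ω) 2 P) (𝓝[>] 0) (𝓝 0)) :
    ∃ e : ℕ → ℝ, (∀ j, 0 < e j) ∧ Tendsto e atTop (𝓝 0) ∧
      (∀ᵐ ω ∂P, Tendsto (fun j => approxLocalTime Z (e j) t ω) atTop
        (𝓝 (ENNReal.ofReal (L ω)))) ∧
      Tendsto (fun j => ∫⁻ ω, ‖(approxLocalTime Z (e j) t ω).toReal - L ω‖ₑ ∂P) atTop (𝓝 0) := by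
  have hu : Tendsto (fun j : ℕ => 1 / ((j : ℝ) + 1)) atTop (𝓝[>] 0) :=
    tendsto_nhdsWithin_iff.2 ⟨tendsto_one_div_add_atTop_nhds_zero_nat,
      Eventually.of_forall fun j => by simp; positivity⟩
  have hupos : ∀ j : ℕ, 0 < 1 / ((j : ℝ) + 1) := fun j => by positivity
  have hl := hlim.comp hu
  have hmeas := tendstoInMeasure_of_tendsto_eLpNorm (p := 2) (by norm_num)
    (fun j => (memLp_approxLocalTime (P := P) hZ (hupos j) t).aestronglyMeasurable)
    hL.aestronglyMeasurable hl
  obtain ⟨ns, hns, hae⟩ := hmeas.exists_seq_tendsto_ae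
  refine ⟨fun j => 1 / ((ns j : ℝ) + 1), fun j => hupos _, ?_, ?_, ?_⟩
  · exact (hu.mono_right nhdsWithin_le_nhds).comp hns.tendsto_atTop
  · filter_upwards [hae] with ω hω
    refine (ENNReal.tendsto_ofReal hω).congr fun j => ?_
    rw [ENNReal.ofReal_toReal (approxLocalTime_ne_top (hupos _) t ω)]
  · refine tendsto_of_tendsto_of_tendsto_of_le_of_le tendsto_const_nhds
      (hl.comp hns.tendsto_atTop) (fun j => zero_le) fun j => ?_
    simp only [Function.comp_apply]
    rw [← eLpNorm_one_eq_lintegral_enorm]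
    exact eLpNorm_le_eLpNorm_of_exponent_le (by norm_num)
      ((memLp_approxLocalTime (P := P) hZ (hupos _) t).sub hL).aestronglyMeasurable

/-- The moments of the local time are the limits of those of the approximate local times. -/
lemma lintegral_localTime_pow (hG : IsGaussianProcess Z P)
    (hc : ∀ t, ∫ ω, Z t ω ∂P = 0) (hZ : Measurable (Function.uncurry Z)) {σ : ℝ} {t : ℝ≥0}
    (hσ : ∀ s, 0 < s → s ≤ t → ∀ ξ, ∫ ω, inner ℝ (Z s ω) ξ ^ 2 ∂P ≤ σ * ‖ξ‖ ^ 2) {L : Ω → ℝ}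
    (hL : MemLp L 2 P) (hlim : Tendsto (fun ε : ℝ => eLpNorm
      (fun ω => (approxLocalTime Z ε t ω).toReal - L ω) 2 P) (𝓝[>] 0) (𝓝 0)) (n : ℕ) :
    ∫⁻ ω, ENNReal.ofReal (L ω) ^ n ∂P = maxMoment P Z .delta n t := by
  obtain ⟨e, he0, he, hae, hL1⟩ := exists_seq_tendsto_localTime hZ hL hlim
  have hLm : AEMeasurable (fun ω => ENNReal.ofReal (L ω)) P :=
    hL.aestronglyMeasurable.aemeasurable.ennreal_ofReal
  -- One direction is Fatou along the subsequence. The other uses the truncation bound, which needs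
  -- only almost sure and L¹ convergence: first the scale tends to 0, then K to infinity.
  refine le_antisymm ?_ (maxMoment_delta_le fun ε hε => ?_)
  · calc ∫⁻ ω, ENNReal.ofReal (L ω) ^ n ∂P
        ≤ ∫⁻ ω, liminf (fun j => approxLocalTime Z (e j) t ω ^ n) atTop ∂P := by
          refine lintegral_mono_ae ?_
          filter_upwards [hae] with ω hω
          exact (((ENNReal.continuous_pow n).tendsto _).comp hω).liminf_eq.ge
      _ ≤ liminf (fun j => ∫⁻ ω, approxLocalTime Z (e j) t ω ^ n ∂P) atTop :=
          lintegral_liminf_le fun j => (measurable_approxLocalTime hZ _ t).pow_const n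
      _ ≤ maxMoment P Z .delta n t :=
          liminf_le_of_le ⟨0, by simp⟩ fun b hb => by
            obtain ⟨j, hj⟩ := hb.exists
            exact hj.trans (le_maxMoment_delta (he0 j) n t)
  rcases n with _ | n
  · simp
  have hfin2 := maxMoment_two_ne_top (charLE_self hG hc) hZ hL hlim
  -- Makes τ²σ at most ε/2, leaving room for small scales e j / c² within ε.
  let τ : ℝ := √(ε / (2 * (|σ| + 1)))
  have hτ : 0 < τ := by positivity
  have hτσ : τ ^ 2 * σ < ε := by
    have h1 : τ ^ 2 * (2 * (|σ| + 1)) = ε := by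
      rw [Real.sq_sqrt (by positivity)]
      field_simp
    nlinarith [le_abs_self σ, abs_nonneg σ, mul_pos hτ hτ]
  let c : ℝ := (√(1 + τ ^ 2))⁻¹
  have hc0 : 0 < c := by positivity
  have hcτ : c ^ 2 * (1 + τ ^ 2) = 1 := by
    rw [inv_pow, Real.sq_sqrt (by positivity), inv_mul_cancel₀ (by positivity)]
  set D : ℝ≥0∞ := (n + 1) * ((ENNReal.ofReal (τ ^ d))⁻¹ * (1 + maxMoment P Z .delta 2 t)) ^ n
    with hD
  have hDtop : D ≠ ∞ := by
    refine ENNReal.mul_ne_top (by simp) (ENNReal.pow_ne_top (ENNReal.mul_ne_top ?_ ?_))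
    · simp; positivity
    · exact ENNReal.add_ne_top.2 ⟨ENNReal.one_ne_top, hfin2⟩
  have hev : ∀ᶠ j in atTop, e j / c ^ 2 + τ ^ 2 * σ ≤ ε := by
    have : Tendsto (fun j => e j / c ^ 2 + τ ^ 2 * σ) atTop (𝓝 (0 / c ^ 2 + τ ^ 2 * σ)) :=
      (he.div_const _).add_const _
    rw [zero_div, zero_add] at this
    exact (this.eventually_lt_const hτσ).mono fun j hj => hj.le
  -- pass to the limit in the truncation bound
  have hK : ∀ K : ℕ, ∫⁻ ω, approxLocalTime Z ε t ω ^ (n + 1) ∂P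
      ≤ ∫⁻ ω, ENNReal.ofReal (L ω) ^ (n + 1) ∂P
        + D * ∫⁻ ω, (ENNReal.ofReal (L ω) - K) ∂P := fun K => by
    have hmin : Tendsto (fun j => ∫⁻ ω, min (approxLocalTime Z (e j) t ω) K ^ (n + 1) ∂P) atTop
        (𝓝 (∫⁻ ω, min (ENNReal.ofReal (L ω)) K ^ (n + 1) ∂P)) := by
      refine tendsto_lintegral_of_dominated_convergence (fun _ => (K : ℝ≥0∞) ^ (n + 1))
        (fun j => ((measurable_approxLocalTime hZ _ t).min measurable_const).pow_const _)
        (fun j => ae_of_all _ fun ω => pow_le_pow_left₀ zero_le (min_le_right _ _) _) ?_ ?_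
      · simp
      · filter_upwards [hae] with ω hω
        exact ((ENNReal.continuous_pow _).tendsto _).comp (hω.min tendsto_const_nhds)
    have hbound : Tendsto (fun j => ∫⁻ ω, min (approxLocalTime Z (e j) t ω) K ^ (n + 1) ∂P +
        D * (∫⁻ ω, (ENNReal.ofReal (L ω) - K) ∂P +
          ∫⁻ ω, ‖(approxLocalTime Z (e j) t ω).toReal - L ω‖ₑ ∂P)) atTop
        (𝓝 (∫⁻ ω, min (ENNReal.ofReal (L ω)) K ^ (n + 1) ∂P +
          D * (∫⁻ ω, (ENNReal.ofReal (L ω) - K) ∂P + 0))) :=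
      hmin.add (ENNReal.Tendsto.const_mul (hL1.const_add _) (Or.inr hDtop))
    refine (ge_of_tendsto hbound (hev.mono fun j hj => ?_)).trans ?_
    · refine (lintegral_approxLocalTime_pow_succ_le hG hc hZ hσ hτ hc0 hcτ (he0 j) hε hj n
        K).trans ?_
      gcongr
      have hLK : AEMeasurable (fun ω => ENNReal.ofReal (L ω) - K) P := hLm.sub aemeasurable_const
      rw [← lintegral_add_left' hLK]
      refine lintegral_mono fun ω => tsub_le_iff_right.2 ?_
      have h1 : approxLocalTime Z (e j) t ω ≤ ENNReal.ofReal (L ω) +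
          ‖(approxLocalTime Z (e j) t ω).toReal - L ω‖ₑ := by
        rw [← ENNReal.ofReal_toReal (approxLocalTime_ne_top (Z := Z) (he0 j) t ω),
          ENNReal.toReal_ofReal ENNReal.toReal_nonneg, Real.enorm_eq_ofReal_abs]
        refine (ENNReal.ofReal_le_ofReal ?_).trans ENNReal.ofReal_add_le
        linarith [le_abs_self ((approxLocalTime Z (e j) t ω).toReal - L ω)]
      refine h1.trans ?_
      rw [add_right_comm]
      gcongr
      exact le_tsub_add
    · rw [add_zero]
      gcongr
      exact min_le_left _ _
  have hLint : ∫⁻ ω, ENNReal.ofReal (L ω) ∂P ≠ ∞ := by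
    have := (hL.integrable (by norm_num)).lintegral_lt_top
    exact this.ne
  have htail : Tendsto (fun K : ℕ => ∫⁻ ω, (ENNReal.ofReal (L ω) - K) ∂P) atTop (𝓝 0) := by
    have := tendsto_lintegral_of_dominated_convergence' (μ := P)
      (F := fun (K : ℕ) ω => ENNReal.ofReal (L ω) - K) (f := fun _ => 0)
      (fun ω => ENNReal.ofReal (L ω)) (fun K => hLm.sub aemeasurable_const)
      (fun K => ae_of_all _ fun ω => tsub_le_self) hLint (ae_of_all _ fun ω => ?_)
    · simpa using this
    · obtain ⟨N, hN⟩ := exists_nat_ge (L ω)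
      refine tendsto_const_nhds.congr' ((eventually_ge_atTop N).mono fun K hK => ?_)
      rw [eq_comm, tsub_eq_zero_iff_le]
      refine ENNReal.ofReal_le_of_le_toReal ?_
      simp only [ENNReal.toReal_natCast]
      exact hN.trans (by exact_mod_cast hK)
  have hfinal : Tendsto (fun K : ℕ => ∫⁻ ω, ENNReal.ofReal (L ω) ^ (n + 1) ∂P
      + D * ∫⁻ ω, (ENNReal.ofReal (L ω) - K) ∂P) atTop
      (𝓝 (∫⁻ ω, ENNReal.ofReal (L ω) ^ (n + 1) ∂P + D * 0)) :=
    (ENNReal.Tendsto.const_mul htail (Or.inr hDtop)).const_add _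
  rw [mul_zero, add_zero] at hfinal
  exact ge_of_tendsto' hfinal hK

end LocalTimeMoments

/-! ### Uniform variance bound on bounded time intervals -/

section Variance

variable {Ω : Type*} [MeasurableSpace Ω] {d : ℕ}
  {P : Measure Ω} [IsProbabilityMeasure P] {Z : ℝ≥0 → Ω → EuclideanSpace ℝ (Fin d)} {α : ℝ}

omit [IsProbabilityMeasure P] in
-- Self-similarity reduces time s to time 1 with the factor s^{2α}, which is at most t^{2α} because
-- α is positive; Cauchy–Schwarz then handles ξ.
lemma SelfSimilar.integral_inner_sq_le (hself : SelfSimilar P α Z) (hα : 0 < α)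
    (hG : IsGaussianProcess Z P) (t : ℝ≥0) : ∃ σ : ℝ, ∀ s, 0 < s → s ≤ t → ∀ ξ,
      ∫ ω, inner ℝ (Z s ω) ξ ^ 2 ∂P ≤ σ * ‖ξ‖ ^ 2 := by
  have hL : MemLp (Z 1) 2 P := (hG.hasGaussianLaw_eval 1).memLp_two
  have hint : Integrable (fun ω => ‖Z 1 ω‖ ^ 2) P := hL.integrable_norm_pow (by norm_num)
  refine ⟨((t : ℝ) ^ α) ^ 2 * ∫ ω, ‖Z 1 ω‖ ^ 2 ∂P, fun s hs hst ξ => ?_⟩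
  have hm : Measurable fun x : ℝ≥0 → EuclideanSpace ℝ (Fin d) => inner ℝ (x 1) ξ ^ 2 :=
    ((measurable_pi_apply _).inner measurable_const).pow_const 2
  have h := ((hself s hs).comp hm).integral_eq
  simp only [Function.comp_def, mul_one, real_inner_smul_left, mul_pow] at h
  rw [h, integral_const_mul, mul_assoc, ← integral_mul_const]
  have hs' : (0 : ℝ) ≤ s := s.coe_nonneg
  have : (s : ℝ) ^ α ≤ (t : ℝ) ^ α := Real.rpow_le_rpow hs' (by exact_mod_cast hst) hα.le
  have h2 : ∫ ω, inner ℝ (Z 1 ω) ξ ^ 2 ∂P ≤ ∫ ω, ‖Z 1 ω‖ ^ 2 * ‖ξ‖ ^ 2 ∂P := by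
    refine integral_mono_of_nonneg (ae_of_all _ fun ω => sq_nonneg _) (hint.mul_const _)
      (ae_of_all _ fun ω => ?_)
    simp only
    rw [← mul_pow, ← sq_abs]
    gcongr
    exact abs_real_inner_le_norm _ _
  have h3 : 0 ≤ ∫ ω, inner ℝ (Z 1 ω) ξ ^ 2 ∂P := integral_nonneg fun ω => sq_nonneg _
  gcongr

end Variance

/-! ### Exponential moments -/

section ExpMoment

lemma exp_coe_ennreal (x : ℝ≥0∞) : EReal.exp (x : EReal) = ∑' n : ℕ, x ^ n / n.factorial := by
  induction x with
  | top =>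
    rw [EReal.coe_ennreal_top, EReal.exp_top, eq_comm, ENNReal.tsum_eq_top_of_eq_top]
    exact ⟨1, by simp⟩
  | coe r =>
    have : ((r : ℝ≥0∞) : EReal) = ((r : ℝ) : EReal) := rfl
    rw [this, EReal.exp_coe, Real.exp_eq_exp_ℝ, NormedSpace.exp_eq_tsum_div,
      ENNReal.ofReal_tsum_of_nonneg (fun n => by positivity) (Real.summable_pow_div_factorial r)]
    refine tsum_congr fun n => ?_
    rw [ENNReal.ofReal_div_of_pos (by positivity), ENNReal.ofReal_pow r.coe_nonneg,
      ENNReal.ofReal_coe_nnreal, ENNReal.ofReal_natCast]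

variable {Ω : Type*} [MeasurableSpace Ω] {d : ℕ}
  {P : Measure Ω} {Z : ℝ≥0 → Ω → EuclideanSpace ℝ (Fin d)} {γ : Potential d}

lemma lintegral_exp_coe {A : Ω → ℝ≥0∞} (hA : AEMeasurable A P) :
    ∫⁻ ω, EReal.exp (A ω : EReal) ∂P = ∑' n : ℕ, (∫⁻ ω, A ω ^ n ∂P) / n.factorial := by
  simp_rw [exp_coe_ennreal, div_eq_mul_inv]
  rw [lintegral_tsum fun n => (hA.pow_const n).mul_const _]
  refine tsum_congr fun n => lintegral_mul_const' _ _ ?_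
  simp [Nat.factorial_ne_zero]

/-- The exponential moment `𝔼 exp(∫₀ᵗ γ(Z_s) ds)`, as a series of moments. -/
noncomputable def expMoment (P : Measure Ω) (Z : ℝ≥0 → Ω → EuclideanSpace ℝ (Fin d))
    (γ : Potential d) (t : ℝ≥0) : ℝ≥0∞ :=
  ∑' n : ℕ, maxMoment P Z γ n t / n.factorial

variable [IsProbabilityMeasure P] {α : ℝ}

lemma exists_isPathIntegral (hG : IsGaussianProcess Z P) (hc : ∀ t, ∫ ω, Z t ω ∂P = 0)
    (hZ : Measurable (Function.uncurry Z)) {t : ℝ≥0}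
    (h : γ = .delta → maxMoment P Z γ 2 t ≠ ∞) : ∃ A, IsPathIntegral P Z t A γ := by
  cases γ with
  | delta =>
    obtain ⟨L, hL, hlim⟩ := exists_localTime (charLE_self hG hc) hZ t (h rfl)
    refine ⟨fun ω => ENNReal.ofReal (L ω), L, hL, hlim.congr' ?_, ae_of_all _ fun ω => rfl⟩
    filter_upwards [self_mem_nhdsWithin] with ε hε
    simp_rw [integral_heatKernel_eq hZ hε]
  | riesz β => exact ⟨_, ae_of_all _ fun ω => rfl⟩
  | coordinates β => exact ⟨_, ae_of_all _ fun ω => rfl⟩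

omit [IsProbabilityMeasure P] in
lemma IsPathIntegral.exists_localTime (hZ : Measurable (Function.uncurry Z)) {t : ℝ≥0}
    {A : Ω → ℝ≥0∞} (h : IsPathIntegral P Z t A .delta) :
    ∃ L : Ω → ℝ, MemLp L 2 P ∧ Tendsto (fun ε : ℝ => eLpNorm
      (fun ω => (approxLocalTime Z ε t ω).toReal - L ω) 2 P) (𝓝[>] 0) (𝓝 0) ∧
        ∀ᵐ ω ∂P, A ω = ENNReal.ofReal (L ω) := by
  obtain ⟨L, hL, hlim, hA⟩ := h
  refine ⟨L, hL, hlim.congr' ?_, hA⟩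
  filter_upwards [self_mem_nhdsWithin] with ε hε
  simp_rw [integral_heatKernel_eq hZ hε]

/-- For a function potential the supremum in `maxMoment` runs over a single function; for δ the
moments are supplied by `lintegral_localTime_pow`. Infinite values are allowed. -/
lemma IsPathIntegral.lintegral_exp (hself : SelfSimilar P α Z) (hα : 0 < α)
    (hG : IsGaussianProcess Z P) (hc : ∀ t, ∫ ω, Z t ω ∂P = 0)
    (hZ : Measurable (Function.uncurry Z)) {t : ℝ≥0} {A : Ω → ℝ≥0∞}
    (h : IsPathIntegral P Z t A γ) :
    ∫⁻ ω, EReal.exp (A ω : EReal) ∂P = expMoment P Z γ t := by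
  have key : ∀ f, γ.family = {f} → A =ᵐ[P] pathIntegral Z f 0 t →
      ∫⁻ ω, EReal.exp (A ω : EReal) ∂P = expMoment P Z γ t := fun f hf hA => by
    have hfm : Measurable f := Potential.measurable_of_mem_family (γ := γ) (by simp [hf])
    rw [lintegral_exp_coe ((measurable_pathIntegral hZ hfm 0 t).aemeasurable.congr hA.symm)]
    refine tsum_congr fun n => ?_
    rw [maxMoment, hf, iSup_singleton]
    congr 1
    refine lintegral_congr_ae ?_
    filter_upwards [hA] with ω hω
    rw [hω]
  cases γ with
  | delta =>
    obtain ⟨L, hL, hlim, hA⟩ := h.exists_localTime hZ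
    obtain ⟨σ, hσ⟩ := hself.integral_inner_sq_le hα hG t
    have hLm : AEMeasurable (fun ω => ENNReal.ofReal (L ω)) P :=
      hL.aestronglyMeasurable.aemeasurable.ennreal_ofReal
    have hA' : A =ᵐ[P] fun ω => ENNReal.ofReal (L ω) := hA
    rw [lintegral_exp_coe (hLm.congr hA'.symm)]
    refine tsum_congr fun n => ?_
    rw [← lintegral_localTime_pow hG hc hZ hσ hL hlim n]
    congr 1
    refine lintegral_congr_ae ?_
    filter_upwards [hA] with ω hω
    rw [hω]
  | riesz β => exact key _ rfl h
  | coordinates β => exact key _ rfl h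

/-- The existence of the exponential growth rate in terms of moments. -/
lemma hasExpGrowthRate_iff (hself : SelfSimilar P α Z) (hα : 0 < α)
    (hG : IsGaussianProcess Z P) (hc : ∀ t, ∫ ω, Z t ω ∂P = 0)
    (hZ : Measurable (Function.uncurry Z)) {ℓ : ℝ} :
    HasExpGrowthRate P Z γ ℓ ↔ (γ = .delta → ∀ t, maxMoment P Z γ 2 t ≠ ∞) ∧
      Tendsto (fun t : ℝ≥0 => ENNReal.log (expMoment P Z γ t) / ((t : ℝ) : EReal)) atTop
        (𝓝 (ℓ : EReal)) := by
  constructor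
  · rintro ⟨A, hA, hlim⟩
    refine ⟨?_, ?_⟩
    · rintro rfl t
      obtain ⟨L, hL, hlim, -⟩ := (hA t).exists_localTime hZ
      exact maxMoment_two_ne_top (charLE_self hG hc) hZ hL hlim
    · simpa only [(hA _).lintegral_exp hself hα hG hc hZ] using hlim
  · rintro ⟨hfin, hlim⟩
    choose A hA using fun t => exists_isPathIntegral (γ := γ) (t := t) hG hc hZ fun h => hfin h t
    refine ⟨A, hA, ?_⟩
    simpa only [(hA _).lintegral_exp hself hα hG hc hZ] using hlim

end ExpMoment

/-! ### Exponential growth rates and the sandwich argument -/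

section GrowthRate

variable {F G : ℝ≥0 → ℝ≥0∞} {ℓ : ℝ}

lemma tendsto_log_div_iff :
    Tendsto (fun t : ℝ≥0 => ENNReal.log (G t) / ((t : ℝ) : EReal)) atTop (𝓝 (ℓ : EReal)) ↔
      (∀ a < ℓ, ∀ᶠ t : ℝ≥0 in atTop, ENNReal.ofReal (Real.exp (a * t)) ≤ G t) ∧
      ∀ a, ℓ < a → ∀ᶠ t : ℝ≥0 in atTop, G t ≤ ENNReal.ofReal (Real.exp (a * t)) := by
  have hlo : ∀ (a : ℝ) (t : ℝ≥0), 0 < t → ((a : EReal) ≤ ENNReal.log (G t) / ((t : ℝ) : EReal) ↔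
      ENNReal.ofReal (Real.exp (a * t)) ≤ G t) := fun a t ht => by
    have ht' : (0 : ℝ) < t := ht
    rw [EReal.le_div_iff_mul_le (by exact_mod_cast ht') (EReal.coe_ne_top _), ← EReal.coe_mul,
      ← EReal.exp_coe, ← EReal.exp_le_exp_iff, ENNReal.exp_log]
  have hhi : ∀ (a : ℝ) (t : ℝ≥0), 0 < t → (ENNReal.log (G t) / ((t : ℝ) : EReal) ≤ (a : EReal) ↔
      G t ≤ ENNReal.ofReal (Real.exp (a * t))) := fun a t ht => by
    have ht' : (0 : ℝ) < t := ht
    rw [EReal.div_le_iff_le_mul (by exact_mod_cast ht') (EReal.coe_ne_top _), ← EReal.coe_mul,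
      mul_comm (t : ℝ), ← EReal.exp_coe, ← EReal.exp_le_exp_iff, ENNReal.exp_log]
  rw [tendsto_order]
  refine and_congr ⟨fun h a ha => ?_, fun h a ha => ?_⟩ ⟨fun h a ha => ?_, fun h a ha => ?_⟩
  · filter_upwards [h a (by exact_mod_cast ha), eventually_gt_atTop 0] with t h1 ht
    exact (hlo a t ht).1 h1.le
  · obtain ⟨r, har, hr⟩ := EReal.lt_iff_exists_real_btwn.1 ha
    filter_upwards [h r (by exact_mod_cast hr), eventually_gt_atTop 0] with t h1 ht
    exact har.trans_le ((hlo r t ht).2 h1)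
  · filter_upwards [h a (by exact_mod_cast ha), eventually_gt_atTop 0] with t h1 ht
    exact (hhi a t ht).1 h1.le
  · obtain ⟨r, hr, hra⟩ := EReal.lt_iff_exists_real_btwn.1 ha
    filter_upwards [h r (by exact_mod_cast hr), eventually_gt_atTop 0] with t h1 ht
    exact ((hhi r t ht).2 h1).trans_lt hra

lemma eventually_ofReal_exp_le_mul {c : ℝ≥0∞} (hc0 : c ≠ 0) (hc : c ≠ ∞) {p q : ℝ} (h : q < p) :
    ∀ᶠ t : ℝ≥0 in atTop,
      ENNReal.ofReal (Real.exp (q * t)) ≤ c * ENNReal.ofReal (Real.exp (p * t)) := by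
  lift c to ℝ≥0 using hc
  have hc' : (0 : ℝ) < c := by
    rw [NNReal.coe_pos]; exact pos_iff_ne_zero.2 (by exact_mod_cast hc0)
  have h1 : Tendsto (fun t : ℝ≥0 => (p - q) * (t : ℝ)) atTop atTop :=
    (NNReal.tendsto_coe_atTop.2 tendsto_id).const_mul_atTop (sub_pos.2 h)
  filter_upwards [h1.eventually_ge_atTop (-Real.log c)] with t ht
  rw [← ENNReal.ofReal_coe_nnreal, ← ENNReal.ofReal_mul hc'.le]
  refine ENNReal.ofReal_le_ofReal ?_
  rw [← Real.exp_log hc', ← Real.exp_add]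
  exact Real.exp_le_exp.2 (by linarith)

/-- Two functions comparable up to constants and arbitrarily small dilations of time have the same
exponential growth rate. -/
lemma tendsto_log_div_iff_of_sandwich (hle : ∀ t, 0 < t → G t ≤ F t)
    (hge : ∀ b : ℝ≥0, 1 < b → ∃ c : ℝ≥0∞, c ≠ 0 ∧ c ≠ ∞ ∧ ∀ t, 0 < t → c * F t ≤ G (b * t)) :
    Tendsto (fun t : ℝ≥0 => ENNReal.log (F t) / ((t : ℝ) : EReal)) atTop (𝓝 (ℓ : EReal)) ↔
      Tendsto (fun t : ℝ≥0 => ENNReal.log (G t) / ((t : ℝ) : EReal)) atTop (𝓝 (ℓ : EReal)) := by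
  -- The dilation b > 1 is obtained by continuity at 1, which treats positive and negative rates
  -- alike.
  have hb : ∀ {φ : ℝ → ℝ} {s : Set ℝ}, ContinuousAt φ 1 → IsOpen s → φ 1 ∈ s →
      ∃ b : ℝ≥0, 1 < b ∧ φ b ∈ s := fun {φ s} hφ hs h1 => by
    have h2 : ∀ᶠ x in 𝓝[>] (1 : ℝ), φ x ∈ s :=
      nhdsWithin_le_nhds (hφ.eventually (hs.mem_nhds h1))
    obtain ⟨x, hx, hx1⟩ := (h2.and self_mem_nhdsWithin).exists
    have hx1' : (1 : ℝ) < x := hx1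
    exact ⟨⟨x, by linarith⟩, hx1', hx⟩
  rw [tendsto_log_div_iff, tendsto_log_div_iff]
  refine ⟨fun ⟨h1, h2⟩ => ⟨fun a ha => ?_, fun a ha => ?_⟩,
    fun ⟨h1, h2⟩ => ⟨fun a ha => ?_, fun a ha => ?_⟩⟩
  -- Lower rate of G: G(t) ≥ c F(t/b) ≥ c exp(a't/b), with b so close to 1 that a'/b > a; the gap
  -- absorbs c.
  · obtain ⟨a', haa', ha'⟩ := exists_between ha
    obtain ⟨b, hb1, hab⟩ := hb (φ := fun x => a' / x) (s := Set.Ioi a)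
      (continuousAt_const.div continuousAt_id one_ne_zero) isOpen_Ioi (by simpa using haa')
    have hb0 : 0 < b := one_pos.trans hb1
    obtain ⟨c, hc0, hc, hcF⟩ := hge b hb1
    have hdiv : Tendsto (fun t : ℝ≥0 => b⁻¹ * t) atTop atTop :=
      tendsto_id.const_mul_atTop (inv_pos.2 hb0)
    filter_upwards [eventually_ofReal_exp_le_mul hc0 hc (show a < a' / b from hab),
      hdiv.eventually (h1 a' ha'), eventually_gt_atTop 0] with t h3 h4 ht
    have h5 := hcF (b⁻¹ * t) (mul_pos (inv_pos.2 hb0) ht)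
    rw [← mul_assoc, mul_inv_cancel₀ hb0.ne', one_mul] at h5
    refine h3.trans (le_trans ?_ h5)
    gcongr
    convert! h4 using 3
    push_cast
    ring
  · filter_upwards [h2 a ha, eventually_gt_atTop 0] with t h3 ht
    exact (hle t ht).trans h3
  · filter_upwards [h1 a ha, eventually_gt_atTop 0] with t h3 ht
    exact h3.trans (hle t ht)
  -- Upper rate of F: c F(t) ≤ G(bt) ≤ exp(a'bt), with a'b < a.
  · obtain ⟨a', ha', haa'⟩ := exists_between ha
    obtain ⟨b, hb1, hab⟩ := hb (φ := fun x => a' * x) (s := Set.Iio a)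
      (continuousAt_const.mul continuousAt_id) isOpen_Iio (by simpa using haa')
    have hb0 : 0 < b := one_pos.trans hb1
    obtain ⟨c, hc0, hc, hcF⟩ := hge b hb1
    have hmul : Tendsto (fun t : ℝ≥0 => b * t) atTop atTop :=
      tendsto_id.const_mul_atTop hb0
    filter_upwards [eventually_ofReal_exp_le_mul hc0 hc (show a' * b < a from hab),
      hmul.eventually (h2 a' ha'), eventually_gt_atTop 0] with t h3 h4 ht
    refine (ENNReal.mul_le_mul_iff_right hc0 hc).1 ((hcF t ht).trans (h4.trans (le_trans ?_ h3)))
    rw [NNReal.coe_mul, mul_assoc]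

end GrowthRate

/-! ### Transfer of finite moments -/

section Finiteness

variable {Ω Ω' : Type*} [MeasurableSpace Ω] [MeasurableSpace Ω'] {d : ℕ}
  {P : Measure Ω} [IsProbabilityMeasure P] {P' : Measure Ω'} [IsProbabilityMeasure P']
  {X : ℝ≥0 → Ω → EuclideanSpace ℝ (Fin d)} {Y : ℝ≥0 → Ω' → EuclideanSpace ℝ (Fin d)}
  {γ : Potential d}

omit [IsProbabilityMeasure P] in
lemma maxMoment_zero_time {n : ℕ} (hn : n ≠ 0) : maxMoment P X γ n 0 = 0 := by
  simp [maxMoment, pathIntegral, hn]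

omit [IsProbabilityMeasure P] [IsProbabilityMeasure P'] in
lemma maxMoment_ne_top_iff_of_sandwich {n : ℕ} (hn : n ≠ 0)
    (hle : ∀ t, maxMoment P' Y γ n t ≤ maxMoment P X γ n t)
    (hge : ∃ b : ℝ≥0, ∃ c : ℝ≥0∞, c ≠ 0 ∧ ∀ t, 0 < t →
      c * maxMoment P X γ n t ≤ maxMoment P' Y γ n (b * t)) :
    (∀ t, maxMoment P X γ n t ≠ ∞) ↔ ∀ t, maxMoment P' Y γ n t ≠ ∞ := by
  refine ⟨fun h t => ((hle t).trans_lt (h t).lt_top).ne, fun h t htop => ?_⟩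
  obtain ⟨b, c, hc0, hc⟩ := hge
  rcases eq_or_ne t 0 with rfl | ht
  · simp [maxMoment_zero_time hn] at htop
  · have := hc t (pos_iff_ne_zero.2 ht)
    rw [htop, ENNReal.mul_top hc0, top_le_iff] at this
    exact h _ this

end Finiteness

end GaussianComparison

/-! ### Equivalence of the two growth rates -/

theorem mainTheorem4 {Ω Ω' : Type*} [MeasurableSpace Ω] [MeasurableSpace Ω']
    (P : Measure Ω) [IsProbabilityMeasure P] (P' : Measure Ω') [IsProbabilityMeasure P']
    (d : ℕ) (X η : ℝ≥0 → Ω → EuclideanSpace ℝ (Fin d)) (Y : ℝ≥0 → Ω' → EuclideanSpace ℝ (Fin d))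
    (hXmeas : Measurable (Function.uncurry X)) (hYmeas : Measurable (Function.uncurry Y))
    (hηmeas : ∀ t, Measurable (η t))
    (hXgauss : IsGaussianProcess X P) (hYgauss : IsGaussianProcess Y P')
    (hηgauss : IsGaussianProcess η P)
    (hXcent : ∀ t, ∫ ω, X t ω ∂P = 0) (hYcent : ∀ t, ∫ ω, Y t ω ∂P' = 0)
    (hηcent : ∀ t, ∫ ω, η t ω ∂P = 0)
    (α : ℝ) (hα : 0 < α)
    (hXself : GaussianComparison.SelfSimilar P α X)
    (hYself : GaussianComparison.SelfSimilar P' α Y)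
    (hlaw : IdentDistrib (fun ω (t : ℝ≥0) => Y t ω) (fun ω (t : ℝ≥0) => X t ω + η t ω) P' P)
    (hindep : IndepFun (fun ω (t : ℝ≥0) => X t ω) (fun ω (t : ℝ≥0) => η t ω) P)
    (hRKHS : ∀ ε : ℝ≥0, 0 < ε → ε < 1 → ∃ ηε : ℝ≥0 → Ω → EuclideanSpace ℝ (Fin d),
      (∀ t, Measurable (ηε t)) ∧ (∀ t, ε ≤ t → ∀ᵐ ω ∂P, ηε t ω = η t ω) ∧
      ∀ᵐ ω ∂P, GaussianComparison.MemRKHS P (fun t : Set.Icc (0 : ℝ≥0) 1 => X t)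
        (fun t => ηε t ω))
    (γ : GaussianComparison.Potential d) (hγ : γ.Admissible) (hαγ : α * γ.degree < 1) :
    ((∃ ℓ : ℝ, GaussianComparison.HasExpGrowthRate P X γ ℓ) ∨
      (∃ ℓ : ℝ, GaussianComparison.HasExpGrowthRate P' Y γ ℓ)) →
    ∃ ℓ : ℝ, GaussianComparison.HasExpGrowthRate P X γ ℓ ∧
      GaussianComparison.HasExpGrowthRate P' Y γ ℓ := by
  have hXt : ∀ t, Measurable (X t) := fun t => hXmeas.comp measurable_prodMk_left
  have hchar : GaussianComparison.CharLE P' Y P X := GaussianComparison.CharLE.of_identDistrib hlaw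
    (GaussianComparison.charLE_add hXgauss hXt hηmeas hXcent hindep)
  have hle : ∀ n t, GaussianComparison.maxMoment P' Y γ n t
      ≤ GaussianComparison.maxMoment P X γ n t := fun n t =>
    hchar.maxMoment_le hYmeas hXmeas hγ n t
  have hge : ∀ b : ℝ≥0, 1 < b → ∃ c : ℝ≥0∞, c ≠ 0 ∧ c ≠ ∞ ∧ ∀ (n : ℕ) (t : ℝ≥0), 0 < t →
      c * GaussianComparison.maxMoment P X γ n t
        ≤ GaussianComparison.maxMoment P' Y γ n (b * t) := fun b hb => by
    refine GaussianComparison.exists_maxMoment_le_mul hXmeas hYmeas hXself hYself hαγ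
      (fun ε hε0 hε1 => ?_) hb
    obtain ⟨c, hc0, hc, h⟩ := GaussianComparison.exists_const_mul_le_of_rkhs hXgauss hXt hηmeas
      hXcent hindep ε ((hRKHS ε hε0 hε1).imp fun ηε h => ⟨h.2.1, h.2.2⟩)
    refine ⟨c, hc0, hc, fun n s hs f hf hfe => (h n s hs f hf hfe).trans_eq ?_⟩
    have hm : Measurable fun x : ℝ≥0 → EuclideanSpace ℝ (Fin d) => ∏ i, f (x (s i)) :=
      Finset.measurable_prod _ fun i _ => hf.comp (measurable_pi_apply _)
    exact (hlaw.comp hm).lintegral_eq.symm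
  -- Finite second moments are the criterion for local times to exist, so in the Dirac case both
  -- functionals are defined or neither is.
  have hfin : (∀ t, GaussianComparison.maxMoment P X γ 2 t ≠ ∞) ↔
      ∀ t, GaussianComparison.maxMoment P' Y γ 2 t ≠ ∞ := by
    obtain ⟨c, hc0, -, hc⟩ := hge 2 one_lt_two
    exact GaussianComparison.maxMoment_ne_top_iff_of_sandwich two_ne_zero (hle 2)
      ⟨2, c, hc0, hc 2⟩
  have hiff : ∀ ℓ : ℝ, GaussianComparison.HasExpGrowthRate P X γ ℓ ↔
      GaussianComparison.HasExpGrowthRate P' Y γ ℓ := fun ℓ => by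
    rw [GaussianComparison.hasExpGrowthRate_iff hXself hα hXgauss hXcent hXmeas,
      GaussianComparison.hasExpGrowthRate_iff hYself hα hYgauss hYcent hYmeas, hfin,
      GaussianComparison.tendsto_log_div_iff_of_sandwich
        (G := GaussianComparison.expMoment P' Y γ)]
    · exact fun t _ => ENNReal.tsum_le_tsum fun n => ENNReal.div_le_div_right (hle n t) _
    · intro b hb
      obtain ⟨c, hc0, hc, h⟩ := hge b hb
      -- Since c does not depend on n, it factors out of the series of moments.
      refine ⟨c, hc0, hc, fun t ht => ?_⟩
      rw [GaussianComparison.expMoment, ← ENNReal.tsum_mul_left]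
      refine ENNReal.tsum_le_tsum fun n => ?_
      rw [← mul_div_assoc]
      exact ENNReal.div_le_div_right (h n t ht) _
  rintro (⟨ℓ, h⟩ | ⟨ℓ, h⟩)
  · exact ⟨ℓ, h, (hiff ℓ).1 h⟩
  · exact ⟨ℓ, (hiff ℓ).2 h, h⟩
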